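/- **Setting.** Consider a time-varying tabular MDP with finite state space $\mathcal S$, finite action space $\mathcal A$ ($S=|\mathcal S|$, $A=|\mathcal A|$), horizon $H$, initial distribution $d_1$ and kernels $P_1,\dots,P_H$; given $(s_h,a_h)$, the random reward $r_h\in\mathbb R$ has a law depending on $(h,s_h,a_h)$ and is independent of $s_{h+1}\sim P_h(\cdot|s_h,a_h)$. For a (randomized) policy $\pi=(\pi_h)$ let $v^\pi=\mathbb E_\pi[\sum_{h=1}^H r_h]$, $v^\star=\sup_\pi v^\pi$, and $d_h^\pi(s,a)=\mathbb P_\pi[s_h=s]\,\pi_h(a|s)$. The data $\mathcal D$ are $n$ i.i.d. episodes $(s_h^\tau,a_h^\tau,r_h^\tau)$ generated by a behavior policy $\mu$. Assume: (i) bounded total reward: $r_h\ge 0$ for all $h$ and $\sum_{h=1}^H r_h\le 1$ almost surely under every policy; (ii) uniform coverage: $d_m:=\min d_h^\mu(s,a)>0$, the minimum being over all $h\in[H]$, all states $s$ that some policy reaches at step $h$ with positive probability, and all $a\in\mathcal A$. **Algorithm (APVI).** Fix $\delta\in(0,1)$, $\iota=\log(HSA/\delta)$ and a constant $C>0$. Let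 $n_{s,a}$ be the number of episodes with $(s_h^\tau,a_h^\tau)=(s,a)$. If $n_{s,a}\ge1$, let $\widehat P_h(\cdot|s,a)$ be the empirical distribution of the next states and $\widehat r_h(s,a)$ the average of the rewards over these episodes; if $n_{s,a}=0$, let $\widehat P_h(\cdot|s,a)=1/S$ and $\widehat r_h(s,a)=0$. Put $\widehat V_{H+1}=0$. For $h=H,\dots,1$ put $$\Gamma_h(s,a)=2\sqrt{\frac{\mathrm{Var}_{s'\sim\widehat P_h(\cdot|s,a)}\big(\widehat r_h(s,a)+\widehat V_{h+1}(s')\big)\,\iota}{n_{s,a}}}+\frac{14H\iota}{n_{s,a}}\ \text{ if } n_{s,a}\ge 1,\qquad \Gamma_h(s,a)=CH\iota\ \text{ if } n_{s,a}=0,$$ $$\overline Q_h=\max\big\{\min\{\widehat r_h+\widehat P_h\widehat V_{h+1}-\Gamma_h,\;H-h+1\},\,0\big\},$$ choose $\widehat\pi_h(\cdot|s)\in\arg\max_{q}\langle\overline Q_h(s,\cdot),q\rangle$ over distributions $q$ on $\mathcal A$, and put $\widehat V_h(s)=\langle\overline Q_h(s,\cdot),\widehat\pi_h(\cdot|s)\rangle$.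 The output is $\widehat\pi=(\widehat\pi_h)_{h\in[H]}$. **Proposition.** There are absolute constants $c_0,C_1,C_2>0$ such that, for every MDP, behavior policy, $n$, $\delta\in(0,1)$ and $C>0$ as above with (i), (ii) and $n>c_0\,\iota/d_m$, with probability at least $1-\delta$ every output $\widehat\pi$ of APVI (however ties are broken) satisfies $$0\le v^\star-v^{\widehat\pi}\le C_1\sqrt{\frac{H\,\iota}{n\,d_m}}+C_2\,\frac{H^3\,\iota}{n\,d_m}.$$ That is, the suboptimality is $\widetilde O(\sqrt{H/(n d_m)})$ up to a logarithmic factor and a higher-order term. -/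

import Mathlib

open MeasureTheory

noncomputable section

namespace OfflineRL

universe u v

/-- A finite-horizon time-varying Markov decision process with finite state space `S`, finite action
space `A` and horizon `H`. Step `h : Fin H` is the time step `h + 1` in the usual 1-based counting.
Given `(s_h, a_h) = (s, a)`, the next state has law `trans h s a` and the (random) instantaneous
reward has law `reward h s a`, independently of the next state. -/
structure MDP (S : Type u) (A : Type v) [Fintype S] (H : ℕ) where
  init : S → ℝ
  init_mem : init ∈ stdSimplex ℝ S
  trans : Fin H → S → A → S → ℝ
  trans_mem : ∀ h s a, trans h s a ∈ stdSimplex ℝ S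
  reward : Fin H → S → A → ProbabilityMeasure ℝ

/-- A (randomized, time-dependent) Markov policy. -/
structure Policy (S : Type u) (A : Type v) [Fintype A] (H : ℕ) where
  prob : Fin H → S → A → ℝ
  prob_mem : ∀ h s, prob h s ∈ stdSimplex ℝ A

/-- A trajectory `(s_1, …, s_{H+1})`, `(a_1, …, a_H)`, `(r_1, …, r_H)`. -/
abbrev Trajectory (S : Type u) (A : Type v) (H : ℕ) : Type (max u v) :=
  (Fin (H + 1) → S) × (Fin H → A) × (Fin H → ℝ)

namespace Trajectory

variable {S : Type u} {A : Type v} {H : ℕ}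

/-- `s_h`, for `h = 1, …, H + 1`. -/
def state (ω : Trajectory S A H) (h : Fin (H + 1)) : S := ω.1 h

/-- `a_h`. -/
def action (ω : Trajectory S A H) (h : Fin H) : A := ω.2.1 h

/-- `r_h`. -/
def rew (ω : Trajectory S A H) (h : Fin H) : ℝ := ω.2.2 h

end Trajectory

section Model

variable {S : Type u} {A : Type v} [Fintype S] [Fintype A] {H : ℕ}

namespace MDP

/-- Probability that following `π` produces the given state and action sequences. -/
def pathProb (M : MDP S A H) (π : Policy S A H) (s : Fin (H + 1) → S) (a : Fin H → A) : ℝ :=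
  M.init (s 0) *
    ∏ h : Fin H, π.prob h (s h.castSucc) (a h) * M.trans h (s h.castSucc) (a h) (s h.succ)

variable [DecidableEq S] [DecidableEq A] [MeasurableSpace S] [MeasurableSpace A]

/-- The law of the trajectory generated by following the policy `π` in `M`: the mixture over all
state-action sequences; given such a sequence, the rewards are independent with `r_h` distributed
as `reward h s_h a_h`. -/
def law (M : MDP S A H) (π : Policy S A H) : Measure (Trajectory S A H) :=
  ∑ p : (Fin (H + 1) → S) × (Fin H → A),
    ENNReal.ofReal (M.pathProb π p.1 p.2) •
      (Measure.dirac p.1).prod ((Measure.dirac p.2).prod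
        (Measure.pi fun h : Fin H => (M.reward h (p.1 h.castSucc) (p.2 h) : Measure ℝ)))

/-- `v^π = E_π[∑_h r_h]`. -/
def value (M : MDP S A H) (π : Policy S A H) : ℝ :=
  ∫ ω, ∑ h, ω.rew h ∂(M.law π)

/-- `v^⋆`, the supremum of `v^π` over all policies. -/
def optValue (M : MDP S A H) : ℝ := ⨆ π : Policy S A H, M.value π

/-- `P[s_h = s]` under the policy `π`. -/
def stateOcc (M : MDP S A H) (π : Policy S A H) (h : Fin H) (s : S) : ℝ :=
  (M.law π).real {ω | ω.state h.castSucc = s}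

/-- The marginal state-action occupancy `d^π_h(s, a) = P[s_h = s] π_h(a | s)`. -/
def occ (M : MDP S A H) (π : Policy S A H) (h : Fin H) (s : S) (a : A) : ℝ :=
  M.stateOcc π h s * π.prob h s a

/-- Some policy visits the state `s` at step `h` with positive probability. -/
def Reachable (M : MDP S A H) (h : Fin H) (s : S) : Prop :=
  ∃ π : Policy S A H, 0 < M.stateOcc π h s

/-- `d_m`: the minimum of `d^μ_h(s, a)` over all steps `h`, all states `s` reachable at step `h` and
all actions `a`. -/
def dMin (M : MDP S A H) (μ : Policy S A H) : ℝ :=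
  sInf {x | ∃ h s a, M.Reachable h s ∧ x = M.occ μ h s a}

/-- Uniform data coverage of the behavior policy `μ`. -/
def UniformCoverage (M : MDP S A H) (μ : Policy S A H) : Prop := 0 < M.dMin μ

/-- Along the trajectories of every policy, the rewards are nonnegative and sum to at most one. -/
def BoundedTotalReward (M : MDP S A H) : Prop :=
  ∀ π : Policy S A H, ∀ᵐ ω ∂(M.law π), (∀ h, 0 ≤ ω.rew h) ∧ ∑ h, ω.rew h ≤ 1

/-- The law of `n` independent episodes rolled out from the behavior policy `μ`. -/
def dataLaw (M : MDP S A H) (μ : Policy S A H) (n : ℕ) : Measure (Fin n → Trajectory S A H) :=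
  Measure.pi fun _ => M.law μ

end MDP

end Model

section Algorithm

variable {S : Type u} {A : Type v} [Fintype S] [Fintype A] [DecidableEq S] [DecidableEq A]
  {H n : ℕ}

/-- `n_{s_h, a_h}`: the number of episodes that visit `(s, a)` at step `h`. -/
def count (D : Fin n → Trajectory S A H) (h : Fin H) (s : S) (a : A) : ℕ :=
  (Finset.univ.filter fun τ => (D τ).state h.castSucc = s ∧ (D τ).action h = a).card

/-- The empirical transition kernel. -/
def transHat (D : Fin n → Trajectory S A H) (h : Fin H) (s : S) (a : A) (s' : S) : ℝ :=
  if count D h s a = 0 then 1 / (Fintype.card S : ℝ)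
  else ((Finset.univ.filter fun τ => (D τ).state h.castSucc = s ∧ (D τ).action h = a ∧
      (D τ).state h.succ = s').card : ℝ) / (count D h s a : ℝ)

/-- The empirical mean reward. -/
def rewHat (D : Fin n → Trajectory S A H) (h : Fin H) (s : S) (a : A) : ℝ :=
  if count D h s a = 0 then 0
  else (∑ τ, if (D τ).state h.castSucc = s ∧ (D τ).action h = a then (D τ).rew h else 0) /
    (count D h s a : ℝ)

/-- The expectation of `f` under the weights `p`. -/
def wMean (p f : S → ℝ) : ℝ := ∑ x, p x * f x

/-- The variance of `f` under the weights `p`. -/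
def wVar (p f : S → ℝ) : ℝ := ∑ x, p x * (f x - wMean p f) ^ 2

/-- `ι = log(H S A / δ)`. -/
def logTerm (S : Type u) (A : Type v) [Fintype S] [Fintype A] (H : ℕ) (δ : ℝ) : ℝ :=
  Real.log ((H : ℝ) * Fintype.card S * Fintype.card A / δ)

/-- The pessimistic penalty `Γ_h(s, a)`, where `V` is the current estimate of the value at step
`h + 1`. Here `C` is the constant of the penalty at pairs that are never visited. -/
def penalty (C δ : ℝ) (D : Fin n → Trajectory S A H) (h : Fin H) (V : S → ℝ) (s : S) (a : A) : ℝ :=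
  if 1 ≤ count D h s a then
    2 * Real.sqrt (wVar (transHat D h s a) (fun s' => rewHat D h s a + V s') * logTerm S A H δ /
        (count D h s a : ℝ))
      + 14 * H * logTerm S A H δ / (count D h s a : ℝ)
  else C * H * logTerm S A H δ

/-- The pessimistic Q-estimate: `r̂ + P̂ V - Γ` truncated to `[0, H - h + 1]` in 1-based counting
of `h`. -/
def qBar (C δ : ℝ) (D : Fin n → Trajectory S A H) (h : Fin H) (V : S → ℝ) (s : S) (a : A) : ℝ :=
  max (min (rewHat D h s a + wMean (transHat D h s a) V - penalty C δ D h V s a)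
    ((H : ℝ) - (h : ℕ))) 0

/-- `π` is an output of adaptive pessimistic value iteration on the data `D`: there are values
`V̂_1, …, V̂_{H+1}` with `V̂_{H+1} = 0` such that, for each `h` and `s`, `π_h(· | s)` maximizes
`⟨Q̄_h(s, ·), q⟩` over all distributions `q` on actions, and `V̂_h(s) = ⟨Q̄_h(s, ·), π_h(· | s)⟩`.
Ties in the maximization may be broken arbitrarily. -/
def IsAPVIOutput (C δ : ℝ) (D : Fin n → Trajectory S A H) (π : Policy S A H) : Prop :=
  ∃ V : Fin (H + 1) → S → ℝ,
    (∀ s, V (Fin.last H) s = 0) ∧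
    ∀ (h : Fin H) (s : S),
      (∀ q ∈ stdSimplex ℝ A, ∑ a, qBar C δ D h (V h.succ) s a * q a ≤
        ∑ a, qBar C δ D h (V h.succ) s a * π.prob h s a) ∧
      V h.castSucc s = ∑ a, qBar C δ D h (V h.succ) s a * π.prob h s a

end Algorithm

end OfflineRL

end

/-! Put `e = √(5ι / (n d_m))`. Coverage makes the visit counts of all relevant `(h, s, a)` accurate
up to a relative error of order `e`. Bernstein's inequality then estimates the mean reward `r` up to
`O(√r e + e²)` and the next-state mean of the optimal value `V` up to `O(σ e + e²)`, where `σ` is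
the standard deviation of `V` at the next state. Two difficulties remain.

The first is that the value estimate at step `h + 1` is correlated with the empirical kernel at step
`h`, and a bound uniform over functions of the next state would cost a power of `S`. The remedy is
to reverse time. Given everything after step `h`, the visits of `(s, a)` in the different episodes
are independent Bernoulli variables whose parameter `backProb` depends only on the next state
(`MDP.law_visit_inter_tail`), while the value estimate at `h + 1` is a function of these later data
(`vHat_tail`). So the error `valueErr` can be used as a frozen weight in Bernstein's inequality
(`measure_pi_le_of_resample`, `MDP.dataLaw_weighted`). What is left is the fluctuation of the state
frequencies at step `h + 1`; it is relative, hence harmless after averaging. This is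
`GoodData.abs_wMean_valueErr_le`: the kernel error on `valueErr` is `O(e ‖valueErr‖)`. A crude
induction, `AccurateData.norm_valueErr_le`, gives `‖valueErr‖ = O(H² e)`, so this contribution is
`O(H² e²)` per step and `O(H³ e²)` in total.

The second is that adding `√r e + σ e` over the horizon naively gives `H e` instead of `√H e`. Total
reward at most one gives `0 ≤ V ≤ 1`, and by the law of total variance `3V - V²` drops in
expectation by at least `r + σ²` in each step, for every action, because `V` dominates every
one-step Bellman backup. With the AM-GM inequality this makes `potential` pay for all one-step
errors (`AccurateData.error_add_potential_le`). Along an optimal action it gives `V ≤ vHat +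
potential`; along the learned policy it gives value at least `vHat - potential`. The potential is at
most `8l + Hc`, and `l = e √H` yields the rate.

The one-step errors are bounded in absolute value, the penalty being one more term of the same size.
The argument does not rely on the penalty dominating the estimation error. -/

namespace OfflineRL

/-! ### Bernstein's inequality for independent bounded variables. -/

section Concentration

variable {Ω : Type*} [MeasurableSpace Ω]

lemma integrable_of_ae_abs_le {ν : Measure Ω} [IsFiniteMeasure ν] {f : Ω → ℝ} {c : ℝ}
    (hf : Measurable f) (hb : ∀ᵐ x ∂ν, |f x| ≤ c) : Integrable f ν :=
  Integrable.of_bound hf.aestronglyMeasurable c (by simpa [Real.norm_eq_abs] using hb)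

/-- Moment generating function bound for a bounded centred random variable. -/
lemma integral_exp_mul_le {ν : Measure Ω} [IsProbabilityMeasure ν] {f : Ω → ℝ}
    (hf : Measurable f) (hb : ∀ᵐ x ∂ν, |f x| ≤ 1) (h0 : ∫ x, f x ∂ν = 0) {l : ℝ}
    (hl0 : 0 ≤ l) (hl1 : l ≤ 1) :
    ∫ x, Real.exp (l * f x) ∂ν ≤ Real.exp (l ^ 2 * ∫ x, f x ^ 2 ∂ν) := by
  have hi : Integrable f ν := integrable_of_ae_abs_le hf hb
  have hi2 : Integrable (fun x => f x ^ 2) ν := by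
    refine integrable_of_ae_abs_le (c := 1) (by fun_prop) ?_
    filter_upwards [hb] with x hx
    rw [abs_of_nonneg (sq_nonneg _), ← sq_abs]
    exact pow_le_one₀ (abs_nonneg _) hx
  have hie : Integrable (fun x => Real.exp (l * f x)) ν := by
    refine integrable_of_ae_abs_le (c := Real.exp 1) (by fun_prop) ?_
    filter_upwards [hb] with x hx
    rw [abs_of_pos (Real.exp_pos _)]
    apply Real.exp_le_exp.2
    have := abs_le.1 hx
    nlinarith
  calc ∫ x, Real.exp (l * f x) ∂ν ≤ ∫ x, (1 + l * f x + l ^ 2 * f x ^ 2) ∂ν := by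
        refine integral_mono_ae hie (by fun_prop) ?_
        filter_upwards [hb] with x hx
        -- The inequality used is `exp y ≤ 1 + y + y²` for `|y| ≤ 1`.
        have h1 : |l * f x| ≤ 1 := by
          rw [abs_mul, abs_of_nonneg hl0]
          exact mul_le_one₀ hl1 (abs_nonneg _) hx
        have h2 := (abs_le.1 (Real.abs_exp_sub_one_sub_id_le h1)).2
        nlinarith
    _ = 1 + l ^ 2 * ∫ x, f x ^ 2 ∂ν := by
        rw [integral_add (by fun_prop) (by fun_prop), integral_add (by fun_prop) (by fun_prop),
          integral_const_mul, integral_const_mul, h0]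
        norm_num
    _ ≤ _ := by
        have := Real.add_one_le_exp (l ^ 2 * ∫ x, f x ^ 2 ∂ν)
        linarith

/-- One-sided Bernstein inequality for sums of independent bounded centred variables. -/
lemma bernstein_one_sided {n : ℕ} {ν : Measure Ω} [IsProbabilityMeasure ν] {f : Fin n → Ω → ℝ}
    (hf : ∀ i, Measurable (f i)) (hb : ∀ i, ∀ᵐ x ∂ν, |f i x| ≤ 1)
    (h0 : ∀ i, ∫ x, f i x ∂ν = 0) {V L : ℝ} (hV : ∑ i, ∫ x, f i x ^ 2 ∂ν ≤ V) (hL : 0 ≤ L) :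
    Measure.pi (fun _ : Fin n => ν) {x | 2 * Real.sqrt (V * L) + 2 * L < ∑ i, f i (x i)} ≤
      ENNReal.ofReal (Real.exp (-L)) := by
  rcases hL.eq_or_lt with rfl | hL
  · simpa using prob_le_one
  have hV0 : 0 ≤ V := le_trans (Finset.sum_nonneg fun i _ => integral_nonneg fun x => sq_nonneg _) hV
  set t := 2 * Real.sqrt (V * L) + 2 * L with ht
  -- The Chernoff parameter is `√(L / V)` when this is at most one, and is capped at one otherwise,
  -- since the moment bound requires `l ≤ 1`.
  obtain ⟨l, hl0, hl1, hlt⟩ : ∃ l : ℝ, 0 ≤ l ∧ l ≤ 1 ∧ l ^ 2 * V - l * t ≤ -L := by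
    rcases le_or_gt L V with h | h
    · have hVp : 0 < V := hL.trans_le h
      refine ⟨Real.sqrt (L / V), Real.sqrt_nonneg _, ?_, ?_⟩
      · exact Real.sqrt_le_one.2 ((div_le_one hVp).2 h)
      · rw [Real.sq_sqrt (by positivity), div_mul_cancel₀ _ hVp.ne']
        have h1 : Real.sqrt (L / V) * Real.sqrt (V * L) = L := by
          rw [← Real.sqrt_mul (by positivity)]
          rw [show L / V * (V * L) = L ^ 2 by field_simp]
          exact Real.sqrt_sq hL.le
        have h2 : 0 ≤ Real.sqrt (L / V) * L := by positivity
        rw [ht]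
        nlinarith
    · refine ⟨1, zero_le_one, le_rfl, ?_⟩
      have := Real.sqrt_nonneg (V * L)
      rw [ht]
      linarith
  have hie : ∀ i, Integrable (fun x => Real.exp (l * f i x)) ν := by
    intro i
    refine integrable_of_ae_abs_le (c := Real.exp 1) (by have := hf i; fun_prop) ?_
    filter_upwards [hb i] with x hx
    rw [abs_of_pos (Real.exp_pos _)]
    apply Real.exp_le_exp.2
    have := abs_le.1 hx
    nlinarith
  have hint : Integrable (fun x : Fin n → Ω => ∏ i, Real.exp (l * f i (x i)))
      (Measure.pi fun _ => ν) := Integrable.fintype_prod (f := fun i x => Real.exp (l * f i x)) hie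
  have hmgf : ∫ x : Fin n → Ω, ∏ i, Real.exp (l * f i (x i)) ∂(Measure.pi fun _ => ν) ≤
      Real.exp (l ^ 2 * V) := by
    rw [integral_fintype_prod_eq_prod (fun i x => Real.exp (l * f i x))]
    calc ∏ i, ∫ x, Real.exp (l * f i x) ∂ν
        ≤ ∏ i, Real.exp (l ^ 2 * ∫ x, f i x ^ 2 ∂ν) :=
          Finset.prod_le_prod (fun i _ => integral_nonneg fun x => (Real.exp_pos _).le)
            fun i _ => integral_exp_mul_le (hf i) (hb i) (h0 i) hl0 hl1
      _ = Real.exp (l ^ 2 * ∑ i, ∫ x, f i x ^ 2 ∂ν) := by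
          rw [← Real.exp_sum, Finset.mul_sum]
      _ ≤ _ := by
          apply Real.exp_le_exp.2
          gcongr
  have hmk := mul_meas_ge_le_integral_of_nonneg
    (Filter.Eventually.of_forall fun x => Finset.prod_nonneg fun i _ => (Real.exp_pos _).le)
    hint (Real.exp (l * t))
  have hsub : {x : Fin n → Ω | t < ∑ i, f i (x i)} ⊆
      {x | Real.exp (l * t) ≤ ∏ i, Real.exp (l * f i (x i))} := by
    intro x hx
    simp only [Set.mem_ofPred_eq] at hx ⊢
    rw [← Real.exp_sum, ← Finset.mul_sum]
    apply Real.exp_le_exp.2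
    gcongr
  refine (measure_mono hsub).trans ?_
  rw [← ofReal_measureReal]
  apply ENNReal.ofReal_le_ofReal
  have h3 : Real.exp (l * t) * (Measure.pi fun _ : Fin n => ν).real
      {x | Real.exp (l * t) ≤ ∏ i, Real.exp (l * f i (x i))} ≤ Real.exp (l * t) * Real.exp (-L) := by
    refine (hmk.trans hmgf).trans ?_
    rw [← Real.exp_add]
    apply Real.exp_le_exp.2
    linarith
  exact le_of_mul_le_mul_left h3 (Real.exp_pos _)

/-- Two-sided Bernstein inequality for sums of independent bounded centred variables. -/
lemma bernstein {n : ℕ} {ν : Measure Ω} [IsProbabilityMeasure ν] {f : Fin n → Ω → ℝ}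
    (hf : ∀ i, Measurable (f i)) (hb : ∀ i, ∀ᵐ x ∂ν, |f i x| ≤ 1)
    (h0 : ∀ i, ∫ x, f i x ∂ν = 0) {V L : ℝ} (hV : ∑ i, ∫ x, f i x ^ 2 ∂ν ≤ V) (hL : 0 ≤ L) :
    Measure.pi (fun _ : Fin n => ν) {x | 2 * Real.sqrt (V * L) + 2 * L < |∑ i, f i (x i)|} ≤
      2 * ENNReal.ofReal (Real.exp (-L)) := by
  have h1 := bernstein_one_sided hf hb h0 hV hL
  have h2 := bernstein_one_sided (f := fun i x => -f i x) (V := V) (fun i => (hf i).neg)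
    (fun i => by simpa using hb i) (fun i => by rw [integral_neg, h0, neg_zero])
    (by simpa using hV) hL
  rw [two_mul (ENNReal.ofReal _)]
  refine le_trans (measure_mono ?_) ((measure_union_le _ _).trans (add_le_add h1 h2))
  intro x hx
  simp only [Set.mem_ofPred_eq, lt_abs, Set.mem_union, Finset.sum_neg_distrib] at hx ⊢
  exact hx

end Concentration

/-! ### Replacing an event by its conditional probability given a statistic. -/

section Resampling

open Set

variable {Ω Θ : Type*} [MeasurableSpace Ω] [MeasurableSpace Θ]

lemma measurable_decide {p : Ω → Prop} [DecidablePred p] (hp : MeasurableSet {x | p x}) :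
    Measurable fun x => decide (p x) := by
  apply measurable_to_bool
  convert hp using 1
  ext x
  simp

/-- If, given the statistic `t`, the event `X` has conditional probability `b ∘ t`, then the pair
(indicator of `X`, `t`) has the same law as (`u ≤ b`, `t`) for an independent uniform `u`. -/
lemma map_indicator_eq_resample {ν : Measure Ω} [IsProbabilityMeasure ν] {X : Set Ω}
    [DecidablePred (· ∈ X)] (hX : MeasurableSet X) {t : Ω → Θ} (ht : Measurable t) {b : Θ → ℝ}
    (hb : Measurable b) (hb1 : ∀ x, b x ≤ 1)
    (h : ∀ E, MeasurableSet E → ν (X ∩ t ⁻¹' E) = ∫⁻ x in t ⁻¹' E, ENNReal.ofReal (b (t x)) ∂ν) :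
    ν.map (fun x => (decide (x ∈ X), t x)) =
      ((ν.map t).prod (volume.restrict (Icc (0 : ℝ) 1))).map
        (fun p => (decide (p.2 ≤ b p.1), p.1)) := by
  have hXm : Measurable fun x => decide (x ∈ X) := measurable_decide hX
  have hg : Measurable fun p : Θ × ℝ => (decide (p.2 ≤ b p.1), p.1) :=
    Measurable.prodMk (measurable_decide (measurableSet_le measurable_snd (hb.comp measurable_fst)))
      measurable_fst
  -- As `Bool` has two points, every measurable set of the product splits into two rectangles, and
  -- it suffices to compare the laws on these. For `true` this is the hypothesis; for `false` it is
  -- the complement inside `t ⁻¹' E`.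
  have key : ∀ E, MeasurableSet E → ∀ c : Bool,
      ν.map (fun x => (decide (x ∈ X), t x)) ({c} ×ˢ E) =
      ((ν.map t).prod (volume.restrict (Icc (0 : ℝ) 1))).map
        (fun p => (decide (p.2 ≤ b p.1), p.1)) ({c} ×ˢ E) := by
    intro E hE c
    have hcE : MeasurableSet ({c} ×ˢ E : Set (Bool × Θ)) := (measurableSet_singleton c).prod hE
    rw [Measure.map_apply (hXm.prodMk ht) hcE, Measure.map_apply hg hcE,
      Measure.prod_apply (hg hcE), lintegral_map (measurable_measure_prodMk_left (hg hcE)) ht]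
    have hvol : ∀ x : Θ, (volume.restrict (Icc (0 : ℝ) 1)) {u | u ≤ b x} =
        ENNReal.ofReal (b x) := by
      intro x
      have hm : MeasurableSet {u : ℝ | u ≤ b x} := measurableSet_Iic
      rw [Measure.restrict_apply hm]
      have : {u | u ≤ b x} ∩ Icc (0 : ℝ) 1 = Icc 0 (b x) := by
        ext u
        simp only [mem_inter_iff, mem_ofPred_eq, mem_Icc]
        constructor
        · rintro ⟨h1, h2, h3⟩; exact ⟨h2, h1⟩
        · rintro ⟨h1, h2⟩; exact ⟨h2, h1, h2.trans (hb1 x)⟩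
      rw [this, Real.volume_Icc, sub_zero]
    have hvol' : ∀ x : Θ, (volume.restrict (Icc (0 : ℝ) 1)) {u | u ≤ b x}ᶜ =
        1 - ENNReal.ofReal (b x) := by
      intro x
      have hm : MeasurableSet {u : ℝ | u ≤ b x} := measurableSet_Iic
      rw [measure_compl hm (measure_ne_top _ _), hvol]
      simp
    have hF : ∀ x, (volume.restrict (Icc (0 : ℝ) 1)) (Prod.mk (t x) ⁻¹'
        ((fun p : Θ × ℝ => (decide (p.2 ≤ b p.1), p.1)) ⁻¹' ({c} ×ˢ E))) =
        (t ⁻¹' E).indicator (fun x => cond c (ENNReal.ofReal (b (t x)))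
          (1 - ENNReal.ofReal (b (t x)))) x := by
      intro x
      by_cases hx : t x ∈ E
      · rw [indicator_of_mem (by exact hx)]
        cases c
        · rw [cond_false, ← hvol']
          congr 1
          ext u
          simp [hx]
        · rw [cond_true, ← hvol]
          congr 1
          ext u
          simp [hx]
      · rw [indicator_of_notMem (by exact hx)]
        rw [show Prod.mk (t x) ⁻¹' ((fun p : Θ × ℝ => (decide (p.2 ≤ b p.1), p.1)) ⁻¹'
          ({c} ×ˢ E)) = ∅ by ext u; simp [hx], measure_empty]
    rw [lintegral_congr hF, lintegral_indicator (ht hE)]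
    cases c
    · simp only [cond_false]
      have hset : (fun x => (decide (x ∈ X), t x)) ⁻¹' ({false} ×ˢ E) =
          (t ⁻¹' E) \ (X ∩ t ⁻¹' E) := by
        ext x
        simp
        tauto
      rw [hset, measure_sdiff inter_subset_right (hX.inter (ht hE)).nullMeasurableSet
        (measure_ne_top _ _), h E hE, lintegral_sub (by fun_prop)]
      · simp
      · rw [← h E hE]
        exact measure_ne_top _ _
      · exact Filter.Eventually.of_forall fun x => by
          simpa using ENNReal.ofReal_le_ofReal (hb1 (t x))
    · simp only [cond_true]
      rw [← h E hE]
      congr 1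
      ext x
      simp
  ext E hE
  have hsplit : E = ({true} ×ˢ (Prod.mk true ⁻¹' E)) ∪ ({false} ×ˢ (Prod.mk false ⁻¹' E)) := by
    ext ⟨c, x⟩
    cases c <;> simp
  have hE1 : MeasurableSet (Prod.mk true ⁻¹' E : Set Θ) := measurable_prodMk_left hE
  have hE0 : MeasurableSet (Prod.mk false ⁻¹' E : Set Θ) := measurable_prodMk_left hE
  have hdisj : Disjoint (({true} : Set Bool) ×ˢ (Prod.mk true ⁻¹' E))
      (({false} : Set Bool) ×ˢ (Prod.mk false ⁻¹' E)) := by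
    rw [Set.disjoint_left]
    rintro ⟨c, x⟩ h1 h2
    have h1' : c = true := h1.1
    have h2' : c = false := h2.1
    rw [h1'] at h2'
    exact Bool.noConfusion h2'
  rw [hsplit, measure_union hdisj ((measurableSet_singleton _).prod hE0),
    measure_union hdisj ((measurableSet_singleton _).prod hE0), key _ hE1, key _ hE0]

/-- Conditionally on the statistics `t (x i)`, the events `x i ∈ X` are independent with
probabilities `b (t (x i))`; hence it suffices to bound an event for all fixed statistics. -/
lemma measure_pi_le_of_resample {n : ℕ} {ν : Measure Ω} [IsProbabilityMeasure ν] {X : Set Ω}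
    [DecidablePred (· ∈ X)] (hX : MeasurableSet X) {t : Ω → Θ} (ht : Measurable t) {b : Θ → ℝ}
    (hb : Measurable b) (hb1 : ∀ x, b x ≤ 1)
    (h : ∀ E, MeasurableSet E → ν (X ∩ t ⁻¹' E) = ∫⁻ x in t ⁻¹' E, ENNReal.ofReal (b (t x)) ∂ν)
    {E : Set (Fin n → Bool × Θ)} (hE : MeasurableSet E) {q : ENNReal}
    (hq : ∀ y : Fin n → Θ, Measure.pi (fun _ : Fin n => volume.restrict (Icc (0 : ℝ) 1))
      {u | (fun i => (decide (u i ≤ b (y i)), y i)) ∈ E} ≤ q) :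
    Measure.pi (fun _ : Fin n => ν) {x | (fun i => (decide (x i ∈ X), t (x i))) ∈ E} ≤ q := by
  have : IsProbabilityMeasure (volume.restrict (Icc (0 : ℝ) 1)) := ⟨by simp⟩
  have : IsProbabilityMeasure (ν.map t) := Measure.isProbabilityMeasure_map ht.aemeasurable
  have hXm : Measurable fun x => decide (x ∈ X) := measurable_decide hX
  have hf : Measurable fun x => (decide (x ∈ X), t x) := hXm.prodMk ht
  have hg : Measurable fun p : Θ × ℝ => (decide (p.2 ≤ b p.1), p.1) :=
    Measurable.prodMk (measurable_decide (measurableSet_le measurable_snd (hb.comp measurable_fst)))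
      measurable_fst
  have : IsProbabilityMeasure (ν.map fun x => (decide (x ∈ X), t x)) :=
    Measure.isProbabilityMeasure_map hf.aemeasurable
  have h1 := Measure.pi_map_pi (μ := fun _ : Fin n => ν)
    (f := fun _ x => (decide (x ∈ X), t x)) (fun _ => hf.aemeasurable)
  have : IsProbabilityMeasure (((ν.map t).prod (volume.restrict (Icc (0 : ℝ) 1))).map
      (fun p => (decide (p.2 ≤ b p.1), p.1))) := Measure.isProbabilityMeasure_map hg.aemeasurable
  have h2 := Measure.pi_map_pi
    (μ := fun _ : Fin n => (ν.map t).prod (volume.restrict (Icc (0 : ℝ) 1)))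
    (f := fun _ p => (decide (p.2 ≤ b p.1), p.1)) (fun _ => hg.aemeasurable)
  have hfn : Measurable fun (x : Fin n → Ω) (i : Fin n) => (decide (x i ∈ X), t (x i)) :=
    measurable_pi_lambda _ fun i => hf.comp (measurable_pi_apply i)
  have hgn : Measurable fun (p : Fin n → Θ × ℝ) (i : Fin n) =>
      (decide ((p i).2 ≤ b (p i).1), (p i).1) :=
    measurable_pi_lambda _ fun i => hg.comp (measurable_pi_apply i)
  have h3 : Measure.pi (fun _ : Fin n => ν) {x | (fun i => (decide (x i ∈ X), t (x i))) ∈ E} =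
      Measure.pi (fun _ : Fin n => (ν.map t).prod (volume.restrict (Icc (0 : ℝ) 1)))
        {p | (fun i => (decide ((p i).2 ≤ b (p i).1), (p i).1)) ∈ E} := by
    have e1 := Measure.map_apply (μ := Measure.pi (fun _ : Fin n => ν)) hfn hE
    have e2 := Measure.map_apply
      (μ := Measure.pi (fun _ : Fin n => (ν.map t).prod (volume.restrict (Icc (0 : ℝ) 1)))) hgn hE
    refine e1.symm.trans (Eq.trans ?_ e2)
    rw [h1, h2]
    congr 2
    funext _
    exact map_indicator_eq_resample hX ht hb hb1 h
  rw [h3]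
  have hmp := measurePreserving_arrowProdEquivProdArrow Θ ℝ (Fin n) (fun _ => ν.map t)
    (fun _ => volume.restrict (Icc (0 : ℝ) 1))
  have hE' : MeasurableSet {p : (Fin n → Θ) × (Fin n → ℝ) |
      (fun i => (decide (p.2 i ≤ b (p.1 i)), p.1 i)) ∈ E} := by
    have : Measurable fun (p : (Fin n → Θ) × (Fin n → ℝ)) (i : Fin n) =>
        (decide (p.2 i ≤ b (p.1 i)), p.1 i) :=
      measurable_pi_lambda _ fun i => hg.comp (g := fun p : Θ × ℝ => (decide (p.2 ≤ b p.1), p.1))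
        (f := fun p : (Fin n → Θ) × (Fin n → ℝ) => (p.1 i, p.2 i))
        (((measurable_pi_apply i).comp measurable_fst).prodMk
          ((measurable_pi_apply i).comp measurable_snd))
    exact this hE
  have h4 := hmp.measure_preimage hE'.nullMeasurableSet
  refine (le_of_eq ?_).trans ((le_of_eq h4).trans ?_)
  · rfl
  -- Fubini: with the statistics frozen, only the independent uniform variables remain random.
  · rw [Measure.prod_apply hE']
    calc _ ≤ ∫⁻ _ : Fin n → Θ, q ∂(Measure.pi fun _ => ν.map t) := lintegral_mono fun y => hq y
      _ = q := by simp

end Resampling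

end OfflineRL

noncomputable section

namespace OfflineRL

universe u v

/-! ### Backward recursion and telescoping over the horizon. -/

section Recursion

variable {S : Type u} {H : ℕ}

/-- Backward recursion over the horizon, started from the constant `c`. -/
def backward (c : ℝ) (step : Fin H → (S → ℝ) → S → ℝ) (k : Fin (H + 1)) : S → ℝ :=
  Fin.reverseInduction (motive := fun _ => S → ℝ) (fun _ => c) step k

lemma backward_last (c : ℝ) (step : Fin H → (S → ℝ) → S → ℝ) :
    backward c step (Fin.last H) = fun _ => c := by
  simp [backward]

lemma backward_castSucc (c : ℝ) (step : Fin H → (S → ℝ) → S → ℝ) (h : Fin H) :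
    backward c step h.castSucc = step h (backward c step h.succ) := by
  simp [backward]

lemma sum_castSucc_sub_succ (f : Fin (H + 1) → ℝ) :
    ∑ h : Fin H, (f h.castSucc - f h.succ) = f 0 - f (Fin.last H) := by
  have h1 := Fin.sum_univ_castSucc f
  have h2 := Fin.sum_univ_succ f
  rw [Finset.sum_sub_distrib]
  linarith

end Recursion

/-! ### Sums over state-action paths and the Markov property. -/

section Paths

variable {S : Type u} {A : Type v} [Fintype S] [Fintype A]

/-- Total weight of all paths, computed backward. -/
lemma sum_path_weights {H : ℕ} (W : Fin H → S → A → S → ℝ) (c : Fin (H + 1) → S → ℝ) (g : S → ℝ)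
    (hlast : ∀ s, c (Fin.last H) s = 1)
    (hstep : ∀ h s, c h.castSucc s = ∑ a, ∑ s', W h s a s' * c h.succ s') :
    ∑ p : (Fin (H + 1) → S) × (Fin H → A),
      g (p.1 0) * ∏ h, W h (p.1 h.castSucc) (p.2 h) (p.1 h.succ) = ∑ s, g s * c 0 s := by
  induction H generalizing g with
  | zero =>
    rw [Fintype.sum_prod_type]
    simp only [Finset.univ_unique, Finset.sum_singleton, Finset.univ_eq_empty, Finset.prod_empty,
      mul_one]
    rw [← (Equiv.funUnique (Fin 1) S).symm.sum_comp]
    refine Finset.sum_congr rfl fun s _ => ?_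
    have := hlast s
    simp only [Fin.last_zero] at this
    simp [this]
  | succ H ih =>
    -- The first transition is absorbed into the initial weight, which leaves a path sum with one
    -- step fewer.
    have ih' := ih (fun h => W h.succ) (fun k => c k.succ)
      (fun x => ∑ s, ∑ a, g s * W 0 s a x) (fun s => by simpa using hlast s)
      (fun h s => by simpa using hstep h.succ s)
    have hR : ∑ s, g s * c 0 s = ∑ x, (∑ s, ∑ a, g s * W 0 s a x) * c (Fin.succ 0) x := by
      have h0 : ∀ s, c 0 s = ∑ a, ∑ s', W 0 s a s' * c (Fin.succ 0) s' := fun s => by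
        simpa using hstep 0 s
      simp_rw [h0, Finset.sum_mul, Finset.mul_sum]
      symm
      rw [Finset.sum_comm]
      refine Finset.sum_congr rfl fun s _ => ?_
      rw [Finset.sum_comm]
      simp_rw [mul_assoc]
    rw [hR, ← ih', Fintype.sum_prod_type, Fintype.sum_prod_type,
      ← (Fin.consEquiv fun _ : Fin (H + 2) => S).sum_comp, Fintype.sum_prod_type]
    simp_rw [← (Fin.consEquiv fun _ : Fin (H + 1) => A).sum_comp, Fintype.sum_prod_type]
    simp only [Fin.consEquiv_apply, Fin.prod_univ_succ, Fin.cons_succ, Fin.cons_zero,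
      Fin.castSucc_zero, ← Fin.succ_castSucc]
    rw [Finset.sum_comm]
    refine Finset.sum_congr rfl fun x _ => ?_
    simp_rw [Finset.sum_mul]
    symm
    rw [Finset.sum_comm]
    refine Finset.sum_congr rfl fun s _ => ?_
    rw [Finset.sum_comm]
    refine Finset.sum_congr rfl fun a _ => ?_
    refine Finset.sum_congr rfl fun y _ => ?_
    ring

variable {H : ℕ}

/-- Expectation of a function of the state and action sequences under the policy `π`. -/
def MDP.pathExp (M : MDP S A H) (π : Policy S A H) (F : (Fin (H + 1) → S) × (Fin H → A) → ℝ) : ℝ :=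
  ∑ p, M.pathProb π p.1 p.2 * F p

namespace MDP

variable (M : MDP S A H) (π : Policy S A H)

lemma pathProb_nonneg (s : Fin (H + 1) → S) (a : Fin H → A) : 0 ≤ M.pathProb π s a :=
  mul_nonneg (M.init_mem.1 _)
    (Finset.prod_nonneg fun h _ => mul_nonneg ((π.prob_mem h _).1 _) ((M.trans_mem h _ _).1 _))

lemma sum_policy_trans (h : Fin H) (s : S) :
    ∑ a, ∑ s', π.prob h s a * M.trans h s a s' = 1 := by
  simp_rw [← Finset.mul_sum, (M.trans_mem h s _).2, mul_one, (π.prob_mem h s).2]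

lemma pathExp_one : M.pathExp π (fun _ => 1) = 1 := by
  have := sum_path_weights (fun h s a s' => π.prob h s a * M.trans h s a s') (fun _ _ => 1)
    M.init (fun _ => rfl) (fun h s => by simpa using (M.sum_policy_trans π h s).symm)
  simp only [mul_one, M.init_mem.2] at this
  simpa [pathExp, pathProb] using this

lemma pathExp_const_mul (c : ℝ) (F : (Fin (H + 1) → S) × (Fin H → A) → ℝ) :
    M.pathExp π (fun p => c * F p) = c * M.pathExp π F := by
  simp only [pathExp, Finset.mul_sum]
  exact Finset.sum_congr rfl fun p _ => by ring

lemma pathExp_sum {ι : Type*} (I : Finset ι) (F : ι → (Fin (H + 1) → S) × (Fin H → A) → ℝ) :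
    M.pathExp π (fun p => ∑ i ∈ I, F i p) = ∑ i ∈ I, M.pathExp π (F i) := by
  simp only [pathExp, Finset.mul_sum]
  exact Finset.sum_comm

/-- Restricting to paths of positive probability matters because the boundedness assumption says
nothing about rewards at pairs that are never visited. -/
lemma pathExp_congr {F G : (Fin (H + 1) → S) × (Fin H → A) → ℝ}
    (h : ∀ p, 0 < M.pathProb π p.1 p.2 → F p = G p) : M.pathExp π F = M.pathExp π G := by
  refine Finset.sum_congr rfl fun p _ => ?_
  rcases (M.pathProb_nonneg π p.1 p.2).eq_or_lt with h0 | h0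
  · rw [← h0, zero_mul, zero_mul]
  · rw [h p h0]

lemma pathExp_mono {F G : (Fin (H + 1) → S) × (Fin H → A) → ℝ}
    (h : ∀ p, 0 < M.pathProb π p.1 p.2 → F p ≤ G p) : M.pathExp π F ≤ M.pathExp π G := by
  refine Finset.sum_le_sum fun p _ => ?_
  rcases (M.pathProb_nonneg π p.1 p.2).eq_or_lt with h0 | h0
  · rw [← h0, zero_mul, zero_mul]
  · exact mul_le_mul_of_nonneg_left (h p h0) h0.le

lemma pathExp_nonneg {F : (Fin (H + 1) → S) × (Fin H → A) → ℝ} (h : ∀ p, 0 ≤ F p) :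
    0 ≤ M.pathExp π F :=
  Finset.sum_nonneg fun p _ => mul_nonneg (M.pathProb_nonneg π p.1 p.2) (h p)

/-- Markov property: given `s_h`, the pair `(a_h, s_{h+1})` is drawn from the policy and the
transition kernel. -/
lemma pathExp_step (h : Fin H) (F : S → A → S → ℝ) :
    M.pathExp π (fun p => F (p.1 h.castSucc) (p.2 h) (p.1 h.succ)) =
      M.pathExp π (fun p => ∑ a, π.prob h (p.1 h.castSucc) a *
        ∑ s', M.trans h (p.1 h.castSucc) a s' * F (p.1 h.castSucc) a s') := by
  set W : Fin H → S → A → S → ℝ := fun h s a s' => π.prob h s a * M.trans h s a s' with hW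
  set G : S → ℝ := fun s => ∑ a, π.prob h s a * ∑ s', M.trans h s a s' * F s a s' with hG
  -- Both expectations are path sums with the weight of step `h` modified, by `F` or by its
  -- conditional mean `G`. After step `h` the backward recursion is constantly one, so both
  -- modifications have the same recursion `c` and hence the same sum.
  set W₁ : Fin H → S → A → S → ℝ := fun k s a s' => W k s a s' * if k = h then F s a s' else 1
    with hW₁
  set W₂ : Fin H → S → A → S → ℝ := fun k s a s' => W k s a s' * if k = h then G s else 1
    with hW₂
  set c : Fin (H + 1) → S → ℝ :=
    backward 1 (fun k V s => ∑ a, ∑ s', W₁ k s a s' * V s') with hc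
  have hlast : ∀ s, c (Fin.last H) s = 1 := fun s => by rw [hc, backward_last]
  have hstep : ∀ k s, c k.castSucc s = ∑ a, ∑ s', W₁ k s a s' * c k.succ s' := fun k s => by
    rw [hc, backward_castSucc]
  have hW1 : ∀ k s, ∑ a, ∑ s', W k s a s' = 1 := M.sum_policy_trans π
  have hone : ∀ k : Fin (H + 1), h.castSucc < k → ∀ s, c k s = 1 := by
    intro k
    induction k using Fin.reverseInduction with
    | last => exact fun _ => hlast
    | cast i ih =>
      intro hi s
      have hne : i ≠ h := by
        rintro rfl
        exact lt_irrefl _ hi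
      have hlt : h.castSucc < i.succ := hi.trans (Fin.castSucc_lt_succ)
      rw [hstep, ← hW1 i s]
      simp [hW₁, hne, ih hlt]
  have hsucc : ∀ s, c h.succ s = 1 := hone _ (Fin.castSucc_lt_succ)
  have hstep2 : ∀ k s, c k.castSucc s = ∑ a, ∑ s', W₂ k s a s' * c k.succ s' := by
    intro k s
    rw [hstep]
    by_cases hk : k = h
    · subst hk
      simp only [hW₁, hW₂, hsucc, if_true, mul_one, ← Finset.sum_mul, hW1, one_mul]
      simp only [hG, hW, Finset.mul_sum, mul_assoc]
    · simp [hW₁, hW₂, hk]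
  have e1 := sum_path_weights W₁ c M.init hlast hstep
  have e2 := sum_path_weights W₂ c M.init hlast hstep2
  have e3 := e1.trans e2.symm
  simp only [hW₁, hW₂, Finset.prod_mul_distrib, Finset.prod_ite_eq', Finset.mem_univ, if_true,
    ← mul_assoc] at e3
  exact e3

/-- Given `s_{h+1}`, the past `(s_k, a_k)_{k ≤ h}` and the future are independent. -/
lemma pathExp_past_future [DecidableEq S] (h : Fin H) (s : S)
    {F G : (Fin (H + 1) → S) × (Fin H → A) → ℝ}
    (hG : ∀ p q : (Fin (H + 1) → S) × (Fin H → A), (∀ k ≤ h.castSucc, p.1 k = q.1 k) →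
      (∀ k ≤ h, p.2 k = q.2 k) → G p = G q)
    (hF : ∀ p q : (Fin (H + 1) → S) × (Fin H → A), (∀ k, h.castSucc < k → p.1 k = q.1 k) →
      (∀ k, h < k → p.2 k = q.2 k) → F p = F q) :
    M.pathExp π (fun p => (if p.1 h.succ = s then 1 else 0) * G p * F p) *
        M.pathExp π (fun p => if p.1 h.succ = s then 1 else 0) =
      M.pathExp π (fun p => (if p.1 h.succ = s then 1 else 0) * G p) *
        M.pathExp π (fun p => (if p.1 h.succ = s then 1 else 0) * F p) := by
  let P := (Fin (H + 1) → S) × (Fin H → A)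
  -- Take two independent paths that meet in `s` at time `h + 1` and exchange their pasts. This
  -- involution preserves the product of their probabilities, which proves the identity in product
  -- form, without dividing by the probability of the meeting state.
  let mix : P → P → P := fun p q =>
    (fun k => if k ≤ h.castSucc then q.1 k else p.1 k, fun k => if k ≤ h then q.2 k else p.2 k)
  let σ : P × P → P × P := fun x => (mix x.1 x.2, mix x.2 x.1)
  have hσ : Function.Involutive σ := by
    rintro ⟨p, q⟩
    simp only [σ, mix]
    refine Prod.ext (Prod.ext ?_ ?_) (Prod.ext ?_ ?_) <;> funext k <;> simp only <;>
      split_ifs <;> rfl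
  have hns : ¬ h.succ ≤ h.castSucc := not_le.2 Fin.castSucc_lt_succ
  have hmix : ∀ p q : P, (mix p q).1 h.succ = p.1 h.succ := fun p q => by simp [mix, hns]
  have hGm : ∀ p q : P, G (mix p q) = G q := fun p q =>
    hG _ _ (fun k hk => by simp [mix, hk]) (fun k hk => by simp [mix, hk])
  have hFm : ∀ p q : P, F (mix p q) = F p := fun p q =>
    hF _ _ (fun k hk => by simp [mix, not_le.2 hk]) (fun k hk => by simp [mix, not_le.2 hk])
  have hprob : ∀ p q : P, p.1 h.succ = q.1 h.succ →
      M.pathProb π (mix p q).1 (mix p q).2 * M.pathProb π (mix q p).1 (mix q p).2 =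
        M.pathProb π p.1 p.2 * M.pathProb π q.1 q.2 := by
    intro p q hpq
    have h0 : (0 : Fin (H + 1)) ≤ h.castSucc := Fin.zero_le _
    simp only [pathProb]
    rw [mul_mul_mul_comm, mul_mul_mul_comm (M.init (p.1 0)), ← Finset.prod_mul_distrib,
      ← Finset.prod_mul_distrib]
    congr 1
    · simp only [mix, h0, if_true]
      exact mul_comm _ _
    · refine Finset.prod_congr rfl fun k _ => ?_
      rcases lt_trichotomy k h with hk | hk | hk
      · have h1 : k.castSucc ≤ h.castSucc := Fin.castSucc_le_castSucc_iff.2 hk.le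
        have h2 : k.succ ≤ h.castSucc := Fin.succ_le_castSucc_iff.2 hk
        simp only [mix, h1, h2, hk.le, if_true]
        exact mul_comm _ _
      -- Step `h` is the only one that straddles the cut; the exchange works there because both
      -- paths have the same state at time `h + 1`.
      · subst hk
        simp only [mix, le_refl, hns, if_true, if_false, hpq]
        exact mul_comm _ _
      · have h1 : ¬ k.castSucc ≤ h.castSucc := by
          rw [Fin.castSucc_le_castSucc_iff]; exact not_le.2 hk
        have h2 : ¬ k.succ ≤ h.castSucc := by
          rw [Fin.succ_le_castSucc_iff]; exact not_lt.2 hk.le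
        simp only [mix, h1, h2, not_le.2 hk, if_false]
  have e : ∀ F₁ F₂ : P → ℝ, M.pathExp π F₁ * M.pathExp π F₂ = ∑ x : P × P,
      M.pathProb π x.1.1 x.1.2 * M.pathProb π x.2.1 x.2.2 * (F₁ x.1 * F₂ x.2) := by
    intro F₁ F₂
    simp only [pathExp]
    rw [Finset.sum_mul_sum, ← Finset.sum_product', Finset.univ_product_univ]
    exact Finset.sum_congr rfl fun x _ => by ring
  rw [mul_comm, e, e, ← Equiv.sum_comp hσ.toPerm]
  refine Finset.sum_congr rfl fun x _ => ?_
  obtain ⟨p, q⟩ := x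
  simp only [Function.Involutive.coe_toPerm, σ, hmix, hGm, hFm]
  by_cases hp : p.1 h.succ = s
  · by_cases hq : q.1 h.succ = s
    · rw [hprob p q (hp.trans hq.symm)]
      simp only [hp, hq, if_true]
      ring
    · simp [hq]
  · simp [hp]

end MDP

end Paths

end OfflineRL

end

noncomputable section

namespace OfflineRL

universe u v

namespace MDP

variable {S : Type u} {A : Type v} [Fintype S] {H : ℕ}

/-! ### State occupancy probabilities. -/

section Occupancy

variable [Fintype A]

variable [DecidableEq S] (M : MDP S A H) (π : Policy S A H)

/-- Probability that the state at time `k` is `s`. -/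
def stateProb (M : MDP S A H) (π : Policy S A H) (k : Fin (H + 1)) (s : S) : ℝ :=
  M.pathExp π fun p => if p.1 k = s then 1 else 0

lemma stateProb_nonneg (k : Fin (H + 1)) (s : S) : 0 ≤ M.stateProb π k s :=
  M.pathExp_nonneg π fun p => by split_ifs <;> norm_num

lemma pathExp_state (k : Fin (H + 1)) (g : S → ℝ) :
    M.pathExp π (fun p => g (p.1 k)) = ∑ s, M.stateProb π k s * g s := by
  have : (fun p : (Fin (H + 1) → S) × (Fin H → A) => g (p.1 k)) =
      fun p => ∑ s, g s * if p.1 k = s then 1 else 0 := by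
    funext p
    simp
  rw [this, pathExp_sum]
  refine Finset.sum_congr rfl fun s _ => ?_
  rw [pathExp_const_mul, mul_comm]
  rfl

lemma pathExp_step_eq (h : Fin H) (F : S → A → S → ℝ) :
    M.pathExp π (fun p => F (p.1 h.castSucc) (p.2 h) (p.1 h.succ)) =
      ∑ s, M.stateProb π h.castSucc s * ∑ a, π.prob h s a * ∑ s', M.trans h s a s' * F s a s' := by
  rw [pathExp_step]
  exact M.pathExp_state π h.castSucc
    fun s => ∑ a, π.prob h s a * ∑ s', M.trans h s a s' * F s a s'

lemma stateProb_zero (s : S) : M.stateProb π 0 s = M.init s := by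
  have := sum_path_weights (fun h s a s' => π.prob h s a * M.trans h s a s') (fun _ _ => 1)
    (fun x => M.init x * if x = s then 1 else 0) (fun _ => rfl)
    (fun h s => by simpa using (M.sum_policy_trans π h s).symm)
  simp only [mul_one, mul_ite, mul_zero, Finset.sum_ite_eq', Finset.mem_univ, if_true] at this
  rw [← this]
  refine Finset.sum_congr rfl fun p _ => ?_
  simp only [pathProb]
  split_ifs <;> simp

lemma exists_path_of_stateProb_pos {k : Fin (H + 1)} {s : S} (h : 0 < M.stateProb π k s) :
    ∃ p : (Fin (H + 1) → S) × (Fin H → A), 0 < M.pathProb π p.1 p.2 ∧ p.1 k = s := by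
  by_contra hc
  push Not at hc
  refine h.ne' ?_
  have : M.stateProb π k s = M.pathExp π fun _ => 0 :=
    M.pathExp_congr π fun p hp => by simp [hc p hp]
  rw [this]
  simp [pathExp]

lemma stateProb_pos_of_path {p : (Fin (H + 1) → S) × (Fin H → A)}
    (hp : 0 < M.pathProb π p.1 p.2) (k : Fin (H + 1)) : 0 < M.stateProb π k (p.1 k) := by
  have h1 : M.pathProb π p.1 p.2 * (if p.1 k = p.1 k then 1 else 0) ≤ M.stateProb π k (p.1 k) :=
    Finset.single_le_sum (f := fun q : (Fin (H + 1) → S) × (Fin H → A) =>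
      M.pathProb π q.1 q.2 * if q.1 k = p.1 k then (1 : ℝ) else 0)
      (fun q _ => mul_nonneg (M.pathProb_nonneg π _ _) (by split_ifs <;> norm_num))
      (Finset.mem_univ p)
  simp only [if_true, mul_one] at h1
  exact hp.trans_le h1

lemma stateProb_succ (h : Fin H) (s' : S) : M.stateProb π h.succ s' =
    ∑ s, M.stateProb π h.castSucc s * ∑ a, π.prob h s a * M.trans h s a s' := by
  rw [stateProb, M.pathExp_step_eq π h fun _ _ x => if x = s' then 1 else 0]
  simp

/-- Expectation of a function of `s_{h+1}` on the event `(s_h, a_h) = (s, a)`. -/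
lemma pathExp_visit [DecidableEq A] (h : Fin H) (s : S) (a : A) (g : S → ℝ) :
    M.pathExp π (fun p => if p.1 h.castSucc = s ∧ p.2 h = a then g (p.1 h.succ) else 0) =
      M.stateProb π h.castSucc s * π.prob h s a * ∑ s', M.trans h s a s' * g s' := by
  rw [M.pathExp_step_eq π h fun x y z => if x = s ∧ y = a then g z else 0]
  rw [Finset.sum_eq_single s, Finset.sum_eq_single a]
  · simp [mul_assoc]
  · intro b _ hb
    simp [hb]
  · simp
  · intro b _ hb
    simp [hb]
  · simp

end Occupancy

/-! ### The trajectory law as a finite mixture over paths. -/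

/-- Expected instantaneous reward. -/
def meanRew (M : MDP S A H) (h : Fin H) (s : S) (a : A) : ℝ := ∫ x, x ∂(M.reward h s a : Measure ℝ)

/-- Conditional law of the rewards given the states and actions. -/
def rewLaw (M : MDP S A H) (p : (Fin (H + 1) → S) × (Fin H → A)) : Measure (Fin H → ℝ) :=
  Measure.pi fun h : Fin H => (M.reward h (p.1 h.castSucc) (p.2 h) : Measure ℝ)

instance (M : MDP S A H) (p : (Fin (H + 1) → S) × (Fin H → A)) :
    IsProbabilityMeasure (M.rewLaw p) := by
  unfold rewLaw; infer_instance

lemma integral_eval_rewLaw (M : MDP S A H) (p : (Fin (H + 1) → S) × (Fin H → A)) (h : Fin H)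
    {f : ℝ → ℝ} (hf : Measurable f) : ∫ r, f (r h) ∂(M.rewLaw p) =
      ∫ x, f x ∂(M.reward h (p.1 h.castSucc) (p.2 h) : Measure ℝ) := by
  have hmp := measurePreserving_eval
    (fun h : Fin H => (M.reward h (p.1 h.castSucc) (p.2 h) : Measure ℝ)) h
  rw [← hmp.map_eq, integral_map hmp.measurable.aemeasurable hf.aestronglyMeasurable]
  rfl

variable [Fintype A] [MeasurableSpace S] [MeasurableSpace A] (M : MDP S A H) (π : Policy S A H)

lemma law_eq : M.law π = ∑ p : (Fin (H + 1) → S) × (Fin H → A),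
    ENNReal.ofReal (M.pathProb π p.1 p.2) • (M.rewLaw p).map fun r => (p.1, p.2, r) := by
  unfold law
  refine Finset.sum_congr rfl fun p _ => ?_
  rw [Measure.dirac_prod, Measure.dirac_prod, Measure.map_map (by fun_prop) (by fun_prop)]
  rfl

lemma law_apply {E : Set (Trajectory S A H)} (hE : MeasurableSet E) :
    M.law π E = ∑ p : (Fin (H + 1) → S) × (Fin H → A),
      ENNReal.ofReal (M.pathProb π p.1 p.2) * M.rewLaw p {r | (p.1, p.2, r) ∈ E} := by
  rw [law_eq, Measure.finsetSum_apply]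
  refine Finset.sum_congr rfl fun p _ => ?_
  rw [Measure.smul_apply, Measure.map_apply (by fun_prop) hE]
  rfl

instance : IsProbabilityMeasure (M.law π) := by
  constructor
  rw [law_apply _ _ MeasurableSet.univ]
  simp only [Set.mem_univ, Set.ofPred_true, measure_univ, mul_one]
  rw [← ENNReal.ofReal_sum_of_nonneg fun p _ => M.pathProb_nonneg π _ _]
  have := M.pathExp_one π
  simp only [pathExp, mul_one] at this
  simp [this]

/-- Paths of probability zero carry the zero measure, so no integrability is required of their
rewards. -/
lemma integrable_law {F : Trajectory S A H → ℝ} (hF : Measurable F)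
    (hi : ∀ p : (Fin (H + 1) → S) × (Fin H → A), 0 < M.pathProb π p.1 p.2 →
      Integrable (fun r => F (p.1, p.2, r)) (M.rewLaw p)) : 
    (∀ p : (Fin (H + 1) → S) × (Fin H → A), Integrable F
      (ENNReal.ofReal (M.pathProb π p.1 p.2) • (M.rewLaw p).map fun r => (p.1, p.2, r))) := by
  intro p
  rcases (M.pathProb_nonneg π p.1 p.2).eq_or_lt with h0 | h0
  · rw [← h0]; simp
  · refine Integrable.smul_measure ?_ ENNReal.ofReal_ne_top
    rw [integrable_map_measure hF.aestronglyMeasurable (by fun_prop)]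
    exact hi p h0

lemma integral_law {F : Trajectory S A H → ℝ} (hF : Measurable F)
    (hi : ∀ p : (Fin (H + 1) → S) × (Fin H → A), 0 < M.pathProb π p.1 p.2 →
      Integrable (fun r => F (p.1, p.2, r)) (M.rewLaw p)) :
    ∫ ω, F ω ∂(M.law π) = M.pathExp π fun p => ∫ r, F (p.1, p.2, r) ∂(M.rewLaw p) := by
  rw [law_eq, integral_finsetSum_measure fun p _ => M.integrable_law π hF hi p]
  refine Finset.sum_congr rfl fun p _ => ?_
  rw [integral_smul_measure, integral_map (by fun_prop) hF.aestronglyMeasurable,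
    ENNReal.toReal_ofReal (M.pathProb_nonneg π _ _), smul_eq_mul]

lemma ae_rewLaw {Q : Trajectory S A H → Prop} (hQ : ∀ᵐ ω ∂(M.law π), Q ω)
    {p : (Fin (H + 1) → S) × (Fin H → A)} (hp : 0 < M.pathProb π p.1 p.2) :
    ∀ᵐ r ∂(M.rewLaw p), Q (p.1, p.2, r) := by
  rw [ae_iff, law_eq, Measure.finsetSum_apply] at hQ
  have h1 := (Finset.sum_eq_zero_iff.1 hQ) p (Finset.mem_univ _)
  rw [Measure.smul_apply, smul_eq_mul, mul_eq_zero] at h1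
  have h2 := h1.resolve_left (by simpa using hp)
  exact ae_of_ae_map (f := fun r => (p.1, p.2, r)) (by fun_prop) (ae_iff.2 h2)

lemma ae_law {Q : Trajectory S A H → Prop} (hm : MeasurableSet {ω | Q ω})
    (hQ : ∀ p : (Fin (H + 1) → S) × (Fin H → A), 0 < M.pathProb π p.1 p.2 →
      ∀ᵐ r ∂(M.rewLaw p), Q (p.1, p.2, r)) : ∀ᵐ ω ∂(M.law π), Q ω := by
  change M.law π {ω | Q ω}ᶜ = 0
  rw [law_apply _ _ hm.compl]
  refine Finset.sum_eq_zero fun p _ => ?_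
  rcases (M.pathProb_nonneg π p.1 p.2).eq_or_lt with h0 | h0
  · rw [← h0]; simp
  · rw [show M.rewLaw p {r | (p.1, p.2, r) ∈ {ω | Q ω}ᶜ} = 0 from ae_iff.1 (hQ p h0), mul_zero]

/-! ### Consequences of the bounded total reward. -/

section Bounded

variable {M}

lemma BoundedTotalReward.ae_mem (hM : M.BoundedTotalReward)
    {p : (Fin (H + 1) → S) × (Fin H → A)} (hp : 0 < M.pathProb π p.1 p.2) (h : Fin H) :
    ∀ᵐ x ∂(M.reward h (p.1 h.castSucc) (p.2 h) : Measure ℝ), 0 ≤ x ∧ x ≤ 1 := by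
  have h1 := M.ae_rewLaw π (hM π) hp
  have hmp := measurePreserving_eval
    (fun h : Fin H => (M.reward h (p.1 h.castSucc) (p.2 h) : Measure ℝ)) h
  rw [← hmp.map_eq, ae_map_iff hmp.measurable.aemeasurable
    (measurableSet_Icc (a := (0 : ℝ)) (b := 1))]
  filter_upwards [h1] with r hr
  exact ⟨hr.1 h, (Finset.single_le_sum (f := fun k => r k) (fun k _ => hr.1 k)
    (Finset.mem_univ h)).trans hr.2⟩

lemma BoundedTotalReward.integrable_eval (hM : M.BoundedTotalReward)
    {p : (Fin (H + 1) → S) × (Fin H → A)} (hp : 0 < M.pathProb π p.1 p.2) (h : Fin H) :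
    Integrable (fun r : Fin H → ℝ => r h) (M.rewLaw p) := by
  refine integrable_of_ae_abs_le (c := 1) (measurable_pi_apply h) ?_
  filter_upwards [M.ae_rewLaw π (hM π) hp] with r hr
  refine (abs_of_nonneg (hr.1 h)).le.trans ?_
  exact (Finset.single_le_sum (f := fun k => r k) (fun k _ => hr.1 k)
    (Finset.mem_univ h)).trans hr.2

/-- The almost sure bound on the total reward survives conditioning on one feasible path; taking
expectations there turns rewards into means. This is the source of `V ≤ 1`. -/
lemma BoundedTotalReward.sum_meanRew_le (hM : M.BoundedTotalReward)
    {p : (Fin (H + 1) → S) × (Fin H → A)} (hp : 0 < M.pathProb π p.1 p.2) :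
    ∑ h, M.meanRew h (p.1 h.castSucc) (p.2 h) ≤ 1 := by
  have h1 : ∑ h, M.meanRew h (p.1 h.castSucc) (p.2 h) = ∫ r, ∑ h, r h ∂(M.rewLaw p) := by
    rw [integral_finsetSum _ fun h _ => hM.integrable_eval π hp h]
    exact Finset.sum_congr rfl fun h _ => (M.integral_eval_rewLaw p h measurable_id).symm
  rw [h1]
  calc ∫ r, ∑ h, r h ∂(M.rewLaw p) ≤ ∫ _, (1 : ℝ) ∂(M.rewLaw p) := by
        refine integral_mono_ae (integrable_finsetSum _ fun h _ => hM.integrable_eval π hp h)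
          (integrable_const _) ?_
        filter_upwards [M.ae_rewLaw π (hM π) hp] with r hr using hr.2
    _ = 1 := by simp

lemma BoundedTotalReward.value_eq [DiscreteMeasurableSpace S] [DiscreteMeasurableSpace A]
    (hM : M.BoundedTotalReward) :
    M.value π = M.pathExp π fun p => ∑ h, M.meanRew h (p.1 h.castSucc) (p.2 h) := by
  unfold value
  have hm : Measurable fun ω : Trajectory S A H => ∑ h, ω.rew h :=
    Finset.measurable_sum _ fun h _ => by unfold Trajectory.rew; fun_prop
  rw [M.integral_law π hm fun p hp =>
    integrable_finsetSum _ fun h _ => hM.integrable_eval π hp h]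
  refine M.pathExp_congr π fun p hp => ?_
  simp only [Trajectory.rew]
  rw [integral_finsetSum _ fun h _ => hM.integrable_eval π hp h]
  exact Finset.sum_congr rfl fun h _ => M.integral_eval_rewLaw p h measurable_id

end Bounded

lemma stateOcc_eq [DecidableEq S] [DiscreteMeasurableSpace S] [DiscreteMeasurableSpace A] (h : Fin H) (s : S) :
    M.stateOcc π h s = M.stateProb π h.castSucc s := by
  have hm : MeasurableSet {ω : Trajectory S A H | ω.state h.castSucc = s} := by
    have : Measurable fun ω : Trajectory S A H => ω.state h.castSucc := by
      unfold Trajectory.state; fun_prop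
    exact this (measurableSet_singleton s)
  unfold stateOcc
  rw [← integral_indicator_one hm, integral_law]
  · refine M.pathExp_congr π fun p _ => ?_
    simp [Set.indicator_apply, Trajectory.state]
  · exact measurable_one.indicator hm
  · intro p _
    simp [Set.indicator_apply, Trajectory.state]

lemma occ_eq [DecidableEq S] [DiscreteMeasurableSpace S] [DiscreteMeasurableSpace A] (h : Fin H) (s : S) (a : A) :
    M.occ π h s a = M.stateProb π h.castSucc s * π.prob h s a := by
  rw [occ, stateOcc_eq]

end MDP

end OfflineRL

end

/-! ### Time reversal: the law of a visit given the later trajectory. -/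

noncomputable section

namespace OfflineRL

universe u v

variable {S : Type u} {A : Type v} {H : ℕ}

/-- The part of a trajectory after step `h`; the earlier coordinates are overwritten. -/
def Trajectory.tail (h : Fin H) (s : S) (a : A) (ω : Trajectory S A H) : Trajectory S A H :=
  (fun k => if h.castSucc < k then ω.1 k else s, fun k => if h < k then ω.2.1 k else a,
    fun k => if h < k then ω.2.2 k else 0)

lemma Trajectory.tail_state_succ (h : Fin H) (s : S) (a : A) (ω : Trajectory S A H) :
    (ω.tail h s a).state h.succ = ω.state h.succ := by
  simp [Trajectory.tail, Trajectory.state]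

lemma Trajectory.measurable_tail [MeasurableSpace S] [MeasurableSpace A] (h : Fin H) (s : S)
    (a : A) : Measurable (Trajectory.tail h s a) := by
  refine Measurable.prodMk ?_ (Measurable.prodMk ?_ ?_) <;>
    refine measurable_pi_lambda _ fun k => ?_ <;> split_ifs <;> fun_prop

namespace MDP

/-- Overwriting the rewards up to step `h` by zero turns their factors of the product law into Dirac
masses. The remaining factors see only the part of the path after step `h`. -/
lemma rewLaw_tail_congr [Fintype S] [MeasurableSpace S] [MeasurableSpace A] (M : MDP S A H) (h : Fin H) (s : S) (a : A) 
    {E : Set (Trajectory S A H)}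
    (hE : MeasurableSet E) {p q : (Fin (H + 1) → S) × (Fin H → A)}
    (h1 : ∀ k, h.castSucc < k → p.1 k = q.1 k) (h2 : ∀ k, h < k → p.2 k = q.2 k) :
    M.rewLaw p {r | Trajectory.tail h s a (p.1, p.2, r) ∈ E} =
      M.rewLaw q {r | Trajectory.tail h s a (q.1, q.2, r) ∈ E} := by
  set f : Fin H → ℝ → ℝ := fun k x => if h < k then x else 0 with hf
  have hfm : ∀ k, Measurable (f k) := fun k => by
    simp only [hf]; split_ifs <;> fun_prop
  set E' : Set (Fin H → ℝ) := {r | ((fun k => if h.castSucc < k then p.1 k else s,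
    fun k => if h < k then p.2 k else a, r) : Trajectory S A H) ∈ E} with hE'
  have hE'm : MeasurableSet E' := by
    have : Measurable fun r : Fin H → ℝ => ((fun k => if h.castSucc < k then p.1 k else s,
      fun k => if h < k then p.2 k else a, r) : Trajectory S A H) := by fun_prop
    exact this hE
  have hq : ((fun k => if h.castSucc < k then q.1 k else s,
      fun k => if h < k then q.2 k else a) : (Fin (H + 1) → S) × (Fin H → A)) =
      (fun k => if h.castSucc < k then p.1 k else s, fun k => if h < k then p.2 k else a) := by
    refine Prod.ext ?_ ?_ <;> funext k <;> simp only
    · split_ifs with hk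
      · exact (h1 k hk).symm
      · rfl
    · split_ifs with hk
      · exact (h2 k hk).symm
      · rfl
  have key : ∀ p' : (Fin (H + 1) → S) × (Fin H → A),
      (∀ k, h.castSucc < k → p.1 k = p'.1 k) → (∀ k, h < k → p.2 k = p'.2 k) →
      M.rewLaw p' {r | (fun k => f k (r k)) ∈ E'} = Measure.pi (fun k : Fin H =>
        if h < k then (M.reward k (p.1 k.castSucc) (p.2 k) : Measure ℝ) else Measure.dirac 0) E' := by
    intro p' hp1 hp2
    have : ∀ k, IsProbabilityMeasure
        ((M.reward k (p'.1 k.castSucc) (p'.2 k) : Measure ℝ).map (f k)) :=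
      fun k => Measure.isProbabilityMeasure_map (hfm k).aemeasurable
    have e := Measure.pi_map_pi (μ := fun k : Fin H =>
      (M.reward k (p'.1 k.castSucc) (p'.2 k) : Measure ℝ)) (f := f)
      (fun k => (hfm k).aemeasurable)
    have hmn : Measurable fun (r : Fin H → ℝ) k => f k (r k) :=
      measurable_pi_lambda _ fun k => (hfm k).comp (measurable_pi_apply k)
    change (Measure.pi _) ((fun (r : Fin H → ℝ) k => f k (r k)) ⁻¹' E') = _
    rw [← Measure.map_apply hmn hE'm, e]
    congr 2
    funext k
    by_cases hk : h < k
    · have hf1 : f k = id := by funext x; simp [hf, hk]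
      rw [if_pos hk, hf1, Measure.map_id, hp2 k hk, hp1 _ (Fin.castSucc_lt_castSucc_iff.2 hk)]
    · have hf1 : f k = fun _ => 0 := by funext x; simp [hf, hk]
      rw [if_neg hk, hf1, Measure.map_const]
      simp
  have hq1 := congrArg Prod.fst hq
  have hq2 := congrArg Prod.snd hq
  have e1 := key p (fun _ _ => rfl) (fun _ _ => rfl)
  have e2 := key q h1 h2
  have s1 : {r | Trajectory.tail h s a (p.1, p.2, r) ∈ E} = {r | (fun k => f k (r k)) ∈ E'} := rfl
  have s2 : {r | Trajectory.tail h s a (q.1, q.2, r) ∈ E} = {r | (fun k => f k (r k)) ∈ E'} := by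
    ext r
    simp only [hE', Set.mem_ofPred_eq, Trajectory.tail]
    simp only at hq1 hq2
    rw [hq1, hq2]
  rw [s1, s2, e1, e2]

variable [Fintype S] [Fintype A] (M : MDP S A H) (π : Policy S A H)

/-- Probability that `(s_h, a_h) = (s, a)` given the next state. -/
def backProb [DecidableEq S] (h : Fin H) (s : S) (a : A) (s' : S) : ℝ :=
  M.stateProb π h.castSucc s * π.prob h s a * M.trans h s a s' / M.stateProb π h.succ s'

lemma visit_trans_nonneg [DecidableEq S] (h : Fin H) (s : S) (a : A) (s' : S) :
    0 ≤ M.stateProb π h.castSucc s * π.prob h s a * M.trans h s a s' :=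
  mul_nonneg (mul_nonneg (M.stateProb_nonneg π _ _) ((π.prob_mem h s).1 a))
    ((M.trans_mem h s a).1 s')

lemma visit_trans_le [DecidableEq S] (h : Fin H) (s : S) (a : A) (s' : S) :
    M.stateProb π h.castSucc s * π.prob h s a * M.trans h s a s' ≤ M.stateProb π h.succ s' := by
  rw [M.stateProb_succ π h s']
  calc _ = M.stateProb π h.castSucc s * (π.prob h s a * M.trans h s a s') := by ring
    _ ≤ M.stateProb π h.castSucc s * ∑ b, π.prob h s b * M.trans h s b s' :=
        mul_le_mul_of_nonneg_left (Finset.single_le_sum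
          (f := fun b => π.prob h s b * M.trans h s b s')
          (fun b _ => mul_nonneg ((π.prob_mem h s).1 b) ((M.trans_mem h s b).1 s'))
          (Finset.mem_univ a)) (M.stateProb_nonneg π _ _)
    _ ≤ _ := Finset.single_le_sum
        (f := fun x => M.stateProb π h.castSucc x * ∑ b, π.prob h x b * M.trans h x b s')
        (fun x _ => mul_nonneg (M.stateProb_nonneg π _ _) (Finset.sum_nonneg fun b _ =>
          mul_nonneg ((π.prob_mem h x).1 b) ((M.trans_mem h x b).1 s'))) (Finset.mem_univ s)

lemma backProb_nonneg [DecidableEq S] (h : Fin H) (s : S) (a : A) (s' : S) :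
    0 ≤ M.backProb π h s a s' :=
  div_nonneg (M.visit_trans_nonneg π h s a s') (M.stateProb_nonneg π _ _)

lemma backProb_le_one [DecidableEq S] (h : Fin H) (s : S) (a : A) (s' : S) :
    M.backProb π h s a s' ≤ 1 :=
  div_le_one_of_le₀ (M.visit_trans_le π h s a s') (M.stateProb_nonneg π _ _)

/-- Bayes' rule. It survives division by zero, since the joint probability is at most the marginal
one and vanishes with it. -/
lemma stateProb_mul_backProb [DecidableEq S] (h : Fin H) (s : S) (a : A) (s' : S) :
    M.stateProb π h.succ s' * M.backProb π h s a s' =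
      M.stateProb π h.castSucc s * π.prob h s a * M.trans h s a s' := by
  rcases (M.stateProb_nonneg π h.succ s').eq_or_lt with h0 | h0
  · have h1 := M.visit_trans_nonneg π h s a s'
    have h2 := M.visit_trans_le π h s a s'
    rw [← h0] at h2 ⊢
    linarith
  · rw [backProb, mul_div_cancel₀ _ h0.ne']

/-- Given the future, the pair `(s_h, a_h)` only depends on `s_{h+1}`. -/
lemma pathExp_visit_mul_future [DecidableEq S] [DecidableEq A] (h : Fin H) (s : S) (a : A)
    {F : (Fin (H + 1) → S) × (Fin H → A) → ℝ} (hF0 : ∀ p, 0 ≤ F p) (hF1 : ∀ p, F p ≤ 1)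
    (hF : ∀ p q : (Fin (H + 1) → S) × (Fin H → A), (∀ k, h.castSucc < k → p.1 k = q.1 k) →
      (∀ k, h < k → p.2 k = q.2 k) → F p = F q) :
    M.pathExp π (fun p => (if p.1 h.castSucc = s ∧ p.2 h = a then 1 else 0) * F p) =
      M.pathExp π (fun p => M.backProb π h s a (p.1 h.succ) * F p) := by
  set G : (Fin (H + 1) → S) × (Fin H → A) → ℝ :=
    fun p => if p.1 h.castSucc = s ∧ p.2 h = a then 1 else 0 with hG
  have hG0 : ∀ p, 0 ≤ G p := fun p => by simp only [hG]; split_ifs <;> norm_num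
  have hG1 : ∀ p, G p ≤ 1 := fun p => by simp only [hG]; split_ifs <;> norm_num
  have hsplit : ∀ K : (Fin (H + 1) → S) × (Fin H → A) → ℝ, M.pathExp π K =
      ∑ s', M.pathExp π (fun p => (if p.1 h.succ = s' then 1 else 0) * K p) := by
    intro K
    rw [← pathExp_sum]
    congr 1
    funext p
    simp
  rw [hsplit, hsplit (fun p => M.backProb π h s a (p.1 h.succ) * F p)]
  refine Finset.sum_congr rfl fun s' _ => ?_
  have hsw := M.pathExp_past_future π h s' (G := G) (F := F)
    (fun p q h1 h2 => by simp only [hG, h1 _ le_rfl, h2 _ le_rfl]) hF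
  have hj : M.pathExp π (fun p => (if p.1 h.succ = s' then 1 else 0) * G p) =
      M.stateProb π h.castSucc s * π.prob h s a * M.trans h s a s' := by
    have := M.pathExp_visit π h s a (fun x => if x = s' then 1 else 0)
    simp only [mul_ite, mul_one, mul_zero, Finset.sum_ite_eq', Finset.mem_univ, if_true] at this
    rw [← this]
    congr 1
    funext p
    simp only [hG]
    split_ifs <;> simp
  have hB : M.pathExp π (fun p => (if p.1 h.succ = s' then 1 else 0) *
      (M.backProb π h s a (p.1 h.succ) * F p)) = M.backProb π h s a s' *
      M.pathExp π (fun p => (if p.1 h.succ = s' then 1 else 0) * F p) := by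
    rw [← pathExp_const_mul]
    congr 1
    funext p
    by_cases hp : p.1 h.succ = s'
    · simp [hp]
    · simp [hp]
  rw [hB]
  have hm : M.pathExp π (fun p => if p.1 h.succ = s' then 1 else 0) = M.stateProb π h.succ s' :=
    rfl
  rw [hm, hj] at hsw
  have hassoc : (fun p => (if p.1 h.succ = s' then 1 else 0) * G p * F p) =
      fun p => (if p.1 h.succ = s' then (1 : ℝ) else 0) * (G p * F p) := by
    funext p; ring
  rw [hassoc] at hsw
  rcases (M.stateProb_nonneg π h.succ s').eq_or_lt with h0 | h0
  · have hz : ∀ K : (Fin (H + 1) → S) × (Fin H → A) → ℝ, (∀ p, 0 ≤ K p) → (∀ p, K p ≤ 1) →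
        M.pathExp π (fun p => (if p.1 h.succ = s' then 1 else 0) * K p) = 0 := by
      intro K hK0 hK1
      apply le_antisymm
      · refine (M.pathExp_mono π (G := fun p => if p.1 h.succ = s' then 1 else 0)
          fun p _ => ?_).trans h0.ge
        by_cases hp : p.1 h.succ = s'
        · simpa [hp] using hK1 p
        · simp [hp]
      · refine M.pathExp_nonneg π fun p => mul_nonneg ?_ (hK0 p)
        split_ifs <;> norm_num
    rw [hz _ (fun p => mul_nonneg (hG0 p) (hF0 p)) (fun p => mul_le_one₀ (hG1 p) (hF0 p) (hF1 p)),
      hz F hF0 hF1, mul_zero]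
  · rw [backProb, div_mul_eq_mul_div, eq_div_iff h0.ne']
    exact hsw

section Law

variable [MeasurableSpace S] [MeasurableSpace A]

lemma lintegral_law {F : Trajectory S A H → ENNReal} (hF : Measurable F) :
    ∫⁻ ω, F ω ∂(M.law π) = ∑ p : (Fin (H + 1) → S) × (Fin H → A),
      ENNReal.ofReal (M.pathProb π p.1 p.2) * ∫⁻ r, F (p.1, p.2, r) ∂(M.rewLaw p) := by
  rw [law_eq, lintegral_finsetSum_measure]
  refine Finset.sum_congr rfl fun p _ => ?_
  rw [lintegral_smul_measure, lintegral_map hF (by fun_prop), smul_eq_mul]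

/-- The backward kernel is the conditional probability of a visit of `(s, a)` at step `h` given the
trajectory after step `h`. -/
lemma law_visit_inter_tail [DecidableEq S] [DecidableEq A] [DiscreteMeasurableSpace S]
    [DiscreteMeasurableSpace A] (h : Fin H) (s : S) (a : A)
    {E : Set (Trajectory S A H)} (hE : MeasurableSet E) :
    M.law π ({ω | ω.state h.castSucc = s ∧ ω.action h = a} ∩ Trajectory.tail h s a ⁻¹' E) =
      ∫⁻ ω in Trajectory.tail h s a ⁻¹' E,
        ENNReal.ofReal (M.backProb π h s a ((ω.tail h s a).state h.succ)) ∂(M.law π) := by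
  have htE : MeasurableSet (Trajectory.tail h s a ⁻¹' E) := Trajectory.measurable_tail h s a hE
  have hst : Measurable fun ω : Trajectory S A H => ω.state h.castSucc := by
    unfold Trajectory.state; fun_prop
  have hst' : Measurable fun ω : Trajectory S A H => ω.state h.succ := by
    unfold Trajectory.state; fun_prop
  have hac : Measurable fun ω : Trajectory S A H => ω.action h := by
    unfold Trajectory.action; fun_prop
  have hX : MeasurableSet {ω : Trajectory S A H | ω.state h.castSucc = s ∧ ω.action h = a} :=
    (hst (measurableSet_singleton s)).inter (hac (measurableSet_singleton a))
  -- Integrating out the rewards reduces the claim to state-action paths; `ρ` depends only on the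
  -- part of the path after step `h`, as `pathExp_visit_mul_future` requires.
  set ρ : (Fin (H + 1) → S) × (Fin H → A) → ℝ := fun p =>
    (M.rewLaw p).real {r | Trajectory.tail h s a (p.1, p.2, r) ∈ E} with hρ
  have hρ0 : ∀ p, 0 ≤ ρ p := fun p => measureReal_nonneg
  have key := M.pathExp_visit_mul_future π h s a (F := ρ) hρ0
    (fun p => measureReal_le_one) (fun p q h1 h2 => by
      simp only [hρ, measureReal_def, M.rewLaw_tail_congr h s a hE h1 h2])
  have hL : M.law π ({ω | ω.state h.castSucc = s ∧ ω.action h = a} ∩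
      Trajectory.tail h s a ⁻¹' E) = ENNReal.ofReal (M.pathExp π
        (fun p => (if p.1 h.castSucc = s ∧ p.2 h = a then 1 else 0) * ρ p)) := by
    rw [law_apply _ _ (hX.inter htE), pathExp, ENNReal.ofReal_sum_of_nonneg]
    · refine Finset.sum_congr rfl fun p _ => ?_
      rw [ENNReal.ofReal_mul (M.pathProb_nonneg π _ _)]
      congr 1
      by_cases hp : p.1 h.castSucc = s ∧ p.2 h = a
      · rw [if_pos hp, one_mul, hρ, ofReal_measureReal]
        congr 1
        ext r
        simp [Trajectory.state, Trajectory.action, hp]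
      · rw [if_neg hp, zero_mul, ENNReal.ofReal_zero]
        convert measure_empty
        · ext r
          simp only [Trajectory.state, Trajectory.action, Set.mem_ofPred_eq, Set.mem_inter_iff,
            Set.mem_empty_iff_false, iff_false]
          tauto
        · infer_instance
    · intro p _
      refine mul_nonneg (M.pathProb_nonneg π _ _) (mul_nonneg ?_ (hρ0 p))
      split_ifs <;> norm_num
  have hR : ∫⁻ ω in Trajectory.tail h s a ⁻¹' E,
        ENNReal.ofReal (M.backProb π h s a ((ω.tail h s a).state h.succ)) ∂(M.law π) =
      ENNReal.ofReal (M.pathExp π (fun p => M.backProb π h s a (p.1 h.succ) * ρ p)) := by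
    simp_rw [Trajectory.tail_state_succ]
    rw [← lintegral_indicator htE, lintegral_law, pathExp, ENNReal.ofReal_sum_of_nonneg]
    · refine Finset.sum_congr rfl fun p _ => ?_
      rw [ENNReal.ofReal_mul (M.pathProb_nonneg π _ _),
        ENNReal.ofReal_mul (M.backProb_nonneg π _ _ _ _)]
      congr 1
      have hm : MeasurableSet {r | Trajectory.tail h s a (p.1, p.2, r) ∈ E} := by
        have : Measurable fun r : Fin H → ℝ => ((p.1, p.2, r) : Trajectory S A H) := by fun_prop
        exact this htE
      rw [hρ, ofReal_measureReal, ← lintegral_indicator_const hm]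
      rfl
    · exact fun p _ => mul_nonneg (M.pathProb_nonneg π _ _)
        (mul_nonneg (M.backProb_nonneg π _ _ _ _) (hρ0 p))
    · refine Measurable.indicator ?_ htE
      exact (Measurable.of_discrete (f := fun x => ENNReal.ofReal (M.backProb π h s a x))).comp hst'
  rw [hL, hR, key]

end Law

end MDP

end OfflineRL

end

noncomputable section

namespace OfflineRL

universe u v

variable {S : Type u} {A : Type v} [Fintype S] {H : ℕ}

/-! ### Elementary properties of weighted means and variances. -/

section WeightedMean

lemma wMean_add (p f g : S → ℝ) : wMean p (fun x => f x + g x) = wMean p f + wMean p g := by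
  simp [wMean, mul_add, Finset.sum_add_distrib]

lemma wMean_sub (p f g : S → ℝ) : wMean p (fun x => f x - g x) = wMean p f - wMean p g := by
  simp [wMean, mul_sub, Finset.sum_sub_distrib]

lemma wMean_const_mul (p : S → ℝ) (c : ℝ) (f : S → ℝ) :
    wMean p (fun x => c * f x) = c * wMean p f := by
  simp only [wMean, Finset.mul_sum]
  exact Finset.sum_congr rfl fun x _ => by ring

lemma wMean_const {p : S → ℝ} (hp : p ∈ stdSimplex ℝ S) (c : ℝ) : wMean p (fun _ => c) = c := by
  simp [wMean, ← Finset.sum_mul, hp.2]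

lemma wMean_mono {p f g : S → ℝ} (hp : ∀ x, 0 ≤ p x) (h : ∀ x, 0 < p x → f x ≤ g x) :
    wMean p f ≤ wMean p g := by
  refine Finset.sum_le_sum fun x _ => ?_
  rcases (hp x).eq_or_lt with h0 | h0
  · rw [← h0, zero_mul, zero_mul]
  · exact mul_le_mul_of_nonneg_left (h x h0) h0.le

lemma wMean_nonneg {p f : S → ℝ} (hp : ∀ x, 0 ≤ p x) (h : ∀ x, 0 ≤ f x) : 0 ≤ wMean p f :=
  Finset.sum_nonneg fun x _ => mul_nonneg (hp x) (h x)

lemma wVar_eq {p : S → ℝ} (hp : p ∈ stdSimplex ℝ S) (f : S → ℝ) :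
    wVar p f = wMean p (fun x => f x ^ 2) - wMean p f ^ 2 := by
  have h : ∀ x, p x * (f x - wMean p f) ^ 2 =
      p x * f x ^ 2 + (p x * wMean p f ^ 2 - 2 * wMean p f * (p x * f x)) := fun x => by ring
  unfold wVar
  simp_rw [h]
  rw [Finset.sum_add_distrib, Finset.sum_sub_distrib, ← Finset.mul_sum, ← Finset.sum_mul, hp.2]
  simp only [wMean]
  ring

lemma wVar_nonneg {p : S → ℝ} (hp : ∀ x, 0 ≤ p x) (f : S → ℝ) : 0 ≤ wVar p f :=
  Finset.sum_nonneg fun x _ => mul_nonneg (hp x) (sq_nonneg _)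

lemma abs_wMean_le {p f : S → ℝ} (hp : p ∈ stdSimplex ℝ S) {c : ℝ} (hf : ∀ x, |f x| ≤ c) :
    |wMean p f| ≤ c := by
  calc |wMean p f| ≤ ∑ x, |p x * f x| := Finset.abs_sum_le_sum_abs _ _
    _ ≤ ∑ x, p x * c := Finset.sum_le_sum fun x _ => by
        rw [abs_mul, abs_of_nonneg (hp.1 x)]
        exact mul_le_mul_of_nonneg_left (hf x) (hp.1 x)
    _ = c := by rw [← Finset.sum_mul, hp.2, one_mul]

end WeightedMean

variable [Fintype A]

namespace MDP

/-! ### Performance difference and comparison of values. -/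

section Comparison

variable [DecidableEq S] [MeasurableSpace S] [MeasurableSpace A] [DiscreteMeasurableSpace S]
  [DiscreteMeasurableSpace A] {M : MDP S A H} (π : Policy S A H)

/-- Performance difference of `π` with respect to an arbitrary sequence of functions. -/
lemma BoundedTotalReward.value_sub (hM : M.BoundedTotalReward) (U : Fin (H + 1) → S → ℝ)
    (hU : ∀ s, U (Fin.last H) s = 0) :
    M.value π - ∑ s, M.init s * U 0 s = ∑ h : Fin H, ∑ s, M.stateProb π h.castSucc s *
      ((∑ a, π.prob h s a * (M.meanRew h s a + wMean (M.trans h s a) (U h.succ))) -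
        U h.castSucc s) := by
  have h1 : M.value π =
      ∑ h : Fin H, ∑ s, M.stateProb π h.castSucc s * ∑ a, π.prob h s a * M.meanRew h s a := by
    rw [hM.value_eq, pathExp_sum]
    refine Finset.sum_congr rfl fun h _ => ?_
    rw [M.pathExp_step_eq π h fun s a _ => M.meanRew h s a]
    simp_rw [← Finset.sum_mul, (M.trans_mem h _ _).2, one_mul]
  have h2 : ∀ h : Fin H, ∑ s, M.stateProb π h.castSucc s *
      ∑ a, π.prob h s a * wMean (M.trans h s a) (U h.succ) =
      ∑ s, M.stateProb π h.succ s * U h.succ s := by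
    intro h
    rw [← M.pathExp_state π h.succ, M.pathExp_step_eq π h fun _ _ x => U h.succ x]
    rfl
  have h3 := sum_castSucc_sub_succ fun k => ∑ s, M.stateProb π k s * U k s
  simp only [hU, mul_zero, Finset.sum_const_zero, sub_zero, stateProb_zero] at h3
  rw [h1, ← h3, ← Finset.sum_sub_distrib]
  refine Finset.sum_congr rfl fun h _ => ?_
  rw [← h2 h, ← Finset.sum_sub_distrib, ← Finset.sum_sub_distrib]
  refine Finset.sum_congr rfl fun s _ => ?_
  simp only [mul_add, Finset.sum_add_distrib]
  ring

/-- A supersolution of the policy's Bellman equation dominates its value, and by the performance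
difference identity only the states reached by that policy count. It is applied to `optV`; the
companion for subsolutions is applied to `vHat - potential`. -/
lemma BoundedTotalReward.value_le (hM : M.BoundedTotalReward) (U : Fin (H + 1) → S → ℝ)
    (hU : ∀ s, U (Fin.last H) s = 0)
    (h : ∀ (h : Fin H) s, 0 < M.stateProb π h.castSucc s →
      ∑ a, π.prob h s a * (M.meanRew h s a + wMean (M.trans h s a) (U h.succ)) ≤
        U h.castSucc s) :
    M.value π ≤ ∑ s, M.init s * U 0 s := by
  have h1 := hM.value_sub π U hU
  have h2 : ∑ h : Fin H, ∑ s, M.stateProb π h.castSucc s *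
      ((∑ a, π.prob h s a * (M.meanRew h s a + wMean (M.trans h s a) (U h.succ))) -
        U h.castSucc s) ≤ 0 := by
    refine Finset.sum_nonpos fun k _ => Finset.sum_nonpos fun s _ => ?_
    rcases (M.stateProb_nonneg π k.castSucc s).eq_or_lt with h0 | h0
    · rw [← h0, zero_mul]
    · exact mul_nonpos_of_nonneg_of_nonpos h0.le (sub_nonpos.2 (h k s h0))
  linarith

lemma BoundedTotalReward.le_value (hM : M.BoundedTotalReward) (U : Fin (H + 1) → S → ℝ)
    (hU : ∀ s, U (Fin.last H) s = 0)
    (h : ∀ (h : Fin H) s, 0 < M.stateProb π h.castSucc s → U h.castSucc s ≤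
      ∑ a, π.prob h s a * (M.meanRew h s a + wMean (M.trans h s a) (U h.succ))) :
    ∑ s, M.init s * U 0 s ≤ M.value π := by
  have h1 := hM.value_sub π U hU
  have h2 : 0 ≤ ∑ h : Fin H, ∑ s, M.stateProb π h.castSucc s *
      ((∑ a, π.prob h s a * (M.meanRew h s a + wMean (M.trans h s a) (U h.succ))) -
        U h.castSucc s) := by
    refine Finset.sum_nonneg fun k _ => Finset.sum_nonneg fun s _ => ?_
    rcases (M.stateProb_nonneg π k.castSucc s).eq_or_lt with h0 | h0
    · rw [← h0, zero_mul]
    · exact mul_nonneg h0.le (sub_nonneg.2 (h k s h0))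
  linarith

end Comparison

/-! ### The optimal value function and its range. -/

section OptimalValue

variable [DecidableEq S]

open Classical in
/-- Optimal value function, set to zero at the states that the policy `μ` does not reach. -/
def optV (M : MDP S A H) (μ : Policy S A H) : Fin (H + 1) → S → ℝ :=
  backward 0 fun h V s =>
    if 0 < M.stateProb μ h.castSucc s then ⨆ a, (M.meanRew h s a + wMean (M.trans h s a) V) else 0

variable (M : MDP S A H) (μ : Policy S A H)

lemma optV_last (s : S) : M.optV μ (Fin.last H) s = 0 := by
  rw [optV, backward_last]

lemma optV_of_unreached {h : Fin H} {s : S} (hs : ¬ 0 < M.stateProb μ h.castSucc s) :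
    M.optV μ h.castSucc s = 0 := by
  rw [optV, backward_castSucc, if_neg hs]

lemma bellman_le_optV {h : Fin H} {s : S} (hs : 0 < M.stateProb μ h.castSucc s) (a : A) :
    M.meanRew h s a + wMean (M.trans h s a) (M.optV μ h.succ) ≤ M.optV μ h.castSucc s := by
  conv_rhs => rw [optV, backward_castSucc, if_pos hs]
  exact le_ciSup (f := fun a => M.meanRew h s a + wMean (M.trans h s a) (M.optV μ h.succ))
    (Set.finite_range _).bddAbove a

lemma exists_bellman_eq_optV {h : Fin H} {s : S} (hs : 0 < M.stateProb μ h.castSucc s) :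
    ∃ a, M.meanRew h s a + wMean (M.trans h s a) (M.optV μ h.succ) = M.optV μ h.castSucc s := by
  have : Nonempty A := by
    by_contra hA
    rw [not_nonempty_iff] at hA
    simpa using (μ.prob_mem h s).2
  obtain ⟨a, ha⟩ := exists_eq_ciSup_of_finite
    (f := fun a => M.meanRew h s a + wMean (M.trans h s a) (M.optV μ h.succ))
  refine ⟨a, ?_⟩
  conv_rhs => rw [optV, backward_castSucc, if_pos hs]
  exact ha

variable [MeasurableSpace S] [MeasurableSpace A] {M μ}

/-- Positive occupancy yields a feasible path through `(s, a)`, and along such a path the assumption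
controls each single reward. -/
lemma BoundedTotalReward.ae_reward_mem [DecidableEq A] (hM : M.BoundedTotalReward) {h : Fin H}
    {s : S} {a : A} (hs : 0 < M.stateProb μ h.castSucc s * μ.prob h s a) :
    ∀ᵐ x ∂(M.reward h s a : Measure ℝ), 0 ≤ x ∧ x ≤ 1 := by
  have h1 := M.pathExp_visit μ h s a fun _ => 1
  simp only [mul_one, (M.trans_mem h s a).2] at h1
  have : ∃ p : (Fin (H + 1) → S) × (Fin H → A), 0 < M.pathProb μ p.1 p.2 ∧
      p.1 h.castSucc = s ∧ p.2 h = a := by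
    by_contra hc
    push Not at hc
    refine hs.ne' ?_
    rw [← h1]
    have h2 : M.pathExp μ (fun p => if p.1 h.castSucc = s ∧ p.2 h = a then 1 else 0) =
        M.pathExp μ fun _ => 0 :=
      M.pathExp_congr μ fun p hp => by
        rw [if_neg]
        rintro ⟨h3, h4⟩
        exact hc p hp h3 h4
    rw [h2]
    simp [pathExp]
  obtain ⟨p, hp, rfl, rfl⟩ := this
  exact hM.ae_mem μ hp h

lemma BoundedTotalReward.meanRew_mem [DecidableEq A] (hM : M.BoundedTotalReward) {h : Fin H}
    {s : S} {a : A} (hs : 0 < M.stateProb μ h.castSucc s * μ.prob h s a) :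
    0 ≤ M.meanRew h s a ∧ M.meanRew h s a ≤ 1 := by
  have h1 := hM.ae_reward_mem hs
  have hi : Integrable (fun x : ℝ => x) (M.reward h s a : Measure ℝ) := by
    refine integrable_of_ae_abs_le (c := 1) measurable_id ?_
    filter_upwards [h1] with x hx
    rw [abs_of_nonneg hx.1]
    exact hx.2
  constructor
  · exact integral_nonneg_of_ae (h1.mono fun x hx => hx.1)
  · calc M.meanRew h s a ≤ ∫ _, (1 : ℝ) ∂(M.reward h s a : Measure ℝ) :=
        integral_mono_ae hi (integrable_const _) (h1.mono fun x hx => hx.2)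
      _ = 1 := by simp

lemma BoundedTotalReward.optV_nonneg [DecidableEq A] (hM : M.BoundedTotalReward)
    (hμ : ∀ (h : Fin H) s a, 0 < M.stateProb μ h.castSucc s → 0 < μ.prob h s a)
    (k : Fin (H + 1)) : ∀ s, 0 ≤ M.optV μ k s := by
  induction k using Fin.reverseInduction with
  | last => exact fun s => (M.optV_last μ s).ge
  | cast h ih =>
    intro s
    by_cases hs : 0 < M.stateProb μ h.castSucc s
    · obtain ⟨a, ha⟩ := M.exists_bellman_eq_optV μ hs
      rw [← ha]
      exact add_nonneg (hM.meanRew_mem (mul_pos hs (hμ h s a hs))).1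
        (wMean_nonneg (M.trans_mem h s a).1 ih)
    · exact (M.optV_of_unreached μ hs).ge

/-- The expected reward collected up to time `k` along a feasible path, plus the optimal value from
time `k` on, is at most one. -/
lemma BoundedTotalReward.sum_add_optV_le [DecidableEq A] (hM : M.BoundedTotalReward)
    (hμ : ∀ (h : Fin H) s a, 0 < M.stateProb μ h.castSucc s → 0 < μ.prob h s a)
    (k : Fin (H + 1)) : ∀ p : (Fin (H + 1) → S) × (Fin H → A), 0 < M.init (p.1 0) →
      (∀ j : Fin H, j.castSucc < k → 0 < μ.prob j (p.1 j.castSucc) (p.2 j) ∧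
        0 < M.trans j (p.1 j.castSucc) (p.2 j) (p.1 j.succ)) →
      ∑ j : Fin H, (if j.castSucc < k then M.meanRew j (p.1 j.castSucc) (p.2 j) else 0) +
        M.optV μ k (p.1 k) ≤ 1 := by
  induction k using Fin.reverseInduction with
  | last =>
    intro p h0 hp
    have hpos : 0 < M.pathProb μ p.1 p.2 :=
      mul_pos h0 (Finset.prod_pos fun j _ =>
        mul_pos (hp j (Fin.castSucc_lt_last j)).1 (hp j (Fin.castSucc_lt_last j)).2)
    simpa [optV_last, Fin.castSucc_lt_last] using hM.sum_meanRew_le μ hpos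
  | cast h ih =>
    intro p h0 hp
    -- Only the initial segment of `p` is assumed feasible, so positivity of the occupancies is
    -- propagated forward along it.
    have hreach : ∀ k : Fin (H + 1), k ≤ h.castSucc → 0 < M.stateProb μ k (p.1 k) := by
      intro k
      induction k using Fin.induction with
      | zero => exact fun _ => by rw [stateProb_zero]; exact h0
      | succ i ihi =>
        intro hi
        have hi' : i.castSucc < h.castSucc := Fin.castSucc_lt_succ.trans_le hi
        exact (mul_pos (mul_pos (ihi hi'.le) (hp i hi').1) (hp i hi').2).trans_le
          (M.visit_trans_le μ i _ _ _)
    have hs := hreach h.castSucc le_rfl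
    set s := p.1 h.castSucc with hsdef
    obtain ⟨a, ha⟩ := M.exists_bellman_eq_optV μ hs
    set R := ∑ j : Fin H,
      (if j.castSucc < h.castSucc then M.meanRew j (p.1 j.castSucc) (p.2 j) else 0) with hR
    have hV : ∀ s', 0 < M.trans h s a s' → M.optV μ h.succ s' ≤ 1 - R - M.meanRew h s a := by
      intro s' hs'
      -- The path is continued by a maximizing action and an arbitrary possible next state. Coverage
      -- of all actions keeps it feasible for `μ`, so the induction hypothesis at `h + 1` applies to
      -- it.
      set p' : (Fin (H + 1) → S) × (Fin H → A) :=
        (Function.update p.1 h.succ s', Function.update p.2 h a) with hp'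
      have hold : ∀ k : Fin (H + 1), k ≤ h.castSucc → p'.1 k = p.1 k := fun k hk => by
        have : k ≠ h.succ := (hk.trans_lt Fin.castSucc_lt_succ).ne
        simp [hp', this]
      have holda : ∀ j : Fin H, j < h → p'.2 j = p.2 j := fun j hj => by
        simp [hp', hj.ne]
      have hnew : p'.1 h.succ = s' := by simp [hp']
      have hnewa : p'.2 h = a := by simp [hp']
      have h1 := ih p' (by rw [hold 0 (Fin.zero_le _)]; exact h0) (by
        intro j hj
        rcases (Fin.castSucc_lt_succ_iff.1 hj).eq_or_lt with rfl | hlt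
        · rw [hold _ le_rfl, hnewa, hnew]
          exact ⟨hμ _ _ _ hs, hs'⟩
        · rw [hold _ (Fin.castSucc_le_castSucc_iff.2 hlt.le), holda _ hlt,
            hold _ (Fin.succ_le_castSucc_iff.2 hlt)]
          exact hp j (Fin.castSucc_lt_castSucc_iff.2 hlt))
      have h2 : ∑ j : Fin H,
          (if j.castSucc < h.succ then M.meanRew j (p'.1 j.castSucc) (p'.2 j) else 0) =
          R + M.meanRew h s a := by
        have : ∀ j : Fin H,
            (if j.castSucc < h.succ then M.meanRew j (p'.1 j.castSucc) (p'.2 j) else 0) =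
            (if j.castSucc < h.castSucc then M.meanRew j (p.1 j.castSucc) (p.2 j) else 0) +
              if j = h then M.meanRew h s a else 0 := by
          intro j
          rcases lt_trichotomy j h with hj | hj | hj
          · rw [if_pos (Fin.castSucc_lt_succ_iff.2 hj.le),
              if_pos (Fin.castSucc_lt_castSucc_iff.2 hj), if_neg hj.ne,
              hold _ (Fin.castSucc_le_castSucc_iff.2 hj.le), holda _ hj, add_zero]
          · subst hj
            rw [if_pos Fin.castSucc_lt_succ, if_neg (lt_irrefl _), if_pos rfl, hold _ le_rfl,
              hnewa, zero_add]
          · rw [if_neg (by rw [Fin.castSucc_lt_succ_iff]; exact not_le.2 hj),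
              if_neg (by rw [Fin.castSucc_lt_castSucc_iff]; exact not_lt.2 hj.le),
              if_neg hj.ne', add_zero]
        rw [Finset.sum_congr rfl fun j _ => this j, Finset.sum_add_distrib]
        simp [hR]
      rw [h2, hnew] at h1
      linarith
    have h3 : wMean (M.trans h s a) (M.optV μ h.succ) ≤ 1 - R - M.meanRew h s a := by
      rw [← wMean_const (M.trans_mem h s a) (1 - R - M.meanRew h s a)]
      exact wMean_mono (M.trans_mem h s a).1 hV
    linarith

lemma BoundedTotalReward.optV_le_one [DecidableEq A] (hM : M.BoundedTotalReward)
    (hμ : ∀ (h : Fin H) s a, 0 < M.stateProb μ h.castSucc s → 0 < μ.prob h s a)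
    (k : Fin (H + 1)) (s : S) : M.optV μ k s ≤ 1 := by
  induction k using Fin.lastCases with
  | last => rw [optV_last]; exact zero_le_one
  | cast h =>
    by_cases hs : 0 < M.stateProb μ h.castSucc s
    · obtain ⟨p, hp, rfl⟩ := M.exists_path_of_stateProb_pos μ hs
      have hinit : 0 < M.init (p.1 0) := by
        refine (M.init_mem.1 _).lt_of_ne' fun h0 => hp.ne' ?_
        simp [pathProb, h0]
      have hstep : ∀ j : Fin H, 0 < μ.prob j (p.1 j.castSucc) (p.2 j) ∧
          0 < M.trans j (p.1 j.castSucc) (p.2 j) (p.1 j.succ) := by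
        intro j
        have hne : μ.prob j (p.1 j.castSucc) (p.2 j) *
            M.trans j (p.1 j.castSucc) (p.2 j) (p.1 j.succ) ≠ 0 :=
          Finset.prod_ne_zero_iff.1 (mul_ne_zero_iff.1 hp.ne').2 j (Finset.mem_univ j)
        exact ⟨((μ.prob_mem j _).1 _).lt_of_ne' (mul_ne_zero_iff.1 hne).1,
          ((M.trans_mem j _ _).1 _).lt_of_ne' (mul_ne_zero_iff.1 hne).2⟩
      have h1 := hM.sum_add_optV_le hμ h.castSucc p hinit fun j _ => hstep j
      have h2 : 0 ≤ ∑ j : Fin H,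
          (if j.castSucc < h.castSucc then M.meanRew j (p.1 j.castSucc) (p.2 j) else 0) := by
        refine Finset.sum_nonneg fun j _ => ?_
        split_ifs
        · exact (hM.meanRew_mem (mul_pos (M.stateProb_pos_of_path μ hp _) (hstep j).1)).1
        · exact le_rfl
      linarith
    · rw [M.optV_of_unreached μ hs]; exact zero_le_one

end OptimalValue

end MDP

end OfflineRL

end

/-! ### The value estimates as functions of the data. -/

noncomputable section

namespace OfflineRL

universe u v

variable {S : Type u} {A : Type v} {H n : ℕ}

lemma Trajectory.measurable_state [MeasurableSpace S] [MeasurableSpace A] (k : Fin (H + 1)) :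
    Measurable fun ω : Trajectory S A H => ω.state k := by
  unfold Trajectory.state; fun_prop

lemma Trajectory.measurable_action [MeasurableSpace S] [MeasurableSpace A] (h : Fin H) :
    Measurable fun ω : Trajectory S A H => ω.action h := by
  unfold Trajectory.action; fun_prop

lemma Trajectory.measurable_rew [MeasurableSpace S] [MeasurableSpace A] (h : Fin H) :
    Measurable fun ω : Trajectory S A H => ω.rew h := by
  unfold Trajectory.rew; fun_prop

lemma Trajectory.tail_state {h : Fin H} {k : Fin (H + 1)} (hk : h.castSucc < k) (s : S) (a : A)
    (ω : Trajectory S A H) : (ω.tail h s a).state k = ω.state k := by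
  simp [Trajectory.tail, Trajectory.state, hk]

lemma Trajectory.tail_action {h k : Fin H} (hk : h < k) (s : S) (a : A)
    (ω : Trajectory S A H) : (ω.tail h s a).action k = ω.action k := by
  simp [Trajectory.tail, Trajectory.action, hk]

lemma Trajectory.tail_rew {h k : Fin H} (hk : h < k) (s : S) (a : A)
    (ω : Trajectory S A H) : (ω.tail h s a).rew k = ω.rew k := by
  simp [Trajectory.tail, Trajectory.rew, hk]

lemma measurable_card_filter {Ω : Type*} [MeasurableSpace Ω] {p : Ω → Prop} [DecidablePred p]
    (hp : MeasurableSet {ω | p ω}) :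
    Measurable fun D : Fin n → Ω => (Finset.univ.filter fun τ => p (D τ)).card := by
  simp_rw [Finset.card_filter]
  refine Finset.measurable_sum _ fun τ _ => ?_
  exact Measurable.ite ((measurable_pi_apply τ) hp) measurable_const measurable_const

lemma measurable_wMean [Fintype S] {Ω : Type*} [MeasurableSpace Ω] {p f : Ω → S → ℝ}
    (hp : ∀ s, Measurable fun ω => p ω s) (hf : ∀ s, Measurable fun ω => f ω s) :
    Measurable fun ω => wMean (p ω) (f ω) :=
  Finset.measurable_sum _ fun s _ => (hp s).mul (hf s)

lemma measurable_wVar [Fintype S] {Ω : Type*} [MeasurableSpace Ω] {p f : Ω → S → ℝ}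
    (hp : ∀ s, Measurable fun ω => p ω s) (hf : ∀ s, Measurable fun ω => f ω s) :
    Measurable fun ω => wVar (p ω) (f ω) :=
  Finset.measurable_sum _ fun s _ => (hp s).mul (((hf s).sub (measurable_wMean hp hf)).pow_const 2)

lemma Trajectory.measurableSet_visit [MeasurableSpace S] [MeasurableSpace A]
    [DiscreteMeasurableSpace S] [DiscreteMeasurableSpace A] (h : Fin H) (s : S) (a : A) :
    MeasurableSet {ω : Trajectory S A H | ω.state h.castSucc = s ∧ ω.action h = a} :=
  (Trajectory.measurable_state h.castSucc (measurableSet_singleton s)).inter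
    (Trajectory.measurable_action h (measurableSet_singleton a))

lemma count_tail [DecidableEq S] [DecidableEq A] (D : Fin n → Trajectory S A H) {h j : Fin H} (hj : h < j) (s₀ s : S) (a₀ a : A) :
    count (fun τ => (D τ).tail h s₀ a₀) j s a = count D j s a := by
  have h1 : h.castSucc < j.castSucc := Fin.castSucc_lt_castSucc_iff.2 hj
  refine congrArg Finset.card (Finset.filter_congr fun τ _ => ?_)
  rw [Trajectory.tail_state h1, Trajectory.tail_action hj]

lemma measurable_count [MeasurableSpace S] [MeasurableSpace A] [DiscreteMeasurableSpace S]
    [DiscreteMeasurableSpace A] [DecidableEq S] [DecidableEq A] (h : Fin H) (s : S) (a : A) :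
    Measurable fun D : Fin n → Trajectory S A H => count D h s a :=
  measurable_card_filter (Trajectory.measurableSet_visit h s a)

lemma measurable_transHat [Fintype S] [MeasurableSpace S] [MeasurableSpace A]
    [DiscreteMeasurableSpace S] [DiscreteMeasurableSpace A] [DecidableEq S] [DecidableEq A] (h : Fin H) (s : S) (a : A) (s' : S) :
    Measurable fun D : Fin n → Trajectory S A H => transHat D h s a s' := by
  unfold transHat
  have h1 : MeasurableSet {ω : Trajectory S A H |
      ω.state h.castSucc = s ∧ ω.action h = a ∧ ω.state h.succ = s'} := by
    have := (Trajectory.measurableSet_visit (H := H) h s a).inter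
      (Trajectory.measurable_state h.succ (measurableSet_singleton s'))
    convert this using 1
    ext ω
    simp [and_assoc]
  refine Measurable.ite (measurable_count h s a (measurableSet_singleton 0)) measurable_const ?_
  exact ((measurable_from_top (f := fun m : ℕ => (m : ℝ))).comp (measurable_card_filter h1)).div
    ((measurable_from_top (f := fun m : ℕ => (m : ℝ))).comp (measurable_count h s a))

lemma measurable_rewHat [MeasurableSpace S] [MeasurableSpace A]
    [DiscreteMeasurableSpace S] [DiscreteMeasurableSpace A] [DecidableEq S] [DecidableEq A] (h : Fin H) (s : S) (a : A) :
    Measurable fun D : Fin n → Trajectory S A H => rewHat D h s a := by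
  unfold rewHat
  refine Measurable.ite (measurable_count h s a (measurableSet_singleton 0)) measurable_const ?_
  refine Measurable.div (Finset.measurable_sum _ fun τ _ => ?_)
    ((measurable_from_top (f := fun m : ℕ => (m : ℝ))).comp (measurable_count h s a))
  have hpr : Measurable fun D : Fin n → Trajectory S A H => D τ := measurable_pi_apply τ
  have hτ : MeasurableSet {D : Fin n → Trajectory S A H |
      (D τ).state h.castSucc = s ∧ (D τ).action h = a} :=
    hpr (Trajectory.measurableSet_visit h s a)
  exact Measurable.ite hτ
    ((Trajectory.measurable_rew h).comp (measurable_pi_apply τ)) measurable_const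

variable [Fintype S] [Fintype A] [DecidableEq S] [DecidableEq A]

/-- The pessimistic value estimates computed by the algorithm. -/
def vHat (C δ : ℝ) (D : Fin n → Trajectory S A H) : Fin (H + 1) → S → ℝ :=
  backward 0 fun h V s => ⨆ a, qBar C δ D h V s a

lemma vHat_last (C δ : ℝ) (D : Fin n → Trajectory S A H) (s : S) :
    vHat C δ D (Fin.last H) s = 0 := by
  rw [vHat, backward_last]

lemma vHat_castSucc (C δ : ℝ) (D : Fin n → Trajectory S A H) (h : Fin H) (s : S) :
    vHat C δ D h.castSucc s = ⨆ a, qBar C δ D h (vHat C δ D h.succ) s a := by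
  rw [vHat, backward_castSucc]

lemma qBar_le_vHat (C δ : ℝ) (D : Fin n → Trajectory S A H) (h : Fin H) (s : S) (a : A) :
    qBar C δ D h (vHat C δ D h.succ) s a ≤ vHat C δ D h.castSucc s := by
  rw [vHat_castSucc]
  exact le_ciSup (f := fun a => qBar C δ D h (vHat C δ D h.succ) s a)
    (Set.finite_range _).bddAbove a

lemma vHat_nonneg (C δ : ℝ) (D : Fin n → Trajectory S A H) (k : Fin (H + 1)) (s : S) :
    0 ≤ vHat C δ D k s := by
  induction k using Fin.lastCases with
  | last => exact (vHat_last C δ D s).ge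
  | cast h =>
    rw [vHat_castSucc]
    exact Real.iSup_nonneg fun a => le_max_right _ _

lemma vHat_le (C δ : ℝ) (D : Fin n → Trajectory S A H) (k : Fin (H + 1)) (s : S) :
    vHat C δ D k s ≤ H := by
  induction k using Fin.lastCases with
  | last => exact (vHat_last C δ D s).trans_le (Nat.cast_nonneg H)
  | cast h =>
    rw [vHat_castSucc]
    refine Real.iSup_le (fun a => max_le ((min_le_right _ _).trans ?_) (Nat.cast_nonneg H))
      (Nat.cast_nonneg H)
    linarith [Nat.cast_nonneg (α := ℝ) (h : ℕ)]

/-- The values of any run of the algorithm are given by `vHat`, whatever the tie-breaking rule. -/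
lemma IsAPVIOutput.vHat_castSucc_eq {C δ : ℝ} {D : Fin n → Trajectory S A H} {π : Policy S A H}
    (hπ : IsAPVIOutput C δ D π) (h : Fin H) (s : S) : vHat C δ D h.castSucc s =
      ∑ a, qBar C δ D h (vHat C δ D h.succ) s a * π.prob h s a := by
  obtain ⟨V, hlast, hV⟩ := hπ
  have hEq : ∀ k, V k = vHat C δ D k := by
    intro k
    induction k using Fin.reverseInduction with
    | last => funext s; rw [hlast, vHat_last]
    | cast h ih =>
      funext s
      have : Nonempty A := by
        by_contra hA
        rw [not_nonempty_iff] at hA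
        simpa using (π.prob_mem h s).2
      obtain ⟨h1, h2⟩ := hV h s
      rw [ih] at h1 h2
      rw [h2]
      apply le_antisymm
      · calc ∑ a, qBar C δ D h (vHat C δ D h.succ) s a * π.prob h s a
            ≤ ∑ a, vHat C δ D h.castSucc s * π.prob h s a :=
              Finset.sum_le_sum fun a _ => mul_le_mul_of_nonneg_right (qBar_le_vHat C δ D h s a)
                ((π.prob_mem h s).1 a)
          _ = vHat C δ D h.castSucc s := by rw [← Finset.mul_sum, (π.prob_mem h s).2, mul_one]
      -- Testing optimality against point masses shows that a maximizer over the simplex attains the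
      -- maximum over actions. The values are therefore independent of tie-breaking.
      · rw [vHat_castSucc]
        refine ciSup_le fun a => ?_
        have h3 := h1 _ (single_mem_stdSimplex ℝ a)
        rwa [Finset.sum_eq_single a (fun b _ hb => by rw [Pi.single_eq_of_ne hb, mul_zero])
          (fun ha => absurd (Finset.mem_univ a) ha), Pi.single_eq_same, mul_one] at h3
  rw [← hEq, ← hEq]
  exact (hV h s).2

lemma exists_qBar_eq_vHat [Nonempty A] (C δ : ℝ) (D : Fin n → Trajectory S A H) (h : Fin H)
    (s : S) : ∃ a, qBar C δ D h (vHat C δ D h.succ) s a = vHat C δ D h.castSucc s := by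
  rw [vHat_castSucc]
  exact exists_eq_ciSup_of_finite (f := fun a => qBar C δ D h (vHat C δ D h.succ) s a)

section Tail

lemma qBar_tail (C δ : ℝ) (D : Fin n → Trajectory S A H) {h j : Fin H} (hj : h < j) (s₀ : S)
    (a₀ : A) (V : S → ℝ) (s : S) (a : A) :
    qBar C δ (fun τ => (D τ).tail h s₀ a₀) j V s a = qBar C δ D j V s a := by
  have h1 : h.castSucc < j.castSucc := Fin.castSucc_lt_castSucc_iff.2 hj
  have h2 : h.castSucc < j.succ := h1.trans Fin.castSucc_lt_succ
  have e1 : transHat (fun τ => (D τ).tail h s₀ a₀) j s a = transHat D j s a := by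
    funext s'
    rw [transHat, transHat, count_tail D hj]
    congr 3
    refine congrArg Finset.card (Finset.filter_congr fun τ _ => ?_)
    rw [Trajectory.tail_state h1, Trajectory.tail_state h2, Trajectory.tail_action hj]
  have e2 : rewHat (fun τ => (D τ).tail h s₀ a₀) j s a = rewHat D j s a := by
    rw [rewHat, rewHat, count_tail D hj]
    congr 2
    refine Finset.sum_congr rfl fun τ _ => ?_
    rw [Trajectory.tail_rew hj]
    refine if_congr ?_ rfl rfl
    rw [Trajectory.tail_state h1, Trajectory.tail_action hj]
  rw [qBar, qBar, penalty, penalty, count_tail D hj, e1, e2]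

/-- `vHat` at the steps after `h` only depends on the data collected after step `h`. -/
lemma vHat_tail (C δ : ℝ) (D : Fin n → Trajectory S A H) (h : Fin H) (s₀ : S) (a₀ : A)
    (k : Fin (H + 1)) : h.castSucc < k →
      vHat C δ (fun τ => (D τ).tail h s₀ a₀) k = vHat C δ D k := by
  induction k using Fin.reverseInduction with
  | last => intro _; funext s; rw [vHat_last, vHat_last]
  | cast j ih =>
    intro hj
    funext s
    have hj' : h < j := Fin.castSucc_lt_castSucc_iff.1 hj
    rw [vHat_castSucc, vHat_castSucc, ih (hj.trans Fin.castSucc_lt_succ)]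
    simp_rw [qBar_tail C δ D hj']

end Tail

section Measurability

variable [MeasurableSpace S] [MeasurableSpace A] [DiscreteMeasurableSpace S]
  [DiscreteMeasurableSpace A]

lemma measurable_qBar (C δ : ℝ) (h : Fin H) {V : (Fin n → Trajectory S A H) → S → ℝ}
    (hV : ∀ s, Measurable fun D => V D s) (s : S) (a : A) :
    Measurable fun D : Fin n → Trajectory S A H => qBar C δ D h (V D) s a := by
  have hc : Measurable fun D : Fin n → Trajectory S A H => (count D h s a : ℝ) :=
    (measurable_from_top (f := fun m : ℕ => (m : ℝ))).comp (measurable_count h s a)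
  have ht := measurable_transHat (S := S) (A := A) (n := n) h s a
  have hr := measurable_rewHat (S := S) (A := A) (n := n) h s a
  have hv := measurable_wVar ht (fun s' => hr.add (hV s'))
  have hm := measurable_wMean ht hV
  have hp : Measurable fun D : Fin n → Trajectory S A H => penalty C δ D h (V D) s a := by
    unfold penalty
    refine Measurable.ite (measurable_count h s a (measurableSet_Ici (a := 1))) ?_ measurable_const
    exact (((hv.mul_const _).div hc).sqrt.const_mul 2).add (measurable_const.div hc)
  unfold qBar
  exact (((hr.add hm).sub hp).min measurable_const).max measurable_const

lemma measurable_vHat (C δ : ℝ) (k : Fin (H + 1)) :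
    ∀ s, Measurable fun D : Fin n → Trajectory S A H => vHat C δ D k s := by
  induction k using Fin.reverseInduction with
  | last => intro s; simp_rw [vHat_last]; exact measurable_const
  | cast h ih =>
    intro s
    simp_rw [vHat_castSucc]
    exact Measurable.iSup fun a => measurable_qBar C δ h ih s a

end Measurability

end OfflineRL

end

/-! ### Deviation bounds for the empirical quantities. -/

noncomputable section

namespace OfflineRL

universe u v

variable {S : Type u} {A : Type v} {H n : ℕ}

/-- Bernstein inequality for the i.i.d. episodes. -/
lemma MDP.dataLaw_bernstein [Fintype S] [Fintype A] [MeasurableSpace S] [MeasurableSpace A]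
    (M : MDP S A H) (μ : Policy S A H) {f : Trajectory S A H → ℝ} (hf : Measurable f)
    (hb : ∀ᵐ ω ∂(M.law μ), |f ω| ≤ 1) (h0 : ∫ ω, f ω ∂(M.law μ) = 0) {v L : ℝ}
    (hv : ∫ ω, f ω ^ 2 ∂(M.law μ) ≤ v) (hL : 0 ≤ L) :
    M.dataLaw μ n {D | 2 * Real.sqrt (n * v * L) + 2 * L < |∑ τ, f (D τ)|} ≤
      2 * ENNReal.ofReal (Real.exp (-L)) := by
  refine bernstein (f := fun _ => f) (fun _ => hf) (fun _ => hb) (fun _ => h0) ?_ hL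
  simp only [Finset.sum_const, Finset.card_univ, Fintype.card_fin, nsmul_eq_mul]
  exact mul_le_mul_of_nonneg_left hv (Nat.cast_nonneg n)

variable [DecidableEq S] [DecidableEq A]

/-- Indicator of a visit of `(s, a)` at step `h`. -/
def visit (h : Fin H) (s : S) (a : A) (ω : Trajectory S A H) : ℝ :=
  if ω.state h.castSucc = s ∧ ω.action h = a then 1 else 0

lemma visit_nonneg (h : Fin H) (s : S) (a : A) (ω : Trajectory S A H) : 0 ≤ visit h s a ω := by
  unfold visit; split_ifs <;> norm_num

lemma visit_le_one (h : Fin H) (s : S) (a : A) (ω : Trajectory S A H) : visit h s a ω ≤ 1 := by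
  unfold visit; split_ifs <;> norm_num

lemma visit_sq (h : Fin H) (s : S) (a : A) (ω : Trajectory S A H) :
    visit h s a ω ^ 2 = visit h s a ω := by
  unfold visit; split_ifs <;> norm_num

lemma abs_visit_mul_le {h : Fin H} {s : S} {a : A} {ω : Trajectory S A H} {x : ℝ}
    (hx : |x| ≤ 1) : |visit h s a ω * x| ≤ 1 := by
  rw [abs_mul, abs_of_nonneg (visit_nonneg h s a ω)]
  exact mul_le_one₀ (visit_le_one h s a ω) (abs_nonneg _) hx

lemma measurable_visit [MeasurableSpace S] [MeasurableSpace A] [DiscreteMeasurableSpace S]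
    [DiscreteMeasurableSpace A] (h : Fin H) (s : S) (a : A) :
    Measurable (visit (S := S) (A := A) h s a) :=
  Measurable.ite (Trajectory.measurableSet_visit h s a) measurable_const measurable_const

lemma sum_visit (D : Fin n → Trajectory S A H) (h : Fin H) (s : S) (a : A) :
    ∑ τ, visit h s a (D τ) = count D h s a := by
  simp [visit, count]

lemma sum_visit_mul_rew {D : Fin n → Trajectory S A H} {h : Fin H} {s : S} {a : A}
    (hc : count D h s a ≠ 0) :
    ∑ τ, visit h s a (D τ) * (D τ).rew h = count D h s a * rewHat D h s a := by
  rw [rewHat, if_neg hc, mul_div_cancel₀ _ (by exact_mod_cast hc)]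
  exact Finset.sum_congr rfl fun τ _ => by unfold visit; split_ifs <;> simp

lemma sum_visit_mul_state [Fintype S] {D : Fin n → Trajectory S A H} {h : Fin H} {s : S} {a : A}
    (hc : count D h s a ≠ 0) (f : S → ℝ) :
    ∑ τ, visit h s a (D τ) * f ((D τ).state h.succ) =
      count D h s a * wMean (transHat D h s a) f := by
  have hc' : (count D h s a : ℝ) ≠ 0 := by exact_mod_cast hc
  have h1 : ∀ s', (count D h s a : ℝ) * transHat D h s a s' =
      ∑ τ, visit h s a (D τ) * if (D τ).state h.succ = s' then 1 else 0 := by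
    intro s'
    rw [transHat, if_neg hc, mul_div_cancel₀ _ hc', Finset.card_filter]
    push_cast
    refine Finset.sum_congr rfl fun τ _ => ?_
    unfold visit
    split_ifs <;> simp_all
  rw [wMean, Finset.mul_sum]
  simp_rw [← mul_assoc, h1, Finset.sum_mul]
  rw [Finset.sum_comm]
  refine Finset.sum_congr rfl fun τ _ => ?_
  simp

lemma transHat_mem [Fintype S] {D : Fin n → Trajectory S A H} {h : Fin H} {s : S} {a : A}
    (hc : count D h s a ≠ 0) : transHat D h s a ∈ stdSimplex ℝ S := by
  have hc' : (count D h s a : ℝ) ≠ 0 := by exact_mod_cast hc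
  constructor
  · intro s'
    rw [transHat, if_neg hc]
    positivity
  · have := sum_visit_mul_state hc (D := D) fun _ => 1
    simp only [mul_one, sum_visit, wMean] at this
    exact mul_left_cancel₀ hc' (by rw [← this, mul_one])

/-- Next states of positive empirical probability have been observed. -/
lemma exists_of_transHat_pos {D : Fin n → Trajectory S A H} [Fintype S] {h : Fin H} {s : S} {a : A}
    (hc : count D h s a ≠ 0) {s' : S} (hs' : 0 < transHat D h s a s') :
    ∃ τ, (D τ).state h.succ = s' := by
  by_contra hne
  push Not at hne
  rw [transHat, if_neg hc, Finset.filter_false_of_mem (by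
    rintro τ - ⟨-, -, h3⟩; exact hne τ h3)] at hs'
  simp at hs'

namespace MDP

variable [Fintype S] [Fintype A] [MeasurableSpace S] [MeasurableSpace A]
  [DiscreteMeasurableSpace S] [DiscreteMeasurableSpace A] (M : MDP S A H) (μ : Policy S A H)

lemma integral_visit_mul_rew (h : Fin H) (s : S) (a : A) {g : ℝ → ℝ} (hg : Measurable g)
    (hi : Integrable g (M.reward h s a : Measure ℝ)) :
    ∫ ω, visit h s a ω * g (ω.rew h) ∂(M.law μ) =
      M.stateProb μ h.castSucc s * μ.prob h s a * ∫ x, g x ∂(M.reward h s a : Measure ℝ) := by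
  have hm : Measurable fun ω : Trajectory S A H => visit h s a ω * g (ω.rew h) :=
    (measurable_visit h s a).mul (hg.comp (Trajectory.measurable_rew h))
  rw [M.integral_law μ hm]
  · have h1 := M.pathExp_visit μ h s a fun _ => ∫ x, g x ∂(M.reward h s a : Measure ℝ)
    rw [← Finset.sum_mul, (M.trans_mem h s a).2, one_mul] at h1
    rw [← h1]
    congr 1
    funext p
    simp only [visit, Trajectory.state, Trajectory.action, Trajectory.rew]
    by_cases hp : p.1 h.castSucc = s ∧ p.2 h = a
    · simp only [hp, and_self, if_true, one_mul]
      rw [M.integral_eval_rewLaw p h hg, hp.1, hp.2]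
    · simp [hp]
  · intro p _
    simp only [visit, Trajectory.state, Trajectory.action, Trajectory.rew]
    by_cases hp : p.1 h.castSucc = s ∧ p.2 h = a
    · simp only [hp, and_self, if_true, one_mul]
      have hmp := measurePreserving_eval
        (fun h : Fin H => (M.reward h (p.1 h.castSucc) (p.2 h) : Measure ℝ)) h
      refine hmp.integrable_comp_of_integrable ?_
      rw [hp.1, hp.2]
      exact hi
    · simp [hp]

lemma integral_visit_mul_state (h : Fin H) (s : S) (a : A) (f : S → ℝ) :
    ∫ ω, visit h s a ω * f (ω.state h.succ) ∂(M.law μ) =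
      M.stateProb μ h.castSucc s * μ.prob h s a * wMean (M.trans h s a) f := by
  have hm : Measurable fun ω : Trajectory S A H => visit h s a ω * f (ω.state h.succ) :=
    (measurable_visit h s a).mul
      ((Measurable.of_discrete (f := f)).comp (Trajectory.measurable_state h.succ))
  rw [M.integral_law μ hm]
  · rw [wMean, ← pathExp_visit]
    congr 1
    funext p
    simp only [visit, Trajectory.state, Trajectory.action]
    by_cases hp : p.1 h.castSucc = s ∧ p.2 h = a <;> simp [hp]
  · intro p _
    simp only [visit, Trajectory.state, Trajectory.action]
    by_cases hp : p.1 h.castSucc = s ∧ p.2 h = a <;> simp [hp]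

lemma integral_visit (h : Fin H) (s : S) (a : A) :
    ∫ ω, visit h s a ω ∂(M.law μ) = M.stateProb μ h.castSucc s * μ.prob h s a := by
  have := M.integral_visit_mul_state μ h s a fun _ => 1
  simpa [wMean_const (M.trans_mem h s a)] using this

lemma dataLaw_count (h : Fin H) (s : S) (a : A) {L : ℝ} (hL : 0 ≤ L) :
    M.dataLaw μ n {D | 2 * Real.sqrt (n * (M.stateProb μ h.castSucc s * μ.prob h s a) * L) + 2 * L <
      |(count D h s a : ℝ) - n * (M.stateProb μ h.castSucc s * μ.prob h s a)|} ≤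
      2 * ENNReal.ofReal (Real.exp (-L)) := by
  set q := M.stateProb μ h.castSucc s * μ.prob h s a with hq
  have hi : Integrable (visit h s a) (M.law μ) :=
    integrable_of_ae_abs_le (c := 1) (measurable_visit h s a) (Filter.Eventually.of_forall fun ω => by
      rw [abs_of_nonneg (visit_nonneg h s a ω)]; exact visit_le_one h s a ω)
  have hint : ∫ ω, visit h s a ω ∂(M.law μ) = q := M.integral_visit μ h s a
  have hq0 : 0 ≤ q := hint ▸ integral_nonneg fun ω => visit_nonneg h s a ω
  have hq1 : q ≤ 1 := by
    rw [← hint]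
    calc _ ≤ ∫ _, (1 : ℝ) ∂(M.law μ) :=
          integral_mono hi (integrable_const _) fun ω => visit_le_one h s a ω
      _ = 1 := by simp
  have key := M.dataLaw_bernstein μ (n := n) (f := fun ω => visit h s a ω - q) (v := q)
    ((measurable_visit h s a).sub_const q)
    (Filter.Eventually.of_forall fun ω => by
      rw [abs_le]
      constructor <;> linarith [visit_nonneg h s a ω, visit_le_one h s a ω])
    (by rw [integral_sub hi (integrable_const _), hint]; simp) (by
      have : ∀ ω : Trajectory S A H, (visit h s a ω - q) ^ 2 =
          (1 - 2 * q) * visit h s a ω + q ^ 2 := fun ω => by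
        have := visit_sq h s a ω
        linear_combination this
      simp_rw [this]
      rw [integral_add (hi.const_mul _) (integrable_const _), integral_const_mul, hint]
      simp only [integral_const, probReal_univ, smul_eq_mul, one_mul]
      nlinarith) hL
  convert key using 6 with D
  rw [Finset.sum_sub_distrib, sum_visit]
  simp

lemma dataLaw_state (h : Fin H) (s : S) (a : A) {f : S → ℝ} (hf : ∀ x, |f x| ≤ 1)
    (h0 : wMean (M.trans h s a) f = 0) {v L : ℝ}
    (hv : wMean (M.trans h s a) (fun x => f x ^ 2) ≤ v) (hL : 0 ≤ L) :
    M.dataLaw μ n {D | 2 * Real.sqrt (n * (M.stateProb μ h.castSucc s * μ.prob h s a * v) * L) +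
      2 * L < |∑ τ, visit h s a (D τ) * f ((D τ).state h.succ)|} ≤
      2 * ENNReal.ofReal (Real.exp (-L)) := by
  refine M.dataLaw_bernstein μ (f := fun ω => visit h s a ω * f (ω.state h.succ))
    ((measurable_visit h s a).mul
      ((Measurable.of_discrete (f := f)).comp (Trajectory.measurable_state h.succ)))
    (Filter.Eventually.of_forall fun ω => abs_visit_mul_le (hf _)) ?_ ?_ hL
  · rw [integral_visit_mul_state, h0, mul_zero]
  · simp_rw [mul_pow, visit_sq]
    rw [M.integral_visit_mul_state μ h s a fun x => f x ^ 2]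
    exact mul_le_mul_of_nonneg_left hv
      (mul_nonneg (M.stateProb_nonneg μ _ _) ((μ.prob_mem h s).1 a))

/-- A variable with values in `[0, 1]` has variance at most its mean. Having the mean reward under
the root is what later lets the bounded total reward control the sum of these errors. -/
lemma dataLaw_rew {M : MDP S A H} (hM : M.BoundedTotalReward) {h : Fin H} {s : S} {a : A}
    (hq : 0 < M.stateProb μ h.castSucc s * μ.prob h s a) {L : ℝ} (hL : 0 ≤ L) :
    M.dataLaw μ n {D | 2 * Real.sqrt
      (n * (M.stateProb μ h.castSucc s * μ.prob h s a * M.meanRew h s a) * L) + 2 * L <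
      |∑ τ, visit h s a (D τ) * ((D τ).rew h - M.meanRew h s a)|} ≤
      2 * ENNReal.ofReal (Real.exp (-L)) := by
  set r := M.meanRew h s a with hr
  have hae := hM.ae_reward_mem hq
  obtain ⟨hr0, hr1⟩ := hM.meanRew_mem hq
  rw [← hr] at hr0 hr1
  have hi : Integrable (fun x : ℝ => x) (M.reward h s a : Measure ℝ) := by
    refine integrable_of_ae_abs_le (c := 1) measurable_id ?_
    filter_upwards [hae] with x hx
    rw [abs_of_nonneg hx.1]
    exact hx.2
  have hi2 : Integrable (fun x : ℝ => (x - r) ^ 2) (M.reward h s a : Measure ℝ) := by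
    refine integrable_of_ae_abs_le (c := 1) (by fun_prop) ?_
    filter_upwards [hae] with x hx
    rw [abs_of_nonneg (sq_nonneg _)]
    nlinarith
  refine M.dataLaw_bernstein μ (f := fun ω => visit h s a ω * (ω.rew h - r))
    ((measurable_visit h s a).mul ((Trajectory.measurable_rew h).sub_const r)) ?_ ?_ ?_ hL
  · refine M.ae_law μ ?_ fun p hp => ?_
    · exact measurableSet_le ((measurable_visit h s a).mul
        ((Trajectory.measurable_rew h).sub_const r)).abs measurable_const
    · filter_upwards [M.ae_rewLaw μ (hM μ) hp] with x hx
      refine abs_visit_mul_le ?_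
      have h1 := hx.1 h
      have h2 := (Finset.single_le_sum (f := fun k => Trajectory.rew (p.1, p.2, x) k)
        (fun k _ => hx.1 k) (Finset.mem_univ h)).trans hx.2
      rw [abs_le]
      constructor <;> linarith
  · rw [M.integral_visit_mul_rew μ h s a (g := fun x => x - r) (by fun_prop)
      (hi.sub (integrable_const r)), integral_sub hi (integrable_const r)]
    simp [hr, meanRew]
  · simp_rw [mul_pow, visit_sq]
    rw [M.integral_visit_mul_rew μ h s a (g := fun x => (x - r) ^ 2) (by fun_prop) hi2]
    refine mul_le_mul_of_nonneg_left ?_ hq.le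
    calc ∫ x, (x - r) ^ 2 ∂(M.reward h s a : Measure ℝ)
        ≤ ∫ x, ((1 - 2 * r) * x + r ^ 2) ∂(M.reward h s a : Measure ℝ) := by
          refine integral_mono_ae hi2 ((hi.const_mul _).add (integrable_const _)) ?_
          filter_upwards [hae] with x hx
          nlinarith
      _ = (1 - 2 * r) * r + r ^ 2 := by
          rw [integral_add (hi.const_mul _) (integrable_const _), integral_const_mul]
          simp [hr, meanRew]
      _ ≤ r := by nlinarith

/-- Bernstein inequality for the visits of `(s, a)` at step `h`, conditionally on the data after
step `h`: the weights `w` may depend on the latter. -/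
lemma dataLaw_weighted (h : Fin H) (s : S) (a : A) {w : (Fin n → Trajectory S A H) → S → ℝ}
    (hw : ∀ x, Measurable fun D => w D x) (hw1 : ∀ D x, |w D x| ≤ 1)
    (hwt : ∀ D, w (fun τ => (D τ).tail h s a) = w D) {L : ℝ} (hL : 0 ≤ L) :
    M.dataLaw μ n {D | 2 * Real.sqrt ((∑ τ, M.backProb μ h s a ((D τ).state h.succ)) * L) + 2 * L <
      |∑ τ, w D ((D τ).state h.succ) *
        (visit h s a (D τ) - M.backProb μ h s a ((D τ).state h.succ))|} ≤
      2 * ENNReal.ofReal (Real.exp (-L)) := by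
  classical
  set b : Trajectory S A H → ℝ := fun ω => M.backProb μ h s a (ω.state h.succ) with hb
  have hbm : Measurable b :=
    (Measurable.of_discrete (f := M.backProb μ h s a)).comp (Trajectory.measurable_state h.succ)
  have hb0 : ∀ ω, 0 ≤ b ω := fun ω => M.backProb_nonneg μ h s a _
  have hb1 : ∀ ω, b ω ≤ 1 := fun ω => M.backProb_le_one μ h s a _
  -- The bad event, written through the visit indicators and the tails alone, which is the form that
  -- resampling needs.
  set E : Set (Fin n → Bool × Trajectory S A H) :=
    {x | 2 * Real.sqrt ((∑ τ, b (x τ).2) * L) + 2 * L <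
      |∑ τ, w (fun τ => (x τ).2) ((x τ).2.state h.succ) *
        ((if (x τ).1 = true then 1 else 0) - b (x τ).2)|} with hE
  have hsnd : ∀ τ, Measurable fun x : Fin n → Bool × Trajectory S A H => (x τ).2 := fun τ =>
    measurable_snd.comp (measurable_pi_apply τ)
  have hfst : ∀ τ, Measurable fun x : Fin n → Bool × Trajectory S A H => (x τ).1 := fun τ =>
    measurable_fst.comp (measurable_pi_apply τ)
  have hEm : MeasurableSet E := by
    have hall : Measurable fun (x : Fin n → Bool × Trajectory S A H) τ => (x τ).2 :=
      measurable_pi_lambda _ hsnd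
    refine measurableSet_lt ?_ ?_
    · exact (((Finset.measurable_sum _ fun τ _ => hbm.comp (hsnd τ)).mul_const L).sqrt.const_mul
        2).add_const _
    · refine (Finset.measurable_sum _ fun τ _ => ?_).abs
      refine Measurable.mul ?_ (Measurable.sub ?_ (hbm.comp (hsnd τ)))
      · have hrw : (fun x : Fin n → Bool × Trajectory S A H =>
            w (fun τ => (x τ).2) ((x τ).2.state h.succ)) = fun x => ∑ y,
              (if (x τ).2.state h.succ = y then 1 else 0) * w (fun τ => (x τ).2) y := by
          funext x
          simp
        rw [hrw]
        refine Finset.measurable_sum _ fun y _ => Measurable.mul ?_ ((hw y).comp hall)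
        refine Measurable.ite ?_ measurable_const measurable_const
        exact ((Trajectory.measurable_state h.succ).comp (hsnd τ)) (measurableSet_singleton y)
      · exact (Measurable.of_discrete (f := fun c : Bool => if c = true then (1 : ℝ) else 0)).comp
          (hfst τ)
  have key := measure_pi_le_of_resample (n := n) (ν := M.law μ)
    (X := {ω | ω.state h.castSucc = s ∧ ω.action h = a}) (Trajectory.measurableSet_visit h s a)
    (t := Trajectory.tail h s a) (Trajectory.measurable_tail h s a) (b := b) hbm hb1
    (fun F hF => M.law_visit_inter_tail μ h s a hF) hEm
    (q := 2 * ENNReal.ofReal (Real.exp (-L))) (by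
      -- With the tails `y` fixed, weights and probabilities are constants, and each summand is a
      -- centred Bernoulli variable of variance at most `b (y τ)`, scaled by a factor of size at
      -- most one.
      intro y
      have : IsProbabilityMeasure (volume.restrict (Set.Icc (0 : ℝ) 1)) := ⟨by simp⟩
      have hvol : ∀ c : ℝ, 0 ≤ c → c ≤ 1 →
          ∫ u in Set.Icc (0 : ℝ) 1, (if u ≤ c then (1 : ℝ) else 0) = c := by
        intro c hc0 hc1
        have h1 : (fun u : ℝ => if u ≤ c then (1 : ℝ) else 0) = (Set.Iic c).indicator 1 := by
          funext u
          simp [Set.indicator_apply]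
        rw [h1, integral_indicator_one measurableSet_Iic, measureReal_restrict_apply measurableSet_Iic]
        have h2 : Set.Iic c ∩ Set.Icc (0 : ℝ) 1 = Set.Icc 0 c := by
          ext u
          simp only [Set.mem_inter_iff, Set.mem_Iic, Set.mem_Icc]
          constructor
          · rintro ⟨h1, h2, h3⟩; exact ⟨h2, h1⟩
          · rintro ⟨h1, h2⟩; exact ⟨h2, h1, h2.trans hc1⟩
        rw [h2, Real.volume_real_Icc_of_le hc0, sub_zero]
      have hite : ∀ c : ℝ, Measurable fun u : ℝ => if u ≤ c then (1 : ℝ) else 0 := fun c =>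
        Measurable.ite measurableSet_Iic measurable_const measurable_const
      have hiti : ∀ c : ℝ, Integrable (fun u : ℝ => if u ≤ c then (1 : ℝ) else 0)
          (volume.restrict (Set.Icc (0 : ℝ) 1)) := fun c =>
        integrable_of_ae_abs_le (c := 1) (hite c) (Filter.Eventually.of_forall fun u => by
          split_ifs <;> norm_num)
      have hB := bernstein (n := n) (ν := volume.restrict (Set.Icc (0 : ℝ) 1))
        (f := fun τ u => w y ((y τ).state h.succ) * ((if u ≤ b (y τ) then 1 else 0) - b (y τ)))
        (V := ∑ τ, b (y τ)) (L := L)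
        (fun τ => ((hite _).sub_const _).const_mul _)
        (fun τ => Filter.Eventually.of_forall fun u => by
          rw [abs_mul]
          refine mul_le_one₀ (hw1 _ _) (abs_nonneg _) ?_
          rw [abs_le]
          have := hb0 (y τ)
          have := hb1 (y τ)
          split_ifs <;> constructor <;> linarith)
        (fun τ => by
          rw [integral_const_mul, integral_sub (hiti _) (integrable_const _),
            hvol _ (hb0 _) (hb1 _)]
          simp)
        (Finset.sum_le_sum fun τ _ => by
          have hsq : ∀ u : ℝ, (w y ((y τ).state h.succ) *
              ((if u ≤ b (y τ) then 1 else 0) - b (y τ))) ^ 2 = w y ((y τ).state h.succ) ^ 2 *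
              ((1 - 2 * b (y τ)) * (if u ≤ b (y τ) then 1 else 0) + b (y τ) ^ 2) := by
            intro u
            split_ifs <;> ring
          simp_rw [hsq]
          rw [integral_const_mul, integral_add ((hiti _).const_mul _) (integrable_const _),
            integral_const_mul, hvol _ (hb0 _) (hb1 _)]
          simp only [integral_const, probReal_univ, smul_eq_mul, one_mul]
          have h1 : w y ((y τ).state h.succ) ^ 2 ≤ 1 := by
            rw [← sq_abs]
            exact pow_le_one₀ (abs_nonneg _) (hw1 _ _)
          have h2 := hb0 (y τ)
          have h3 := hb1 (y τ)
          have h4 := sq_nonneg (w y ((y τ).state h.succ))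
          nlinarith [mul_nonneg h2 (sub_nonneg.2 h3)]) hL
      refine (measure_mono ?_).trans hB
      intro u hu
      simpa [hE] using hu)
  refine (measure_mono ?_).trans key
  intro D hD
  simp only [hE, Set.mem_ofPred_eq] at hD ⊢
  simp only [hwt, hb, Trajectory.tail_state_succ] at hD ⊢
  simpa [visit] using hD

end MDP

end OfflineRL

end

/-! ### The good event and the kernel error on the value estimates. -/

noncomputable section

namespace OfflineRL

universe u v

variable {S : Type u} {A : Type v} {H n : ℕ}

lemma sum_state_eq_sum_count [Fintype A] [DecidableEq S] [DecidableEq A]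
    (D : Fin n → Trajectory S A H) (h : Fin H) (s : S) :
    (∑ τ, if (D τ).state h.castSucc = s then (1 : ℝ) else 0) = ∑ a, (count D h s a : ℝ) := by
  simp_rw [← sum_visit]
  rw [Finset.sum_comm]
  refine Finset.sum_congr rfl fun τ _ => ?_
  simp only [visit]
  by_cases hs : (D τ).state h.castSucc = s <;> simp [hs]

lemma sum_comp_state [Fintype S] [DecidableEq S] (D : Fin n → Trajectory S A H) (k : Fin (H + 1)) (g : S → ℝ) :
    ∑ τ, g ((D τ).state k) = ∑ s, (∑ τ, if (D τ).state k = s then (1 : ℝ) else 0) * g s := by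
  simp_rw [Finset.sum_mul]
  rw [Finset.sum_comm]
  refine Finset.sum_congr rfl fun τ _ => ?_
  simp

/-- Standard deviation of the optimal value at the next state. -/
def optSd [Fintype S] [Fintype A] [DecidableEq S] (M : MDP S A H) (μ : Policy S A H)
    (h : Fin H) (s : S) (a : A) : ℝ :=
  Real.sqrt (wVar (M.trans h s a) (M.optV μ h.succ))

lemma optSd_sq [Fintype S] [Fintype A] [DecidableEq S] (M : MDP S A H) (μ : Policy S A H)
    (h : Fin H) (s : S) (a : A) :
    optSd M μ h s a ^ 2 = wVar (M.trans h s a) (M.optV μ h.succ) :=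
  Real.sq_sqrt (wVar_nonneg (M.trans_mem h s a).1 _)

lemma optSd_nonneg [Fintype S] [Fintype A] [DecidableEq S] (M : MDP S A H) (μ : Policy S A H)
    (h : Fin H) (s : S) (a : A) :
    0 ≤ optSd M μ h s a := Real.sqrt_nonneg _

variable [Fintype S] [Fintype A] [DecidableEq S] [DecidableEq A]

open Classical in
/-- Estimation error of the value function at the states reached by `μ`. -/
def valueErr (M : MDP S A H) (μ : Policy S A H) (C δ : ℝ) (D : Fin n → Trajectory S A H)
    (k : Fin (H + 1)) (s : S) : ℝ :=
  if 0 < M.stateProb μ k s then vHat C δ D k s - M.optV μ k s else 0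

/-- The concentration inequalities satisfied by the data with high probability. -/
structure GoodData (M : MDP S A H) (μ : Policy S A H) (C δ L : ℝ) (D : Fin n → Trajectory S A H) :
    Prop where
  reached : ∀ τ k, 0 < M.stateProb μ k ((D τ).state k)
  visits : ∀ (h : Fin H) s a, 0 < M.stateProb μ h.castSucc s →
    |(count D h s a : ℝ) - n * (M.stateProb μ h.castSucc s * μ.prob h s a)| ≤
      2 * Real.sqrt (n * (M.stateProb μ h.castSucc s * μ.prob h s a) * L) + 2 * L
  rew : ∀ (h : Fin H) s a, 0 < M.stateProb μ h.castSucc s →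
    |∑ τ, visit h s a (D τ) * ((D τ).rew h - M.meanRew h s a)| ≤ 2 * Real.sqrt
      (n * (M.stateProb μ h.castSucc s * μ.prob h s a * M.meanRew h s a) * L) + 2 * L
  value : ∀ (h : Fin H) s a, 0 < M.stateProb μ h.castSucc s →
    |∑ τ, visit h s a (D τ) * (M.optV μ h.succ ((D τ).state h.succ) -
      wMean (M.trans h s a) (M.optV μ h.succ))| ≤ 2 * Real.sqrt
      (n * (M.stateProb μ h.castSucc s * μ.prob h s a * optSd M μ h s a ^ 2) * L) + 2 * L
  sqDev : ∀ (h : Fin H) s a, 0 < M.stateProb μ h.castSucc s →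
    |∑ τ, visit h s a (D τ) * ((M.optV μ h.succ ((D τ).state h.succ) -
      wMean (M.trans h s a) (M.optV μ h.succ)) ^ 2 - optSd M μ h s a ^ 2)| ≤ 2 * Real.sqrt
      (n * (M.stateProb μ h.castSucc s * μ.prob h s a * optSd M μ h s a ^ 2) * L) + 2 * L
  weighted : ∀ (h : Fin H) s a, 0 < M.stateProb μ h.castSucc s →
    |∑ τ, valueErr M μ C δ D h.succ ((D τ).state h.succ) / ‖valueErr M μ C δ D h.succ‖ *
      (visit h s a (D τ) - M.backProb μ h s a ((D τ).state h.succ))| ≤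
      2 * Real.sqrt ((∑ τ, M.backProb μ h s a ((D τ).state h.succ)) * L) + 2 * L

/-- Here `m` is the expected number of visits. The condition `L ≤ e² m` turns a deviation of a sum
into a deviation per visit, uniformly over state-action pairs. -/
lemma bernstein_rate_le {m v L e : ℝ} (hm : 0 ≤ m) (hv : 0 ≤ v) (he : 0 ≤ e)
    (hL : L ≤ e ^ 2 * m) : 2 * Real.sqrt (m * v * L) + 2 * L ≤ m * (2 * Real.sqrt v * e + 2 * e ^ 2) := by
  have h1 : Real.sqrt (m * v * L) ≤ m * (Real.sqrt v * e) := by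
    apply Real.sqrt_le_iff.2
    refine ⟨by positivity, ?_⟩
    rw [mul_pow, mul_pow, Real.sq_sqrt hv]
    calc m * v * L ≤ m * v * (e ^ 2 * m) := by gcongr
      _ = _ := by ring
  nlinarith

lemma abs_le_of_mul_le {N m x y : ℝ} (hN : 0 < N) (hm : m ≤ 2 * N) (hy : 0 ≤ y)
    (h : |N * x| ≤ m * y) : |x| ≤ 2 * y := by
  rw [abs_mul, abs_of_pos hN] at h
  have h1 : N * |x| ≤ N * (2 * y) := h.trans (by nlinarith)
  exact le_of_mul_le_mul_left h1 hN

section LocalEstimates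

variable {M : MDP S A H} {μ : Policy S A H} {C δ L e : ℝ} {D : Fin n → Trajectory S A H}

/-- Relative accuracy of the visit counts. -/
lemma GoodData.abs_count_sub_le (hD : GoodData M μ C δ L D) (he0 : 0 ≤ e) (he : e ≤ 1 / 8)
    {h : Fin H} {s : S} {a : A} (hs : 0 < M.stateProb μ h.castSucc s)
    (hL : L ≤ e ^ 2 * (n * (M.stateProb μ h.castSucc s * μ.prob h s a))) :
    |(count D h s a : ℝ) - n * (M.stateProb μ h.castSucc s * μ.prob h s a)| ≤
      3 * e * (n * (M.stateProb μ h.castSucc s * μ.prob h s a)) := by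
  have hq : 0 ≤ n * (M.stateProb μ h.castSucc s * μ.prob h s a) :=
    mul_nonneg (Nat.cast_nonneg n) (mul_nonneg hs.le ((μ.prob_mem h s).1 a))
  have h1 := hD.visits h s a hs
  have h2 := bernstein_rate_le (v := 1) hq zero_le_one he0 hL
  rw [mul_one, Real.sqrt_one] at h2
  refine (h1.trans h2).trans ?_
  have h3 : 2 * 1 * e + 2 * e ^ 2 ≤ 3 * e := by nlinarith
  exact (mul_le_mul_of_nonneg_left h3 hq).trans_eq (mul_comm _ _)

/-- Relative accuracy of the number of visits of a state. -/
lemma GoodData.abs_sum_state_sub_le (hD : GoodData M μ C δ L D) (he0 : 0 ≤ e) (he : e ≤ 1 / 8)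
    (hL : ∀ (h : Fin H) s a, 0 < M.stateProb μ h.castSucc s →
      L ≤ e ^ 2 * (n * (M.stateProb μ h.castSucc s * μ.prob h s a))) (h : Fin H) (s : S) :
    |(∑ τ, if (D τ).state h.castSucc = s then (1 : ℝ) else 0) - n * M.stateProb μ h.castSucc s| ≤
      3 * e * (n * M.stateProb μ h.castSucc s) := by
  by_cases hs : 0 < M.stateProb μ h.castSucc s
  -- Relative errors add up without loss over actions, so the accuracy of the pair counts passes to
  -- the states without another union bound.
  · have h1 : n * M.stateProb μ h.castSucc s =
        ∑ a, n * (M.stateProb μ h.castSucc s * μ.prob h s a) := by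
      rw [← Finset.mul_sum, ← Finset.mul_sum, (μ.prob_mem h s).2, mul_one]
    rw [sum_state_eq_sum_count, h1, ← Finset.sum_sub_distrib, Finset.mul_sum]
    exact (Finset.abs_sum_le_sum_abs _ _).trans (Finset.sum_le_sum fun a _ =>
      hD.abs_count_sub_le he0 he hs (hL h s a hs))
  · have h0 : M.stateProb μ h.castSucc s = 0 :=
      le_antisymm (not_lt.1 hs) (M.stateProb_nonneg μ _ _)
    have h1 : ∀ τ, (D τ).state h.castSucc ≠ s := by
      rintro τ rfl
      exact hs (hD.reached τ _)
    simp [h0, h1]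

lemma valueErr_last (C δ : ℝ) (D : Fin n → Trajectory S A H) :
    valueErr M μ C δ D (Fin.last H) = 0 := by
  funext s
  simp [valueErr, vHat_last, MDP.optV_last]

/-- Error of the empirical kernel on the value estimates. Although the value estimates and the
empirical kernel depend on the same data, no union bound over states is involved. -/
lemma GoodData.abs_wMean_valueErr_le (hD : GoodData M μ C δ L D) (he0 : 0 ≤ e) (he : e ≤ 1 / 8)
    (hL0 : 0 ≤ L) (hL : ∀ (h : Fin H) s a, 0 < M.stateProb μ h.castSucc s →
      L ≤ e ^ 2 * (n * (M.stateProb μ h.castSucc s * μ.prob h s a)))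
    {h : Fin H} {s : S} {a : A} (hs : 0 < M.stateProb μ h.castSucc s)
    (hm : 0 < n * (M.stateProb μ h.castSucc s * μ.prob h s a)) :
    |wMean (transHat D h s a) (valueErr M μ C δ D h.succ) -
      wMean (M.trans h s a) (valueErr M μ C δ D h.succ)| ≤
      19 * e * ‖valueErr M μ C δ D h.succ‖ := by
  -- At time `H + 1` there are no actions and hence no pair counts, but the value error vanishes
  -- there.
  rcases Fin.eq_castSucc_or_eq_last h.succ with ⟨h', hh'⟩ | hlast
  swap
  · rw [hlast, valueErr_last]
    simp [wMean]
  set f := valueErr M μ C δ D h.succ with hf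
  set w : S → ℝ := fun x => f x / ‖f‖ with hw
  have hw1 : ∀ x, |w x| ≤ 1 := fun x => by
    rw [hw, abs_div, abs_norm]
    exact div_le_one_of_le₀ (norm_le_pi_norm f x) (norm_nonneg _)
  have hfw : ∀ x, f x = ‖f‖ * w x := by
    intro x
    rcases eq_or_ne ‖f‖ 0 with h0 | h0
    · rw [h0, zero_mul, norm_eq_zero.1 h0, Pi.zero_apply]
    · rw [hw, mul_div_cancel₀ _ h0]
  set m := n * (M.stateProb μ h.castSucc s * μ.prob h s a) with hmdef
  have hN := hD.abs_count_sub_le he0 he hs (hL h s a hs)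
  rw [← hmdef] at hN
  set N : ℝ := (count D h s a : ℝ) with hNdef
  have hmN : m ≤ 2 * N := by
    have := (abs_le.1 hN).1
    nlinarith
  have hNpos : 0 < N := by linarith
  have hc : count D h s a ≠ 0 := by
    intro h0
    rw [hNdef, h0] at hNpos
    simp at hNpos
  set B : S → ℝ := M.backProb μ h s a with hB
  set ν : S → ℝ := fun x => ∑ τ, if (D τ).state h.succ = x then (1 : ℝ) else 0 with hν
  have hνx : ∀ x, |ν x - n * M.stateProb μ h.succ x| ≤ 3 * e * (n * M.stateProb μ h.succ x) := by
    intro x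
    have := hD.abs_sum_state_sub_le he0 he hL h' x
    rw [← hh'] at this
    exact this
  have hBx : ∀ x, n * M.stateProb μ h.succ x * B x = m * M.trans h s a x := fun x => by
    rw [mul_assoc, M.stateProb_mul_backProb, hmdef]
    ring
  have hB0 : ∀ x, 0 ≤ B x := M.backProb_nonneg μ h s a
  have hdiff : ∀ x, |(ν x - n * M.stateProb μ h.succ x) * B x| ≤
      3 * e * (m * M.trans h s a x) := by
    intro x
    rw [abs_mul, abs_of_nonneg (hB0 x), ← hBx x]
    calc _ ≤ 3 * e * (n * M.stateProb μ h.succ x) * B x :=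
          mul_le_mul_of_nonneg_right (hνx x) (hB0 x)
      _ = _ := by ring
  have hsumP : ∑ x, 3 * e * (m * M.trans h s a x) = 3 * e * m := by
    rw [← Finset.mul_sum, ← Finset.mul_sum, (M.trans_mem h s a).2, mul_one]
  have hBsum : ∑ τ, B ((D τ).state h.succ) ≤ 2 * m := by
    rw [sum_comp_state]
    calc ∑ x, ν x * B x = ∑ x, (m * M.trans h s a x + (ν x - n * M.stateProb μ h.succ x) * B x) :=
          Finset.sum_congr rfl fun x _ => by rw [← hBx]; ring
      _ ≤ ∑ x, (m * M.trans h s a x + 3 * e * (m * M.trans h s a x)) :=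
          Finset.sum_le_sum fun x _ => by have := le_of_abs_le (hdiff x); linarith
      _ = m + 3 * e * m := by
          rw [Finset.sum_add_distrib, hsumP, ← Finset.mul_sum, (M.trans_mem h s a).2, mul_one]
      _ ≤ 2 * m := by nlinarith
  have hT : |∑ τ, w ((D τ).state h.succ) * (visit h s a (D τ) - B ((D τ).state h.succ))| ≤
      m * (3.25 * e) := by
    refine (hD.weighted h s a hs).trans ?_
    have h1 : 2 * Real.sqrt ((∑ τ, B ((D τ).state h.succ)) * L) ≤ 2 * Real.sqrt (m * 2 * L) := by
      gcongr
      linarith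
    have h2 := bernstein_rate_le (v := 2) hm.le zero_le_two he0 (hL h s a hs)
    have h3 : Real.sqrt 2 ≤ 1.5 := by
      rw [Real.sqrt_le_left (by norm_num)]
      norm_num
    have h4 : 2 * Real.sqrt 2 * e + 2 * e ^ 2 ≤ 3.25 * e := by nlinarith
    exact (add_le_add_left h1 _).trans (h2.trans (mul_le_mul_of_nonneg_left h4 hm.le))
  -- Three fluctuations are separated: the visits given the later data, the state frequencies at
  -- step `h + 1`, and the visit count itself. They are at most `3.25 e m`, `3 e m` and `3 e m`. In
  -- the second, Bayes' rule replaces the weights by `m` times the transition probabilities, which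
  -- sum to `m`, so the number of states does not appear.
  have hid : N * (wMean (transHat D h s a) w - wMean (M.trans h s a) w) =
      (∑ τ, w ((D τ).state h.succ) * (visit h s a (D τ) - B ((D τ).state h.succ))) +
      (∑ x, (ν x - n * M.stateProb μ h.succ x) * B x * w x) -
      (N - m) * wMean (M.trans h s a) w := by
    have h1 := sum_visit_mul_state hc w
    have h2 := sum_comp_state D h.succ fun x => w x * B x
    have h3 : ∑ x, (ν x - n * M.stateProb μ h.succ x) * B x * w x =
        ∑ x, ν x * (w x * B x) - m * wMean (M.trans h s a) w := by
      rw [wMean, Finset.mul_sum, ← Finset.sum_sub_distrib]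
      refine Finset.sum_congr rfl fun x _ => ?_
      have := hBx x
      linear_combination (-(w x)) * this
    rw [h3, ← h2]
    simp only [mul_sub, Finset.sum_sub_distrib]
    have h4 : ∑ τ, w ((D τ).state h.succ) * visit h s a (D τ) =
        N * wMean (transHat D h s a) w := by
      rw [← h1]
      exact Finset.sum_congr rfl fun τ _ => mul_comm _ _
    rw [h4]
    ring
  have hfin : |N * (wMean (transHat D h s a) w - wMean (M.trans h s a) w)| ≤ m * (9.5 * e) := by
    rw [hid]
    have h1 : |∑ x, (ν x - n * M.stateProb μ h.succ x) * B x * w x| ≤ 3 * e * m := by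
      rw [← hsumP]
      refine (Finset.abs_sum_le_sum_abs _ _).trans (Finset.sum_le_sum fun x _ => ?_)
      rw [abs_mul]
      calc _ ≤ |(ν x - n * M.stateProb μ h.succ x) * B x| * 1 :=
            mul_le_mul_of_nonneg_left (hw1 x) (abs_nonneg _)
        _ ≤ _ := by rw [mul_one]; exact hdiff x
    have h2 : |(N - m) * wMean (M.trans h s a) w| ≤ 3 * e * m := by
      rw [abs_mul]
      calc _ ≤ |N - m| * 1 :=
            mul_le_mul_of_nonneg_left (abs_wMean_le (M.trans_mem h s a) hw1) (abs_nonneg _)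
        _ ≤ _ := by rw [mul_one]; exact hN
    have h3 := abs_le.1 hT
    have h4 := abs_le.1 h1
    have h5 := abs_le.1 h2
    have h6 : 0 ≤ e * m := mul_nonneg he0 hm.le
    rw [abs_le]
    constructor <;> linarith [h3.1, h3.2, h4.1, h4.2, h5.1, h5.2]
  have hres := abs_le_of_mul_le hNpos hmN (by positivity) hfin
  have hmul : ∀ p : S → ℝ, wMean p f = ‖f‖ * wMean p w := fun p => by
    rw [← wMean_const_mul]
    congr 1
    funext x
    exact hfw x
  rw [hmul, hmul, ← mul_sub, abs_mul, abs_norm]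
  calc _ ≤ ‖f‖ * (2 * (9.5 * e)) := mul_le_mul_of_nonneg_left hres (norm_nonneg _)
    _ = _ := by ring

end LocalEstimates

end OfflineRL

end

/-! ### One-step errors on the good event. -/

noncomputable section

namespace OfflineRL

universe u v

lemma wVar_add_const {S : Type u} [Fintype S] {p : S → ℝ} (hp : p ∈ stdSimplex ℝ S) (c : ℝ)
    (f : S → ℝ) : wVar p (fun x => c + f x) = wVar p f := by
  unfold wVar
  rw [wMean_add p (fun _ => c) f, wMean_const hp]
  refine Finset.sum_congr rfl fun x _ => ?_
  ring

lemma wVar_le_wMean_sq {S : Type u} [Fintype S] {p : S → ℝ} (hp : p ∈ stdSimplex ℝ S) (f : S → ℝ)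
    (c : ℝ) : wVar p f ≤ wMean p fun x => (f x - c) ^ 2 := by
  have h : wMean p (fun x => (f x - c) ^ 2) =
      wMean p (fun x => f x ^ 2) - 2 * c * wMean p f + c ^ 2 := by
    rw [← wMean_const_mul, ← wMean_sub, ← wMean_const hp (c ^ 2), ← wMean_add]
    congr 1
    funext x
    ring
  rw [wVar_eq hp, h]
  nlinarith [sq_nonneg (wMean p f - c)]

lemma vHat_eq {S : Type u} {A : Type v} [Fintype S] [Fintype A] [DecidableEq S]
    [DecidableEq A] {H n : ℕ} {M : MDP S A H} {μ : Policy S A H} {C δ : ℝ}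
    {D : Fin n → Trajectory S A H} {k : Fin (H + 1)} {x : S} (hx : 0 < M.stateProb μ k x) :
    vHat C δ D k x = M.optV μ k x + valueErr M μ C δ D k x := by
  rw [valueErr, if_pos hx]
  ring

/-- Since `valueErr` is set to zero at unreached states, the splitting needs `p` to charge reached
states only; the true and the empirical kernels both do. -/
lemma wMean_vHat {S : Type u} {A : Type v} [Fintype S] [Fintype A] [DecidableEq S]
    [DecidableEq A] {H n : ℕ} {M : MDP S A H} {μ : Policy S A H} {C δ : ℝ}
    {D : Fin n → Trajectory S A H} {p : S → ℝ} {k : Fin (H + 1)} (hp0 : ∀ x, 0 ≤ p x)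
    (hp : ∀ x, 0 < p x → 0 < M.stateProb μ k x) :
    wMean p (vHat C δ D k) = wMean p (M.optV μ k) + wMean p (valueErr M μ C δ D k) := by
  rw [← wMean_add]
  apply le_antisymm
  · exact wMean_mono hp0 fun x hx => (vHat_eq (hp x hx)).le
  · exact wMean_mono hp0 fun x hx => (vHat_eq (hp x hx)).ge

lemma one_le_horizon {H : ℕ} (h : Fin H) : (1 : ℝ) ≤ H := by
  exact_mod_cast h.pos

lemma one_le_remaining {H : ℕ} (h : Fin H) : (1 : ℝ) ≤ (H : ℝ) - (h : ℕ) := by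
  have : ((h : ℕ) : ℝ) + 1 ≤ H := by exact_mod_cast h.isLt
  linarith

variable {S : Type u} {A : Type v} [Fintype S] [Fintype A] [DecidableEq S] [DecidableEq A]
  [MeasurableSpace S] [MeasurableSpace A] {H n : ℕ}

/-- Data satisfying the concentration inequalities, with relative accuracy `e`. -/
structure AccurateData (M : MDP S A H) (μ : Policy S A H) (C δ L e : ℝ)
    (D : Fin n → Trajectory S A H) : Prop where
  bounded : M.BoundedTotalReward
  prob_pos : ∀ (h : Fin H) s a, 0 < M.stateProb μ h.castSucc s → 0 < μ.prob h s a
  good : GoodData M μ C δ L D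
  n_pos : 0 < n
  e_pos : 0 < e
  e_le : e ≤ 1 / 8
  logTerm_nonneg : 0 ≤ logTerm S A H δ
  logTerm_le : 2 * logTerm S A H δ ≤ L
  le_visits : ∀ (h : Fin H) s a, 0 < M.stateProb μ h.castSucc s →
      L ≤ e ^ 2 * (n * (M.stateProb μ h.castSucc s * μ.prob h s a))

namespace AccurateData

variable {M : MDP S A H} {μ : Policy S A H} {C δ L e : ℝ} {D : Fin n → Trajectory S A H}
  (hD : AccurateData M μ C δ L e D) {h : Fin H} {s : S} {a : A}

include hD

lemma L_nonneg : 0 ≤ L := by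
  have h1 := hD.logTerm_nonneg
  have h2 := hD.logTerm_le
  linarith

lemma mass_pos (hs : 0 < M.stateProb μ h.castSucc s) :
    0 < M.stateProb μ h.castSucc s * μ.prob h s a :=
  mul_pos hs (hD.prob_pos h s a hs)

lemma visits_pos (hs : 0 < M.stateProb μ h.castSucc s) :
    0 < n * (M.stateProb μ h.castSucc s * μ.prob h s a) :=
  mul_pos (Nat.cast_pos.2 hD.n_pos) (hD.mass_pos hs)

lemma visits_le (hs : 0 < M.stateProb μ h.castSucc s) :
    n * (M.stateProb μ h.castSucc s * μ.prob h s a) ≤ 2 * (count D h s a : ℝ) := by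
  have h1 := (abs_le.1 (hD.good.abs_count_sub_le hD.e_pos.le hD.e_le hs
    (hD.le_visits h s a hs))).1
  have h2 := hD.visits_pos (a := a) hs
  have h3 := hD.e_le
  nlinarith

lemma count_pos (hs : 0 < M.stateProb μ h.castSucc s) : 0 < (count D h s a : ℝ) := by
  have h1 := hD.visits_le (a := a) hs
  have h2 := hD.visits_pos (a := a) hs
  linarith

lemma count_ne_zero (hs : 0 < M.stateProb μ h.castSucc s) : count D h s a ≠ 0 := by
  have := hD.count_pos (a := a) hs
  rintro h0
  rw [h0] at this
  simp at this

lemma transHat_mem (hs : 0 < M.stateProb μ h.castSucc s) : transHat D h s a ∈ stdSimplex ℝ S :=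
  OfflineRL.transHat_mem (hD.count_ne_zero hs)

lemma stateProb_pos_of_transHat (hs : 0 < M.stateProb μ h.castSucc s) {x : S}
    (hx : 0 < transHat D h s a x) : 0 < M.stateProb μ h.succ x := by
  obtain ⟨τ, rfl⟩ := exists_of_transHat_pos (hD.count_ne_zero hs) hx
  exact hD.good.reached τ _

lemma stateProb_pos_of_trans (hs : 0 < M.stateProb μ h.castSucc s) {x : S}
    (hx : 0 < M.trans h s a x) : 0 < M.stateProb μ h.succ x :=
  (mul_pos (hD.mass_pos hs) hx).trans_le (M.visit_trans_le μ h s a x)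

lemma meanRew_mem (hs : 0 < M.stateProb μ h.castSucc s) :
    0 ≤ M.meanRew h s a ∧ M.meanRew h s a ≤ 1 :=
  hD.bounded.meanRew_mem (hD.mass_pos hs)

lemma optV_nonneg (k : Fin (H + 1)) (x : S) : 0 ≤ M.optV μ k x :=
  hD.bounded.optV_nonneg hD.prob_pos k x

lemma optV_le_one (k : Fin (H + 1)) (x : S) : M.optV μ k x ≤ 1 :=
  hD.bounded.optV_le_one hD.prob_pos k x

lemma abs_le_of_visits (hs : 0 < M.stateProb μ h.castSucc s) {x v : ℝ} (hv : 0 ≤ v)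
    (hx : |count D h s a * x| ≤
      2 * Real.sqrt (n * (M.stateProb μ h.castSucc s * μ.prob h s a * v) * L) + 2 * L) :
    |x| ≤ 4 * Real.sqrt v * e + 4 * e ^ 2 := by
  have h1 := bernstein_rate_le (hD.visits_pos (a := a) hs).le hv hD.e_pos.le (hD.le_visits h s a hs)
  rw [← mul_assoc (n : ℝ)] at hx
  have h2 := abs_le_of_mul_le (hD.count_pos hs) (hD.visits_le hs)
    (by have := hD.e_pos; positivity) (hx.trans h1)
  linarith

lemma abs_rewHat_sub_le (hs : 0 < M.stateProb μ h.castSucc s) :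
    |rewHat D h s a - M.meanRew h s a| ≤ 4 * Real.sqrt (M.meanRew h s a) * e + 4 * e ^ 2 := by
  refine hD.abs_le_of_visits (a := a) hs (hD.meanRew_mem hs).1 ?_
  have h1 := hD.good.rew h s a hs
  simp only [mul_sub, Finset.sum_sub_distrib, sum_visit_mul_rew (hD.count_ne_zero hs),
    ← Finset.sum_mul, sum_visit] at h1
  rwa [mul_sub]

lemma optSd_le_one : optSd M μ h s a ≤ 1 := by
  rw [optSd, Real.sqrt_le_one]
  refine (wVar_le_wMean_sq (M.trans_mem h s a) _ 0).trans ?_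
  rw [← wMean_const (M.trans_mem h s a) 1]
  refine wMean_mono (M.trans_mem h s a).1 fun x _ => ?_
  rw [sub_zero]
  exact pow_le_one₀ (hD.optV_nonneg _ x) (hD.optV_le_one _ x)

lemma abs_transHat_optV_sub_le (hs : 0 < M.stateProb μ h.castSucc s) :
    |wMean (transHat D h s a) (M.optV μ h.succ) - wMean (M.trans h s a) (M.optV μ h.succ)| ≤
      4 * optSd M μ h s a * e + 4 * e ^ 2 := by
  have h1 := hD.good.value h s a hs
  rw [sum_visit_mul_state (hD.count_ne_zero hs)
    (fun x => M.optV μ h.succ x - wMean (M.trans h s a) (M.optV μ h.succ)),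
    wMean_sub, wMean_const (hD.transHat_mem hs)] at h1
  have h2 := hD.abs_le_of_visits (a := a) hs (sq_nonneg _) h1
  rwa [Real.sqrt_sq (optSd_nonneg _ _ _ _ _)] at h2

/-- The deviation `4σe + 4e²` completes the square with `σ²`, so the empirical standard deviation
exceeds the true one by at most `2e`. -/
lemma transHat_sqDev_le (hs : 0 < M.stateProb μ h.castSucc s) :
    wMean (transHat D h s a)
      (fun x => (M.optV μ h.succ x - wMean (M.trans h s a) (M.optV μ h.succ)) ^ 2) ≤
      (optSd M μ h s a + 2 * e) ^ 2 := by
  have h1 := hD.good.sqDev h s a hs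
  rw [sum_visit_mul_state (hD.count_ne_zero hs)
    (fun x => (M.optV μ h.succ x - wMean (M.trans h s a) (M.optV μ h.succ)) ^ 2 -
      optSd M μ h s a ^ 2), wMean_sub, wMean_const (hD.transHat_mem hs)] at h1
  have h2 := le_of_abs_le (hD.abs_le_of_visits (a := a) hs (sq_nonneg _) h1)
  rw [Real.sqrt_sq (optSd_nonneg _ _ _ _ _)] at h2
  nlinarith

lemma abs_valueErr_sub_le (hs : 0 < M.stateProb μ h.castSucc s) :
    |wMean (transHat D h s a) (valueErr M μ C δ D h.succ) -
      wMean (M.trans h s a) (valueErr M μ C δ D h.succ)| ≤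
      19 * e * ‖valueErr M μ C δ D h.succ‖ :=
  hD.good.abs_wMean_valueErr_le hD.e_pos.le hD.e_le hD.L_nonneg hD.le_visits hs (hD.visits_pos hs)

/-- The chain `2ι ≤ L ≤ e² m ≤ 2e² N`, with `N` the visit count and `m` its mean, gives `ι / N ≤
e²`. The reward estimate is a constant shift and drops out of the variance. -/
lemma penalty_le (hs : 0 < M.stateProb μ h.castSucc s) {c : ℝ} (hc0 : 0 ≤ c)
    (hc : wVar (transHat D h s a) (vHat C δ D h.succ) ≤ c ^ 2) :
    penalty C δ D h (vHat C δ D h.succ) s a ≤ 2 * c * e + 14 * H * e ^ 2 := by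
  have hN := hD.count_pos (a := a) hs
  have hι : logTerm S A H δ / count D h s a ≤ e ^ 2 := by
    rw [div_le_iff₀ hN]
    have h1 := hD.le_visits h s a hs
    have h2 := hD.visits_le (a := a) hs
    have h3 := hD.logTerm_le
    have h4 : e ^ 2 * (n * (M.stateProb μ h.castSucc s * μ.prob h s a)) ≤
        e ^ 2 * (2 * count D h s a) := mul_le_mul_of_nonneg_left h2 (sq_nonneg e)
    linarith
  have hι0 : 0 ≤ logTerm S A H δ / count D h s a := div_nonneg hD.logTerm_nonneg hN.le
  rw [penalty, if_pos (Nat.one_le_iff_ne_zero.2 (hD.count_ne_zero hs)),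
    wVar_add_const (hD.transHat_mem hs), mul_div_assoc, mul_div_assoc]
  have h1 : Real.sqrt (wVar (transHat D h s a) (vHat C δ D h.succ) *
      (logTerm S A H δ / count D h s a)) ≤ c * e := by
    apply Real.sqrt_le_iff.2
    refine ⟨mul_nonneg hc0 hD.e_pos.le, ?_⟩
    rw [mul_pow]
    exact mul_le_mul hc hι hι0 (sq_nonneg c)
  have h2 : 14 * (H : ℝ) * (logTerm S A H δ / count D h s a) ≤ 14 * H * e ^ 2 :=
    mul_le_mul_of_nonneg_left hι (by positivity)
  linarith

lemma penalty_nonneg (hs : 0 < M.stateProb μ h.castSucc s) :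
    0 ≤ penalty C δ D h (vHat C δ D h.succ) s a := by
  have h1 := hD.logTerm_nonneg
  rw [penalty, if_pos (Nat.one_le_iff_ne_zero.2 (hD.count_ne_zero hs))]
  positivity

lemma penalty_le_crude (hs : 0 < M.stateProb μ h.castSucc s) :
    penalty C δ D h (vHat C δ D h.succ) s a ≤ 2 * H * e + 14 * H * e ^ 2 := by
  refine hD.penalty_le hs (Nat.cast_nonneg H) ?_
  refine (wVar_le_wMean_sq (hD.transHat_mem hs) _ 0).trans ?_
  rw [← wMean_const (hD.transHat_mem (a := a) hs) ((H : ℝ) ^ 2)]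
  refine wMean_mono (hD.transHat_mem hs).1 fun x _ => ?_
  rw [sub_zero]
  exact pow_le_pow_left₀ (vHat_nonneg C δ D _ x) (vHat_le C δ D _ x) 2

lemma penalty_le_fine (hs : 0 < M.stateProb μ h.castSucc s) :
    penalty C δ D h (vHat C δ D h.succ) s a ≤
      4 * (optSd M μ h s a + 2 * e + ‖valueErr M μ C δ D h.succ‖) * e + 14 * H * e ^ 2 := by
  set b := ‖valueErr M μ C δ D h.succ‖ with hb
  have hb0 : 0 ≤ b := norm_nonneg _
  have hσ : 0 ≤ optSd M μ h s a := optSd_nonneg _ _ _ _ _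
  -- The variance is at most `2(σ + 2e)² + 2b²`, by splitting `vHat` into `optV` and `valueErr`;
  -- this lies below the square of the chosen `c`.
  have he := hD.e_pos
  have h1 := hD.penalty_le (a := a) hs (c := 2 * (optSd M μ h s a + 2 * e + b)) (by positivity) ?_
  · linarith
  set c := wMean (M.trans h s a) (M.optV μ h.succ) with hc
  refine (wVar_le_wMean_sq (hD.transHat_mem hs) _ c).trans ?_
  calc wMean (transHat D h s a) (fun x => (vHat C δ D h.succ x - c) ^ 2)
      ≤ wMean (transHat D h s a) (fun x => 2 * (M.optV μ h.succ x - c) ^ 2 + 2 * b ^ 2) := by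
        refine wMean_mono (hD.transHat_mem hs).1 fun x hx => ?_
        rw [vHat_eq (hD.stateProb_pos_of_transHat hs hx)]
        have h2 : valueErr M μ C δ D h.succ x ^ 2 ≤ b ^ 2 :=
          sq_le_sq' (abs_le.1 (norm_le_pi_norm (valueErr M μ C δ D h.succ) x)).1
            (abs_le.1 (norm_le_pi_norm (valueErr M μ C δ D h.succ) x)).2
        nlinarith [sq_nonneg (M.optV μ h.succ x - c - valueErr M μ C δ D h.succ x)]
    _ = 2 * wMean (transHat D h s a) (fun x => (M.optV μ h.succ x - c) ^ 2) + 2 * b ^ 2 := by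
        rw [wMean_add, wMean_const_mul, wMean_const (hD.transHat_mem hs)]
    _ ≤ 2 * (optSd M μ h s a + 2 * e) ^ 2 + 2 * b ^ 2 := by
        have := hD.transHat_sqDev_le (a := a) hs
        linarith
    _ ≤ _ := by
        have h3 : 0 ≤ (optSd M μ h s a + 2 * e) * b := by positivity
        nlinarith [sq_nonneg (optSd M μ h s a + 2 * e), sq_nonneg b]

lemma wMean_transHat_vHat (hs : 0 < M.stateProb μ h.castSucc s) :
    wMean (transHat D h s a) (vHat C δ D h.succ) = wMean (transHat D h s a) (M.optV μ h.succ) +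
      wMean (transHat D h s a) (valueErr M μ C δ D h.succ) :=
  wMean_vHat (hD.transHat_mem hs).1 fun _ hx => hD.stateProb_pos_of_transHat hs hx

lemma wMean_trans_vHat (hs : 0 < M.stateProb μ h.castSucc s) :
    wMean (M.trans h s a) (vHat C δ D h.succ) = wMean (M.trans h s a) (M.optV μ h.succ) +
      wMean (M.trans h s a) (valueErr M μ C δ D h.succ) :=
  wMean_vHat (M.trans_mem h s a).1 fun _ hx => hD.stateProb_pos_of_trans hs hx

/-- Crude bound on the one-step error of the pessimistic estimate. -/
lemma abs_estimate_sub_le_crude (hs : 0 < M.stateProb μ h.castSucc s) :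
    |rewHat D h s a + wMean (transHat D h s a) (vHat C δ D h.succ) -
      penalty C δ D h (vHat C δ D h.succ) s a -
      (M.meanRew h s a + wMean (M.trans h s a) (M.optV μ h.succ))| ≤
      13 * H * e + ‖valueErr M μ C δ D h.succ‖ := by
  have he := hD.e_pos
  have he8 := hD.e_le
  have hH := one_le_horizon h
  have h1 := hD.abs_rewHat_sub_le (a := a) hs
  have h2 := hD.abs_transHat_optV_sub_le (a := a) hs
  have h3 := hD.penalty_nonneg (a := a) hs
  have h4 := hD.penalty_le_crude (a := a) hs
  have h5 : |wMean (transHat D h s a) (valueErr M μ C δ D h.succ)| ≤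
      ‖valueErr M μ C δ D h.succ‖ :=
    abs_wMean_le (hD.transHat_mem hs) fun x => norm_le_pi_norm (valueErr M μ C δ D h.succ) x
  have h6 : Real.sqrt (M.meanRew h s a) * e ≤ 1 * e :=
    mul_le_mul_of_nonneg_right (Real.sqrt_le_one.2 (hD.meanRew_mem hs).2) he.le
  have h7 : optSd M μ h s a * e ≤ 1 * e := mul_le_mul_of_nonneg_right hD.optSd_le_one he.le
  have h8 : e ^ 2 ≤ e / 8 := by nlinarith
  have h9 : e ≤ H * e := by nlinarith
  have h10 : H * e ^ 2 ≤ H * e / 8 := by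
    have := mul_le_mul_of_nonneg_left h8 (Nat.cast_nonneg H : (0 : ℝ) ≤ H)
    linarith
  rw [hD.wMean_transHat_vHat hs]
  rw [abs_le] at h1 h2 h5 ⊢
  constructor <;> linarith [h1.1, h1.2, h2.1, h2.2, h5.1, h5.2]

/-- One-step error of the pessimistic estimate. -/
lemma abs_estimate_sub_le (hs : 0 < M.stateProb μ h.castSucc s) :
    |rewHat D h s a + wMean (transHat D h s a) (vHat C δ D h.succ) -
      penalty C δ D h (vHat C δ D h.succ) s a -
      (M.meanRew h s a + wMean (M.trans h s a) (vHat C δ D h.succ))| ≤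
      4 * Real.sqrt (M.meanRew h s a) * e + 8 * optSd M μ h s a * e + 16 * e ^ 2 +
        23 * e * ‖valueErr M μ C δ D h.succ‖ + 14 * H * e ^ 2 := by
  have h1 := hD.abs_rewHat_sub_le (a := a) hs
  have h2 := hD.abs_transHat_optV_sub_le (a := a) hs
  have h3 := hD.penalty_nonneg (a := a) hs
  have h4 := hD.penalty_le_fine (a := a) hs
  have h5 := hD.abs_valueErr_sub_le (a := a) hs
  rw [hD.wMean_transHat_vHat hs, hD.wMean_trans_vHat hs]
  rw [abs_le] at h1 h2 h5 ⊢
  -- The coefficient `23` is `19` from the kernel error plus `4` from the penalty; `8` is `4 + 4`,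
  -- and `16` is `4 + 4 + 8`.
  constructor <;> linarith [h1.1, h1.2, h2.1, h2.2, h5.1, h5.2]

lemma bellman_mem (hs : 0 < M.stateProb μ h.castSucc s) :
    0 ≤ M.meanRew h s a + wMean (M.trans h s a) (M.optV μ h.succ) ∧
      M.meanRew h s a + wMean (M.trans h s a) (M.optV μ h.succ) ≤ 1 :=
  ⟨add_nonneg (hD.meanRew_mem hs).1 (wMean_nonneg (M.trans_mem h s a).1 (hD.optV_nonneg _)),
    (M.bellman_le_optV μ hs a).trans (hD.optV_le_one _ s)⟩

/-- Crude uniform bound on the error of the value estimates. -/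
lemma norm_valueErr_le (k : Fin (H + 1)) :
    ‖valueErr M μ C δ D k‖ ≤ 13 * H * e * ((H : ℝ) - (k : ℕ)) := by
  have he := hD.e_pos
  induction k using Fin.reverseInduction with
  | last => rw [valueErr_last]; simp
  | cast h ih =>
    have hstep : 13 * H * e * ((H : ℝ) - ((h.castSucc : Fin (H + 1)) : ℕ)) =
        13 * H * e + 13 * H * e * ((H : ℝ) - ((h.succ : Fin (H + 1)) : ℕ)) := by
      rw [Fin.val_castSucc, Fin.val_succ]
      push_cast
      ring
    have hB : 13 * H * e + ‖valueErr M μ C δ D h.succ‖ ≤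
        13 * H * e * ((H : ℝ) - ((h.castSucc : Fin (H + 1)) : ℕ)) := by
      rw [hstep]
      linarith
    have hB0 : 0 ≤ 13 * H * e + ‖valueErr M μ C δ D h.succ‖ := by positivity
    refine (pi_norm_le_iff_of_nonneg (hB0.trans hB)).2 fun s => ?_
    refine le_trans ?_ hB
    rw [Real.norm_eq_abs, valueErr]
    split_ifs with hs
    swap
    · rw [abs_zero]; exact hB0
    have hA : Nonempty A := ⟨(M.exists_bellman_eq_optV μ hs).choose⟩
    have hrem := one_le_remaining h
    rw [abs_le]
    constructor
    -- The lower bound uses an action optimal for the true values, the upper bound one maximizing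
    -- the estimates. Truncation is harmless, as `optV ≤ 1` is below the truncation level.
    · obtain ⟨a, ha⟩ := M.exists_bellman_eq_optV μ hs
      have h1 := (abs_le.1 (hD.abs_estimate_sub_le_crude (a := a) hs)).1
      have h2 := qBar_le_vHat C δ D h s a
      have h3 := (hD.bellman_mem (a := a) hs).2
      have h4 : M.optV μ h.castSucc s - (13 * H * e + ‖valueErr M μ C δ D h.succ‖) ≤
          qBar C δ D h (vHat C δ D h.succ) s a := by
        refine le_max_of_le_left (le_min ?_ ?_) <;> linarith
      linarith
    · obtain ⟨a, ha⟩ := exists_qBar_eq_vHat C δ D h s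
      have h1 := (abs_le.1 (hD.abs_estimate_sub_le_crude (a := a) hs)).2
      have h2 := M.bellman_le_optV μ hs a
      have h3 := (hD.bellman_mem (a := a) hs).1
      have h4 : qBar C δ D h (vHat C δ D h.succ) s a ≤
          M.optV μ h.castSucc s + (13 * H * e + ‖valueErr M μ C δ D h.succ‖) := by
        refine max_le ((min_le_left _ _).trans ?_) ?_ <;> linarith
      linarith

end AccurateData

end OfflineRL

end

/-! ### The potential argument. -/

noncomputable section

namespace OfflineRL

universe u v

lemma MDP.dataLaw_ae_reached {S : Type u} {A : Type v} [Fintype S] [Fintype A] [DecidableEq S]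
    [MeasurableSpace S] [MeasurableSpace A] [DiscreteMeasurableSpace S] {H n : ℕ} (M : MDP S A H)
    (μ : Policy S A H) : ∀ᵐ D ∂(M.dataLaw μ n),
    ∀ τ k, 0 < M.stateProb μ k ((D τ).state k) := by
  have h1 : ∀ᵐ ω ∂(M.law μ), ∀ k, 0 < M.stateProb μ k (ω.state k) := by
    refine M.ae_law μ ?_ fun p hp => Filter.Eventually.of_forall fun r k =>
      M.stateProb_pos_of_path μ hp k
    rw [show {ω : Trajectory S A H | ∀ k, 0 < M.stateProb μ k (ω.state k)} =
      ⋂ k, {ω | 0 < M.stateProb μ k (ω.state k)} by ext; simp]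
    exact MeasurableSet.iInter fun k => measurableSet_lt measurable_const
      ((Measurable.of_discrete (f := M.stateProb μ k)).comp (Trajectory.measurable_state k))
  rw [ae_all_iff]
  intro τ
  exact (Measure.quasiMeasurePreserving_eval (fun _ : Fin n => M.law μ) τ).ae h1

variable {S : Type u} {A : Type v} [Fintype S] [Fintype A] [DecidableEq S] [DecidableEq A]
  {H n : ℕ}

/-- Potential function dominating the accumulated one-step errors. -/
def potential (M : MDP S A H) (μ : Policy S A H) (l c : ℝ) (k : Fin (H + 1)) (s : S) : ℝ :=
  4 * l * (3 * M.optV μ k s - M.optV μ k s ^ 2) + ((H : ℝ) - (k : ℕ)) * c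

namespace AccurateData

variable [MeasurableSpace S] [MeasurableSpace A] {M : MDP S A H} {μ : Policy S A H} {C δ L e : ℝ}
  {D : Fin n → Trajectory S A H} (hD : AccurateData M μ C δ L e D) {l c : ℝ}

include hD

lemma potential_nonneg (hl : 0 ≤ l) (hc : 0 ≤ c) (k : Fin (H + 1)) (s : S) :
    0 ≤ potential M μ l c k s := by
  have h0 := hD.optV_nonneg k s
  have h1 := hD.optV_le_one k s
  have h2 : ((k : ℕ) : ℝ) ≤ H := by exact_mod_cast Nat.lt_succ_iff.1 k.isLt
  refine add_nonneg (mul_nonneg (by positivity) (by nlinarith)) (mul_nonneg (by linarith) hc)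

lemma potential_le (hl : 0 ≤ l) (s : S) : potential M μ l c 0 s ≤ 8 * l + H * c := by
  have h0 := hD.optV_nonneg 0 s
  have h1 := hD.optV_le_one 0 s
  have h2 : 3 * M.optV μ 0 s - M.optV μ 0 s ^ 2 ≤ 2 := by nlinarith
  have h3 := mul_le_mul_of_nonneg_left h2 (by positivity : 0 ≤ 4 * l)
  simp only [potential, Fin.val_zero, Nat.cast_zero, sub_zero]
  linarith

/-- The potential decreases by at least the one-step error. -/
lemma error_add_potential_le (hl : 0 < l)
    (hc : 6 * (e ^ 2 / l) + 329 * H ^ 2 * e ^ 2 ≤ c) {h : Fin H} {s : S} {a : A}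
    (hs : 0 < M.stateProb μ h.castSucc s) :
    4 * Real.sqrt (M.meanRew h s a) * e + 8 * optSd M μ h s a * e + 16 * e ^ 2 +
        23 * e * ‖valueErr M μ C δ D h.succ‖ + 14 * H * e ^ 2 +
      wMean (M.trans h s a) (potential M μ l c h.succ) ≤ potential M μ l c h.castSucc s := by
  obtain ⟨hr0, hr1⟩ := hD.meanRew_mem (a := a) hs
  have he := hD.e_pos
  have hH := one_le_horizon h
  set r := M.meanRew h s a
  set x := wMean (M.trans h s a) (M.optV μ h.succ) with hx
  have hσ := optSd_sq M μ h s a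
  rw [wVar_eq (M.trans_mem h s a), ← hx] at hσ
  set σ := optSd M μ h s a
  have hbell := M.bellman_le_optV μ hs a
  have hV1 := hD.optV_le_one h.castSucc s
  have hx0 : 0 ≤ x := wMean_nonneg (M.trans_mem h s a).1 (hD.optV_nonneg _)
  have hpot : wMean (M.trans h s a) (potential M μ l c h.succ) =
      4 * l * (3 * x - (σ ^ 2 + x ^ 2)) + ((H : ℝ) - (h : ℕ) - 1) * c := by
    have h1 : (fun y => potential M μ l c h.succ y) = fun y =>
        (4 * l * (3 * M.optV μ h.succ y - M.optV μ h.succ y ^ 2)) + ((H : ℝ) - (h : ℕ) - 1) * c := by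
      funext y
      simp only [potential, Fin.val_succ]
      push_cast
      ring
    change wMean (M.trans h s a) (fun y => potential M μ l c h.succ y) = _
    rw [h1, wMean_add, wMean_const_mul, wMean_sub, wMean_const_mul,
      wMean_const (M.trans_mem h s a), hσ]
    ring
  -- Applied to `√r` (twice) and to `σ` (four times), this leaves `2lr + 4lσ² + 6e²/l`. The first
  -- two terms are covered by the drop of `4l(3V - V²)`, the last by `c`.
  have ham : ∀ y : ℝ, 2 * (y * e) ≤ l * y ^ 2 + e ^ 2 / l := by
    intro y
    have h1 : l * (e ^ 2 / l) = e ^ 2 := mul_div_cancel₀ _ hl.ne'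
    have h2 : l * (2 * (y * e)) ≤ l * (l * y ^ 2 + e ^ 2 / l) := by
      rw [mul_add, h1]
      nlinarith [sq_nonneg (l * y - e)]
    exact le_of_mul_le_mul_left h2 hl
  have h1 := ham (Real.sqrt r)
  rw [Real.sq_sqrt hr0] at h1
  have h2 := ham σ
  -- Multiplied by `23e`, the crude bound gives `299 H² e²`; with `16e²` and `14He²` this makes the
  -- `329 H² e²` in `c`.
  have h3 : ‖valueErr M μ C δ D h.succ‖ ≤ 13 * H ^ 2 * e := by
    refine (hD.norm_valueErr_le h.succ).trans ?_
    have : (H : ℝ) - ((h.succ : Fin (H + 1)) : ℕ) ≤ H := by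
      linarith [Nat.cast_nonneg (α := ℝ) ((h.succ : Fin (H + 1)) : ℕ)]
    calc 13 * H * e * ((H : ℝ) - ((h.succ : Fin (H + 1)) : ℕ)) ≤ 13 * H * e * H :=
          mul_le_mul_of_nonneg_left this (by positivity)
      _ = _ := by ring
  have h4 : 23 * e * ‖valueErr M μ C δ D h.succ‖ ≤ 23 * e * (13 * H ^ 2 * e) :=
    mul_le_mul_of_nonneg_left h3 (by positivity)
  have h5 : (H : ℝ) * e ^ 2 ≤ H ^ 2 * e ^ 2 :=
    mul_le_mul_of_nonneg_right (by nlinarith) (sq_nonneg e)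
  have h6 : e ^ 2 ≤ H ^ 2 * e ^ 2 := by nlinarith [sq_nonneg e]
  -- The map `y ↦ 3y - y²` has slope at least one on `[0, 1]`, and `r + x ≤ V ≤ 1`.
  have hmono : r + (3 * x - x ^ 2) ≤ 3 * M.optV μ h.castSucc s - M.optV μ h.castSucc s ^ 2 := by
    nlinarith
  have hmono' := mul_le_mul_of_nonneg_left hmono (by positivity : 0 ≤ 4 * l)
  have hlr : 0 ≤ l * r := by positivity
  rw [hpot]
  simp only [potential, Fin.val_castSucc]
  nlinarith

lemma optV_le_vHat_add_potential (hl : 0 < l) (hc : 6 * (e ^ 2 / l) + 329 * H ^ 2 * e ^ 2 ≤ c)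
    (hc0 : 0 ≤ c) (k : Fin (H + 1)) : ∀ s, 0 < M.stateProb μ k s →
      M.optV μ k s ≤ vHat C δ D k s + potential M μ l c k s := by
  induction k using Fin.reverseInduction with
  | last => intro s _; simp [potential, vHat_last, MDP.optV_last]
  | cast h ih =>
    intro s hs
    obtain ⟨a, ha⟩ := M.exists_bellman_eq_optV μ hs
    have h1 : wMean (M.trans h s a) (M.optV μ h.succ) ≤ wMean (M.trans h s a) (vHat C δ D h.succ) +
        wMean (M.trans h s a) (potential M μ l c h.succ) := by
      rw [← wMean_add]
      exact wMean_mono (M.trans_mem h s a).1 fun x hx => ih x (hD.stateProb_pos_of_trans hs hx)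
    have h2 := (abs_le.1 (hD.abs_estimate_sub_le (a := a) hs)).1
    have h3 := hD.error_add_potential_le hl hc (a := a) hs
    have h4 := qBar_le_vHat C δ D h s a
    have h5 := hD.optV_le_one h.castSucc s
    have h6 := hD.potential_nonneg hl.le hc0 h.castSucc s
    have h7 := one_le_remaining h
    have h8 : M.optV μ h.castSucc s - potential M μ l c h.castSucc s ≤
        qBar C δ D h (vHat C δ D h.succ) s a := by
      refine le_max_of_le_left (le_min ?_ ?_) <;> linarith
    linarith

variable [DiscreteMeasurableSpace S] [DiscreteMeasurableSpace A]

/-- Suboptimality of any output of the algorithm. -/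
lemma optValue_sub_value_le (hreach : ∀ (π : Policy S A H) (h : Fin H) s,
      0 < M.stateProb π h.castSucc s → 0 < M.stateProb μ h.castSucc s)
    (hl : 0 < l) (hc : 6 * (e ^ 2 / l) + 329 * H ^ 2 * e ^ 2 ≤ c) {π : Policy S A H}
    (hπ : IsAPVIOutput C δ D π) :
    0 ≤ M.optValue - M.value π ∧ M.optValue - M.value π ≤ 2 * (8 * l + H * c) := by
  have he := hD.e_pos
  have hc0 : 0 ≤ c := le_trans (by positivity) hc
  have hle : ∀ π' : Policy S A H, M.value π' ≤ ∑ s, M.init s * M.optV μ 0 s := by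
    intro π'
    refine hD.bounded.value_le π' _ (M.optV_last μ) fun h s hs => ?_
    have hs' := hreach π' h s hs
    calc _ ≤ ∑ a, π'.prob h s a * M.optV μ h.castSucc s := Finset.sum_le_sum fun a _ =>
          mul_le_mul_of_nonneg_left (M.bellman_le_optV μ hs' a) ((π'.prob_mem h s).1 a)
      _ = M.optV μ h.castSucc s := by rw [← Finset.sum_mul, (π'.prob_mem h s).2, one_mul]
  have hne : Nonempty (Policy S A H) := ⟨μ⟩
  have hopt : M.optValue ≤ ∑ s, M.init s * M.optV μ 0 s := ciSup_le hle
  -- The potential pays for the error at every action, so `vHat - potential` is a subsolution along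
  -- the learned policy, whichever actions it takes.
  have hval : ∑ s, M.init s * (vHat C δ D 0 s - potential M μ l c 0 s) ≤ M.value π := by
    refine hD.bounded.le_value π (fun k s => vHat C δ D k s - potential M μ l c k s) ?_ ?_
    · intro s
      simp [potential, vHat_last, MDP.optV_last]
    · intro h s hs
      have hs' := hreach π h s hs
      have h1 : vHat C δ D h.castSucc s - potential M μ l c h.castSucc s =
          ∑ a, π.prob h s a * (qBar C δ D h (vHat C δ D h.succ) s a -
            potential M μ l c h.castSucc s) := by
        simp only [mul_sub, Finset.sum_sub_distrib, ← Finset.sum_mul, (π.prob_mem h s).2, one_mul]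
        rw [hπ.vHat_castSucc_eq]
        congr 1
        exact Finset.sum_congr rfl fun a _ => mul_comm _ _
      rw [h1]
      refine Finset.sum_le_sum fun a _ => mul_le_mul_of_nonneg_left ?_ ((π.prob_mem h s).1 a)
      rw [wMean_sub]
      have h2 := (abs_le.1 (hD.abs_estimate_sub_le (a := a) hs')).2
      have h3 := hD.error_add_potential_le hl hc (a := a) hs'
      have h4 := (hD.meanRew_mem (a := a) hs').1
      have h5 : 0 ≤ wMean (M.trans h s a) (vHat C δ D h.succ) :=
        wMean_nonneg (M.trans_mem h s a).1 (vHat_nonneg C δ D _)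
      have h6 : 0 ≤ 4 * Real.sqrt (M.meanRew h s a) * e + 8 * optSd M μ h s a * e + 16 * e ^ 2 +
          23 * e * ‖valueErr M μ C δ D h.succ‖ + 14 * H * e ^ 2 := by
        have := optSd_nonneg M μ h s a
        positivity
      have h7 : qBar C δ D h (vHat C δ D h.succ) s a ≤
          M.meanRew h s a + wMean (M.trans h s a) (vHat C δ D h.succ) +
          (4 * Real.sqrt (M.meanRew h s a) * e + 8 * optSd M μ h s a * e + 16 * e ^ 2 +
            23 * e * ‖valueErr M μ C δ D h.succ‖ + 14 * H * e ^ 2) := by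
        refine max_le ((min_le_left _ _).trans ?_) ?_ <;> linarith
      linarith
  refine ⟨sub_nonneg.2 (le_ciSup (f := fun π' => M.value π') ⟨∑ s, M.init s * M.optV μ 0 s, ?_⟩ π), ?_⟩
  · rintro _ ⟨π', rfl⟩
    exact hle π'
  · have h1 : ∑ s, M.init s * M.optV μ 0 s ≤
        ∑ s, (M.init s * (vHat C δ D 0 s - potential M μ l c 0 s) +
          M.init s * (2 * (8 * l + H * c))) := by
      refine Finset.sum_le_sum fun s _ => ?_
      rcases (M.init_mem.1 s).eq_or_lt with h0 | h0
      · rw [← h0]; simp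
      · rw [← mul_add]
        refine mul_le_mul_of_nonneg_left ?_ h0.le
        have h2 := hD.optV_le_vHat_add_potential hl hc hc0 0 s (by rw [MDP.stateProb_zero]; exact h0)
        have h3 := hD.potential_le (c := c) hl.le s
        linarith
    rw [Finset.sum_add_distrib, ← Finset.sum_mul, M.init_mem.2, one_mul] at h1
    linarith

end AccurateData

/-! ### Probability of the good event. -/

section Probability

variable [MeasurableSpace S] [MeasurableSpace A] [DiscreteMeasurableSpace S]
  [DiscreteMeasurableSpace A] {M : MDP S A H} {μ : Policy S A H}

lemma measurable_valueErr (C δ : ℝ) (k : Fin (H + 1)) (s : S) :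
    Measurable fun D : Fin n → Trajectory S A H => valueErr M μ C δ D k s := by
  unfold valueErr
  split_ifs
  · exact (measurable_vHat C δ k s).sub_const _
  · exact measurable_const

/-- The concentration inequalities hold with high probability. -/
lemma dataLaw_not_goodData_le (hM : M.BoundedTotalReward)
    (hμ : ∀ (h : Fin H) s a, 0 < M.stateProb μ h.castSucc s → 0 < μ.prob h s a) (C δ : ℝ)
    {L : ℝ} (hL : 0 ≤ L) :
    M.dataLaw μ n {D | ¬ GoodData M μ C δ L D} ≤
      (H * Fintype.card S * Fintype.card A : ℕ) * (10 * ENNReal.ofReal (Real.exp (-L))) := by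
  have hV0 := fun k s => hM.optV_nonneg hμ k s
  have hV1 := fun k s => hM.optV_le_one hμ k s
  set E := ENNReal.ofReal (Real.exp (-L)) with hE
  have hloc : ∀ x : Fin H × S × A, ∃ B : Set (Fin n → Trajectory S A H),
      M.dataLaw μ n B ≤ 10 * E ∧ ∀ D, D ∉ B → 0 < M.stateProb μ x.1.castSucc x.2.1 →
      |(count D x.1 x.2.1 x.2.2 : ℝ) -
          n * (M.stateProb μ x.1.castSucc x.2.1 * μ.prob x.1 x.2.1 x.2.2)| ≤ 2 * Real.sqrt
        (n * (M.stateProb μ x.1.castSucc x.2.1 * μ.prob x.1 x.2.1 x.2.2) * L) + 2 * L ∧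
      |∑ τ, visit x.1 x.2.1 x.2.2 (D τ) * ((D τ).rew x.1 - M.meanRew x.1 x.2.1 x.2.2)| ≤
        2 * Real.sqrt (n * (M.stateProb μ x.1.castSucc x.2.1 * μ.prob x.1 x.2.1 x.2.2 *
          M.meanRew x.1 x.2.1 x.2.2) * L) + 2 * L ∧
      |∑ τ, visit x.1 x.2.1 x.2.2 (D τ) * (M.optV μ x.1.succ ((D τ).state x.1.succ) -
        wMean (M.trans x.1 x.2.1 x.2.2) (M.optV μ x.1.succ))| ≤ 2 * Real.sqrt
        (n * (M.stateProb μ x.1.castSucc x.2.1 * μ.prob x.1 x.2.1 x.2.2 *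
          optSd M μ x.1 x.2.1 x.2.2 ^ 2) * L) + 2 * L ∧
      |∑ τ, visit x.1 x.2.1 x.2.2 (D τ) * ((M.optV μ x.1.succ ((D τ).state x.1.succ) -
        wMean (M.trans x.1 x.2.1 x.2.2) (M.optV μ x.1.succ)) ^ 2 -
          optSd M μ x.1 x.2.1 x.2.2 ^ 2)| ≤ 2 * Real.sqrt
        (n * (M.stateProb μ x.1.castSucc x.2.1 * μ.prob x.1 x.2.1 x.2.2 *
          optSd M μ x.1 x.2.1 x.2.2 ^ 2) * L) + 2 * L ∧
      |∑ τ, valueErr M μ C δ D x.1.succ ((D τ).state x.1.succ) / ‖valueErr M μ C δ D x.1.succ‖ *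
        (visit x.1 x.2.1 x.2.2 (D τ) - M.backProb μ x.1 x.2.1 x.2.2 ((D τ).state x.1.succ))| ≤
        2 * Real.sqrt ((∑ τ, M.backProb μ x.1 x.2.1 x.2.2 ((D τ).state x.1.succ)) * L) +
          2 * L := by
    rintro ⟨h, s, a⟩
    by_cases hs : 0 < M.stateProb μ h.castSucc s
    swap
    · exact ⟨∅, by simp, fun D _ hD => absurd hD hs⟩
    have hq : 0 < M.stateProb μ h.castSucc s * μ.prob h s a := mul_pos hs (hμ h s a hs)
    have hp := M.trans_mem h s a
    set V := M.optV μ h.succ with hV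
    set m := wMean (M.trans h s a) V with hm
    have hm0 : 0 ≤ m := wMean_nonneg hp.1 (hV0 _)
    have hm1 : m ≤ 1 := by
      rw [← wMean_const hp 1]
      exact wMean_mono hp.1 fun x _ => hV1 _ x
    have hdev : ∀ x, |V x - m| ≤ 1 := fun x => by
      have := hV0 h.succ x
      have := hV1 h.succ x
      rw [abs_le]
      constructor <;> linarith
    have hdev2 : ∀ x, (V x - m) ^ 2 ≤ 1 := fun x => by
      rw [← sq_abs]
      exact pow_le_one₀ (abs_nonneg _) (hdev x)
    have hσ : wMean (M.trans h s a) (fun x => (V x - m) ^ 2) = optSd M μ h s a ^ 2 :=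
      (optSd_sq M μ h s a).symm
    have hσ1 : optSd M μ h s a ^ 2 ≤ 1 := by
      rw [← hσ, ← wMean_const hp 1]
      exact wMean_mono hp.1 fun x _ => hdev2 x
    have hσ0 := sq_nonneg (optSd M μ h s a)
    set v := optSd M μ h s a ^ 2 with hv
    have b1 := M.dataLaw_count μ (n := n) h s a hL
    have b2 := MDP.dataLaw_rew μ (n := n) hM hq hL
    have b3 := M.dataLaw_state μ (n := n) h s a (f := fun x => V x - m) hdev
      (by rw [wMean_sub, wMean_const hp, hm, sub_self]) hσ.le hL
    have b4 := M.dataLaw_state μ (n := n) h s a (f := fun x => (V x - m) ^ 2 - v)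
      (fun x => by
        have := sq_nonneg (V x - m)
        have := hdev2 x
        rw [abs_le]
        constructor <;> linarith)
      (by rw [wMean_sub, wMean_const hp, hσ, sub_self]) (v := v)
      (by
        -- Squared deviations lie in `[0, 1]` with mean `v = σ²`, so their variance is again at most
        -- `σ²`.
        calc wMean (M.trans h s a) (fun x => ((V x - m) ^ 2 - v) ^ 2)
            ≤ wMean (M.trans h s a) (fun x => (1 - 2 * v) * (V x - m) ^ 2 + v ^ 2) := by
              refine wMean_mono hp.1 fun x _ => ?_
              have := sq_nonneg (V x - m)
              have := hdev2 x
              nlinarith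
          _ = (1 - 2 * v) * v + v ^ 2 := by
              rw [wMean_add, wMean_const_mul, hσ, wMean_const hp]
          _ ≤ v := by nlinarith) hL
    have b5 := M.dataLaw_weighted μ (n := n) h s a
      (w := fun D x => valueErr M μ C δ D h.succ x / ‖valueErr M μ C δ D h.succ‖)
      (fun x => (measurable_valueErr C δ h.succ x).div
        (measurable_norm.comp (measurable_pi_lambda _ fun y => measurable_valueErr C δ h.succ y)))
      (fun D x => by
        rw [abs_div, abs_norm]
        exact div_le_one_of_le₀ (norm_le_pi_norm (valueErr M μ C δ D h.succ) x) (norm_nonneg _))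
      (fun D => by
        -- The weight at `h + 1` is a function of the data after step `h`, which is what permits
        -- freezing it.
        have : valueErr M μ C δ (fun τ => (D τ).tail h s a) h.succ =
            valueErr M μ C δ D h.succ := by
          funext x
          rw [valueErr, valueErr, vHat_tail C δ D h s a h.succ Fin.castSucc_lt_succ]
        simp only [this]) hL
    refine ⟨_, (measure_union_le _ _).trans (add_le_add b1 ((measure_union_le _ _).trans
      (add_le_add b2 ((measure_union_le _ _).trans (add_le_add b3
        ((measure_union_le _ _).trans (add_le_add b4 b5))))))) |>.trans_eq ?_, ?_⟩
    · rw [← hE]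
      ring
    · intro D hD _
      simp only [Set.mem_union, Set.mem_ofPred_eq, not_or, not_lt] at hD
      exact hD
  choose B hB1 hB2 using hloc
  have hsub : {D | ¬ GoodData M μ C δ L D} ⊆
      {D | ¬ ∀ τ k, 0 < M.stateProb μ k ((D τ).state k)} ∪ ⋃ x, B x := by
    intro D hD
    by_contra hne
    simp only [Set.mem_union, Set.mem_ofPred_eq, not_or, not_not, Set.mem_iUnion,
      not_exists] at hne
    refine hD ⟨hne.1, ?_, ?_, ?_, ?_, ?_⟩
    · exact fun h s a hs => (hB2 (h, s, a) D (hne.2 _) hs).1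
    · exact fun h s a hs => (hB2 (h, s, a) D (hne.2 _) hs).2.1
    · exact fun h s a hs => (hB2 (h, s, a) D (hne.2 _) hs).2.2.1
    · exact fun h s a hs => (hB2 (h, s, a) D (hne.2 _) hs).2.2.2.1
    · exact fun h s a hs => (hB2 (h, s, a) D (hne.2 _) hs).2.2.2.2
  refine (measure_mono hsub).trans ((measure_union_le _ _).trans ?_)
  -- Visiting only reached states is an almost sure event; the union bound runs over the five
  -- two-sided inequalities at each of the `HSA` triples.
  rw [show M.dataLaw μ n {D | ¬ ∀ τ k, 0 < M.stateProb μ k ((D τ).state k)} = 0 from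
    ae_iff.1 (M.dataLaw_ae_reached μ), zero_add]
  refine (measure_iUnion_fintype_le _ _).trans ((Finset.sum_le_sum fun x _ => hB1 x).trans_eq ?_)
  rw [Finset.sum_const, Finset.card_univ, Fintype.card_prod, Fintype.card_prod, Fintype.card_fin,
    nsmul_eq_mul, mul_assoc H]

end Probability

end OfflineRL

end

/-! ### Degenerate cases, numerical constants and the final assembly. -/

noncomputable section

namespace OfflineRL

universe u v

variable {S : Type u} {A : Type v} [Fintype A] {H n : ℕ}

lemma Policy.eq_of_subsingleton [Subsingleton A] (π π' : Policy S A H) : π = π' := by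
  obtain ⟨p, hp⟩ := π
  obtain ⟨p', hp'⟩ := π'
  have : p = p' := by
    funext h s a
    have h1 := (hp h s).2
    have h2 := (hp' h s).2
    rw [Fintype.sum_subsingleton _ a] at h1 h2
    rw [h1, h2]
  subst this
  rfl

variable [Fintype S] [MeasurableSpace S] [MeasurableSpace A] {M : MDP S A H} {μ : Policy S A H}

lemma MDP.dMin_le [DecidableEq S] [DiscreteMeasurableSpace S] [DiscreteMeasurableSpace A]
    {h : Fin H} {s : S} (hs : M.Reachable h s) (a : A) :
    M.dMin μ ≤ M.stateProb μ h.castSucc s * μ.prob h s a := by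
  rw [← M.occ_eq]
  refine csInf_le ⟨0, ?_⟩ ⟨h, s, a, hs, rfl⟩
  rintro _ ⟨h', s', a', -, rfl⟩
  rw [M.occ_eq]
  exact mul_nonneg (M.stateProb_nonneg μ _ _) ((μ.prob_mem h' s').1 a')

/-- With horizon zero the infimum is over the empty set, and the real `sInf ∅` is zero. -/
lemma MDP.UniformCoverage.horizon_pos (hμ : M.UniformCoverage μ) : 0 < H := by
  rcases Nat.eq_zero_or_pos H with rfl | hH
  · exfalso
    unfold UniformCoverage dMin at hμ
    rw [show {x | ∃ h s a, M.Reachable h s ∧ x = M.occ μ h s a} = ∅ by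
      ext x
      simp only [Set.mem_ofPred_eq, Set.mem_empty_iff_false, iff_false]
      rintro ⟨h, -⟩
      exact h.elim0, Real.sInf_empty] at hμ
    exact lt_irrefl _ hμ
  · exact hH

variable [DecidableEq S] [DecidableEq A]

/-- Numerical form of the union bound. -/
lemma union_bound_le {N : ℕ} (hN : 2 ≤ N) {δ : ℝ} (hδ0 : 0 < δ) (hδ1 : δ < 1) :
    (N : ENNReal) * (10 * ENNReal.ofReal (Real.exp (-(5 * Real.log (N / δ))))) ≤
      ENNReal.ofReal δ := by
  have hN' : (2 : ℝ) ≤ N := by exact_mod_cast hN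
  set x : ℝ := δ / N with hx
  have hx0 : 0 < x := by positivity
  have hx1 : x ≤ 1 / 2 := by
    rw [hx, div_le_iff₀ (by linarith)]
    linarith
  have hexp : Real.exp (-(5 * Real.log (N / δ))) = x ^ 5 := by
    have h1 : -(5 * Real.log (N / δ)) = ((5 : ℕ) : ℝ) * Real.log x := by
      rw [hx, ← inv_div, Real.log_inv]
      push_cast
      ring
    rw [h1, Real.exp_nat_mul, Real.exp_log hx0]
  rw [hexp, ← ENNReal.ofReal_natCast N,
    show (10 : ENNReal) = ENNReal.ofReal 10 by simp,
    ← ENNReal.ofReal_mul (by norm_num), ← ENNReal.ofReal_mul (by positivity)]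
  apply ENNReal.ofReal_le_ofReal
  have hδ : δ = N * x := by
    rw [hx, mul_div_cancel₀ _ (by linarith)]
  -- As `10 / 16 < 1`, the factor `10` is absorbed; this is where `N ≥ 2` enters.
  have h4 : x ^ 4 ≤ (1 / 2) ^ 4 := pow_le_pow_left₀ hx0.le hx1 4
  calc (N : ℝ) * (10 * x ^ 5) = N * x * (10 * x ^ 4) := by ring
    _ ≤ N * x * 1 := mul_le_mul_of_nonneg_left (by linarith) (by positivity)
    _ = δ := by rw [mul_one, ← hδ]

/-- Explicit form of the suboptimality bound. -/
lemma regret_constant_le {H ι m : ℝ} (hH : 0 < H) (hι : 0 < ι) (hm : 0 < m) :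
    2 * (8 * (Real.sqrt (5 * ι / m) * Real.sqrt H) +
      H * (6 * (Real.sqrt (5 * ι / m) ^ 2 / (Real.sqrt (5 * ι / m) * Real.sqrt H)) +
        329 * H ^ 2 * Real.sqrt (5 * ι / m) ^ 2)) ≤
      84 * Real.sqrt (H * ι / m) + 3290 * (H ^ 3 * ι / m) := by
  have he : 0 < Real.sqrt (5 * ι / m) := Real.sqrt_pos.2 (by positivity)
  have hsH : 0 < Real.sqrt H := Real.sqrt_pos.2 hH
  have hHH : Real.sqrt H * Real.sqrt H = H := Real.mul_self_sqrt hH.le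
  have h1 : H * (Real.sqrt (5 * ι / m) ^ 2 / (Real.sqrt (5 * ι / m) * Real.sqrt H)) =
      Real.sqrt (5 * ι / m) * Real.sqrt H := by
    field_simp
    rw [sq, hHH]
  have h2 : Real.sqrt (5 * ι / m) ^ 2 = 5 * ι / m := Real.sq_sqrt (by positivity)
  have h3 : Real.sqrt (5 * ι / m) * Real.sqrt H ≤ 3 * Real.sqrt (H * ι / m) := by
    rw [← Real.sqrt_mul (by positivity), Real.sqrt_le_left (by positivity), mul_pow,
      Real.sq_sqrt (by positivity)]
    have : 5 * ι / m * H = 5 * (H * ι / m) := by ring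
    have h0 : 0 < H * ι / m := by positivity
    linarith
  have h4 : H * (329 * H ^ 2 * (5 * ι / m)) = 1645 * (H ^ 3 * ι / m) := by ring
  calc _ = 28 * (Real.sqrt (5 * ι / m) * Real.sqrt H) +
        2 * (H * (329 * H ^ 2 * Real.sqrt (5 * ι / m) ^ 2)) := by
        linear_combination 12 * h1
    _ ≤ _ := by
        rw [h2, h4]
        linarith

end OfflineRL

end

theorem mainTheorem8 :
    ∃ c₀ C₁ C₂ : ℝ, 0 < c₀ ∧ 0 < C₁ ∧ 0 < C₂ ∧
      ∀ (S : Type*) (A : Type*) [Fintype S] [Fintype A] [DecidableEq S] [DecidableEq A]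
        [MeasurableSpace S] [MeasurableSpace A] [DiscreteMeasurableSpace S]
        [DiscreteMeasurableSpace A]
        (H n : ℕ) (M : OfflineRL.MDP S A H) (μ : OfflineRL.Policy S A H) (C δ : ℝ),
        0 < C → 0 < δ → δ < 1 →
        M.BoundedTotalReward →
        M.UniformCoverage μ →
        c₀ * (1 / M.dMin μ) * OfflineRL.logTerm S A H δ < (n : ℝ) →
        M.dataLaw μ n
          {D | ¬ ∀ π : OfflineRL.Policy S A H, OfflineRL.IsAPVIOutput C δ D π →
            0 ≤ M.optValue - M.value π ∧
            M.optValue - M.value π ≤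
              C₁ * Real.sqrt (H * OfflineRL.logTerm S A H δ / (n * M.dMin μ)) +
              C₂ * (H ^ 3 * OfflineRL.logTerm S A H δ / (n * M.dMin μ))}
          ≤ ENNReal.ofReal δ := by
  -- `320 = 5 · 64` ensures `e ≤ 1 / 8`. The others are `84 = 2 · (8 + 6) · 3`, with `√5 ≤ 3`, and
  -- `3290 = 2 · 329 · 5`.
  refine ⟨320, 84, 3290, by norm_num, by norm_num, by norm_num, ?_⟩
  intro S A _ _ _ _ _ _ _ _ H n M μ C δ hC hδ0 hδ1 hM hμ hn
  have hH : 0 < H := hμ.horizon_pos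
  have hd : 0 < M.dMin μ := hμ
  have hcov : ∀ (h : Fin H) s, M.Reachable h s → ∀ a,
      M.dMin μ ≤ M.stateProb μ h.castSucc s * μ.prob h s a := fun h s hs a => M.dMin_le hs a
  have hreachable : ∀ (π : OfflineRL.Policy S A H) (h : Fin H) s,
      0 < M.stateProb π h.castSucc s → M.Reachable h s := fun π h s hs =>
    ⟨π, by rw [M.stateOcc_eq]; exact hs⟩
  obtain ⟨s₀, -, hs₀⟩ : ∃ s ∈ Finset.univ, M.init s ≠ 0 :=
    Finset.exists_ne_zero_of_sum_ne_zero (by rw [M.init_mem.2]; exact one_ne_zero)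
  have hA : Nonempty A := by
    by_contra hne
    rw [not_nonempty_iff] at hne
    simpa using (μ.prob_mem ⟨0, hH⟩ s₀).2
  have hS : Nonempty S := ⟨s₀⟩
  have hprob : ∀ (h : Fin H) s a, 0 < M.stateProb μ h.castSucc s → 0 < μ.prob h s a := by
    intro h s a hs
    exact (pos_iff_pos_of_mul_pos (hd.trans_le (hcov h s (hreachable μ h s hs) a))).1 hs
  have hreach : ∀ (π : OfflineRL.Policy S A H) (h : Fin H) s,
      0 < M.stateProb π h.castSucc s → 0 < M.stateProb μ h.castSucc s := by
    intro π h s hs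
    have h1 := hd.trans_le (hcov h s (hreachable π h s hs) hA.some)
    exact pos_of_mul_pos_left h1 ((μ.prob_mem h s).1 _)
  have hcS : 1 ≤ Fintype.card S := Fintype.card_pos
  have hcA : 1 ≤ Fintype.card A := Fintype.card_pos
  set N : ℕ := H * Fintype.card S * Fintype.card A with hN
  have hlog : OfflineRL.logTerm S A H δ = Real.log (N / δ) := by
    rw [OfflineRL.logTerm, hN]
    push_cast
    rfl
  have hN1 : 1 ≤ N := Nat.mul_pos (Nat.mul_pos hH hcS) hcA
  have hι : 0 < OfflineRL.logTerm S A H δ := by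
    rw [hlog]
    apply Real.log_pos
    rw [lt_div_iff₀ hδ0]
    have : (1 : ℝ) ≤ N := by exact_mod_cast hN1
    linarith
  set ι := OfflineRL.logTerm S A H δ with hιdef
  have hn0 : (0 : ℝ) < n := lt_trans (by positivity) hn
  have hm : 0 < n * M.dMin μ := by positivity
  -- With a single action there is only one policy and nothing to lose. Otherwise `HSA ≥ 2`, as the
  -- numerical union bound requires.
  rcases subsingleton_or_nontrivial A with hsub | hnt
  · refine le_trans (le_of_eq ?_) (zero_le)
    convert measure_empty (μ := M.dataLaw μ n)
    ext D
    simp only [Set.mem_ofPred_eq, Set.mem_empty_iff_false, iff_false, not_not]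
    intro π _
    have hval : M.optValue = M.value π := by
      have : Nonempty (OfflineRL.Policy S A H) := ⟨π⟩
      rw [OfflineRL.MDP.optValue, show (fun π' => M.value π') = fun _ => M.value π by
        funext π'; rw [OfflineRL.Policy.eq_of_subsingleton π' π], ciSup_const]
    rw [hval, sub_self]
    exact ⟨le_rfl, by positivity⟩
  · have hcA2 : 2 ≤ Fintype.card A := Fintype.one_lt_card
    have hN2 : 2 ≤ N := hcA2.trans (Nat.le_mul_of_pos_left _ (Nat.mul_pos hH hcS))
    have hgood := OfflineRL.dataLaw_not_goodData_le (n := n) hM hprob C δ (L := 5 * ι)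
      (by positivity)
    rw [← hN, hlog] at hgood
    refine le_trans (measure_mono ?_) (hgood.trans (OfflineRL.union_bound_le hN2 hδ0 hδ1))
    rw [← hlog]
    intro D hD hG
    refine hD fun π hπ => ?_
    set e := Real.sqrt (5 * ι / (n * M.dMin μ)) with he
    have he0 : 0 < e := Real.sqrt_pos.2 (by positivity)
    have hsq : e ^ 2 = 5 * ι / (n * M.dMin μ) := Real.sq_sqrt (by positivity)
    have he8 : e ≤ 1 / 8 := by
      rw [he, Real.sqrt_le_left (by norm_num), div_le_iff₀ hm]
      have h1 : 320 * ι < n * M.dMin μ := by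
        rw [mul_one_div, div_mul_eq_mul_div, div_lt_iff₀ hd] at hn
        exact hn
      linarith
    have hacc : OfflineRL.AccurateData M μ C δ (5 * ι) e D := by
      refine ⟨hM, hprob, hG, by exact_mod_cast hn0, he0, he8, hι.le, by linarith, ?_⟩
      intro h s a hs
      rw [hsq, div_mul_eq_mul_div, le_div_iff₀ hm]
      have := hcov h s (hreachable μ h s hs) a
      gcongr
    have hHr : (0 : ℝ) < H := by exact_mod_cast hH
    -- The choice `l = e √H` balances `l` against `H e² / l` in the bound `8l + Hc`.
    have hl : 0 < e * Real.sqrt H := mul_pos he0 (Real.sqrt_pos.2 hHr)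
    obtain ⟨h1, h2⟩ := hacc.optValue_sub_value_le hreach hl le_rfl hπ
    exact ⟨h1, h2.trans (OfflineRL.regret_constant_le hHr hι hm)⟩
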